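/- A one-dimensional sandpile model consists of a finite set $\mathcal N\subset\mathbb Z\setminus\{0\}$ such that every integer is a nonnegative integer combination of elements of $\mathcal N$, and of a function $\mathcal D:\mathcal N\to\{1,2,3,\dots\}$; put $\theta=\sum_{v\in\mathcal N}\mathcal D(v)$. Its global rule $F$ maps a configuration $c:\mathbb Z\to\mathbb N$ to $$F(c)(x)=c(x)-\theta\,[c(x)\ge\theta]+\sum_{v\in\mathcal N}\mathcal D(v)\,[c(x-v)\ge\theta]\qquad(x\in\mathbb Z),$$ where $[\cdot]$ is $1$ if the condition holds and $0$ otherwise. A cell $x$ is unstable in $c$ if $c(x)\ge\theta$, and $c$ is stable if no cell is unstable. The first column stable prediction problem $1^{\mathrm{st}}\mathrm{col}\text{-}\mathsf{S}\text{-}\mathsf{PRED}$ of the model is the following decision problem. Input: a number $n$, a stable configuration $c$ that is empty outside the segment $\{0,\dots,n-1\}$, and a cell $x\in\mathbb Z$. Question: starting from $c$ with one grain added on cell $0$ (the minimal cell of the segment), is the cell $x$ unstable after some number $t\ge 0$ of applications of $F$? The input is coded as a bit string: the values $c(0),\dots,c(n-1)$, each in binary on a fixed number of bits depending only on $\theta$,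 followed by a sign bit and by $|x|$ in binary on $k(\lfloor\log_2 n\rfloor+1)$ bits (with $\log_2 0$ read as $0$), where $k\in\mathbb N$ is a constant; only cells $x$ with $|x|<2^{k(\lfloor\log_2 n\rfloor+1)}$ are considered. $\mathsf{NC}^1$ is the class of languages over $\{0,1\}$ decided by a family $(C_N)_{N\ge0}$ of Boolean circuits with gates of fan-in at most $2$, where $C_N$ has $N$ inputs, size polynomial in $N$ and depth $O(\log N)$, which is logspace-uniform: a deterministic Turing transducer working in space $O(\log N)$ outputs a description of $C_N$ on input $1^N$. Theorem. For every one-dimensional sandpile model and every constant $k$, $1^{\mathrm{st}}\mathrm{col}\text{-}\mathsf{S}\text{-}\mathsf{PRED}\in\mathsf{NC}^1$. -/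

import Mathlib

/-! ## One-dimensional sandpile models -/

/-- A one-dimensional sandpile model: a finite neighborhood `nbhd ⊆ ℤ \ {0}`, a distribution
giving a positive number of grains to each element of the neighborhood (values of `dist` outside
`nbhd` are never used), and completeness: every integer is a nonnegative integer combination of
elements of `nbhd`.  (For a nonempty finite set, all of `ℤ` is obtained with nonnegative
coefficients iff it is obtained with strictly positive coefficients.) -/
structure SandpileModel where
  nbhd : Finset ℤ
  dist : ℤ → ℕ
  zero_notMem : (0 : ℤ) ∉ nbhd
  dist_pos : ∀ v ∈ nbhd, 0 < dist v
  complete : AddSubmonoid.closure (nbhd : Set ℤ) = ⊤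

namespace SandpileModel

/-- The stability threshold. -/
def threshold (M : SandpileModel) : ℕ := ∑ v ∈ M.nbhd, M.dist v

/-- The global rule: every cell holding at least `threshold` grains gives `dist v` of them to the
cell at offset `v`, for each `v` in the neighborhood, all cells simultaneously.  So cell `x`
receives `dist v` grains from `x - v` whenever `x - v` is unstable. -/
def step (M : SandpileModel) (c : ℤ → ℕ) : ℤ → ℕ := fun x =>
  c x - (if M.threshold ≤ c x then M.threshold else 0)
    + ∑ v ∈ M.nbhd, (if M.threshold ≤ c (x - v) then M.dist v else 0)

/-- Every cell is stable. -/
def Stable (M : SandpileModel) (c : ℤ → ℕ) : Prop := ∀ x, c x < M.threshold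

/-- Cell `x` is unstable at some time of the parallel evolution from `c`. -/
def EventuallyUnstable (M : SandpileModel) (c : ℤ → ℕ) (x : ℤ) : Prop :=
  ∃ t : ℕ, M.threshold ≤ (M.step^[t] c) x

end SandpileModel

/-- The configuration `c` is placed on the segment `{0, …, n - 1}`: it is empty elsewhere. -/
def SupportedOnSegment (n : ℕ) (c : ℤ → ℕ) : Prop :=
  ∀ x : ℤ, c x ≠ 0 → 0 ≤ x ∧ x < n

/-- Add one grain on cell `y`. -/
def addGrain (c : ℤ → ℕ) (y : ℤ) : ℤ → ℕ := fun x => c x + (if x = y then 1 else 0)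

/-- The `width` least significant binary digits of `m`, least significant first. -/
def bitsOfWidth (width m : ℕ) : List Bool := (List.range width).map (fun j => m.testBit j)

/-- The bit string coding a stable configuration on `{0, …, n - 1}` and a cell `x`: the grain
contents of the `n` cells, in order, each in binary on a constant number of bits, followed by a
sign bit and `|x|` in binary on `k * (⌊log₂ n⌋ + 1)` bits. -/
def SandpileModel.encodeInstance (M : SandpileModel) (k n : ℕ) (c : ℤ → ℕ) (x : ℤ) : List Bool :=
  (List.range n).flatMap (fun i => bitsOfWidth M.threshold.size (c (i : ℤ)))
    ++ decide (x < 0) :: bitsOfWidth (k * (Nat.log 2 n + 1)) x.natAbs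

/-- The first column stable prediction problem, as a language over `{0, 1}`.  An instance is a
stable configuration `c` on a segment `{0, …, n - 1}` and a cell `x`, given on `O(log n)` bits,
`k` being the constant in the `O`.  It is positive if adding one grain on cell `0` (the minimal
cell of the segment) eventually makes `x` unstable. -/
def SandpileModel.firstColStablePred (M : SandpileModel) (k : ℕ) : Language Bool :=
  {w | ∃ (n : ℕ) (c : ℤ → ℕ) (x : ℤ),
    SupportedOnSegment n c ∧ M.Stable c ∧ x.natAbs < 2 ^ (k * (Nat.log 2 n + 1)) ∧
    w = M.encodeInstance k n c x ∧
    M.EventuallyUnstable (addGrain c 0) x}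

/-! ## Boolean circuits of fan-in two -/

/-- Gates; the operands of `neg`, `conj`, `disj` are the positions of other gates in the list of
gates of the circuit, and `var i` is the `i`-th input bit. -/
inductive Gate where
  | var (i : ℕ)
  | const (b : Bool)
  | neg (j : ℕ)
  | conj (j₁ j₂ : ℕ)
  | disj (j₁ j₂ : ℕ)

/-- A circuit is a topologically sorted list of gates (gates may be shared); its last gate is the
output. -/
abbrev Circuit := List Gate

/-- A gate at position `m` of a circuit on `n` input bits may only use input bits below `n` and
gates at positions below `m`. -/
def Gate.Valid (n m : ℕ) : Gate → Prop
  | .var i => i < n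
  | .const _ => True
  | .neg j => j < m
  | .conj j₁ j₂ => j₁ < m ∧ j₂ < m
  | .disj j₁ j₂ => j₁ < m ∧ j₂ < m

/-- Value of a gate from the input bits and the values of the previous gates. -/
def Gate.value (w vals : List Bool) : Gate → Bool
  | .var i => w.getD i false
  | .const b => b
  | .neg j => !(vals.getD j false)
  | .conj j₁ j₂ => vals.getD j₁ false && vals.getD j₂ false
  | .disj j₁ j₂ => vals.getD j₁ false || vals.getD j₂ false

/-- Depth of a gate from the depths of the previous gates. -/
def Gate.depth (depths : List ℕ) : Gate → ℕ
  | .var _ => 0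
  | .const _ => 0
  | .neg j => depths.getD j 0 + 1
  | .conj j₁ j₂ => max (depths.getD j₁ 0) (depths.getD j₂ 0) + 1
  | .disj j₁ j₂ => max (depths.getD j₁ 0) (depths.getD j₂ 0) + 1

namespace Circuit

/-- The circuit is a genuine circuit on `n` input bits. -/
def WellFormed (n : ℕ) (C : Circuit) : Prop :=
  C ≠ [] ∧ ∀ (m : ℕ) (g : Gate), C[m]? = some g → g.Valid n m

/-- The values of all gates on input `w`. -/
def values (C : Circuit) (w : List Bool) : List Bool :=
  C.foldl (fun vals g => vals ++ [g.value w vals]) []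

/-- The value of the output gate on input `w`. -/
def output (C : Circuit) (w : List Bool) : Bool := (C.values w).getLastD false

/-- The depths of all gates. -/
def depths (C : Circuit) : List ℕ :=
  C.foldl (fun ds g => ds ++ [g.depth ds]) []

/-- The depth of the circuit: the greatest depth of a gate. -/
def depth (C : Circuit) : ℕ := C.depths.foldr max 0

/-- The size of the circuit: its number of gates. -/
def size (C : Circuit) : ℕ := C.length

end Circuit

/-- Symbols used to write down a circuit. -/
inductive CircuitSymbol where
  | var
  | const (b : Bool)
  | neg
  | conj
  | disj
  | tick
  | sep

/-- Description of a gate: its kind followed by its operands, numbers being written in unary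
(a circuit of polynomial size has a description of polynomial length). -/
def Gate.describe : Gate → List CircuitSymbol
  | .var i => .var :: List.replicate i .tick
  | .const b => [.const b]
  | .neg j => .neg :: List.replicate j .tick
  | .conj j₁ j₂ => .conj :: (List.replicate j₁ .tick ++ .sep :: List.replicate j₂ .tick)
  | .disj j₁ j₂ => .disj :: (List.replicate j₁ .tick ++ .sep :: List.replicate j₂ .tick)

/-- Description of a circuit: the descriptions of its gates, in order. -/
def Circuit.describe (C : Circuit) : List CircuitSymbol := C.flatMap Gate.describe

/-! ## Space-bounded Turing transducers -/

/-- What the head of the input tape sees: an input symbol or one of the two end markers. -/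
inductive InputSymbol (A : Type) where
  | leftEnd
  | sym (a : A)
  | rightEnd

/-- Head moves. -/
inductive HeadMove where
  | left
  | stay
  | right

/-- A head cannot move to the left of position `0`. -/
def HeadMove.apply : HeadMove → ℕ → ℕ
  | .left, p => p - 1
  | .stay, p => p
  | .right, p => p + 1

/-- What a transducer does in one step: new state, move of the input head, symbol written and move
on each work tape, word appended to the output. -/
structure TransducerAction (Q Γ B : Type) (k : ℕ) where
  state : Q
  inputMove : HeadMove
  write : Fin k → Γ
  workMove : Fin k → HeadMove
  emit : List B

/-- A deterministic Turing transducer with input alphabet `A` and output alphabet `B`: a two-way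
read-only input tape between end markers, `tapes` one-way infinite read-write work tapes, and a
write-only output tape.  The machine halts when `trans` is `none`. -/
structure Transducer (A B : Type) where
  State : Type
  Work : Type
  state_finite : Finite State
  work_finite : Finite Work
  tapes : ℕ
  start : State
  blank : Work
  trans : State → InputSymbol A → (Fin tapes → Work) → Option (TransducerAction State Work B tapes)

namespace Transducer

variable {A B : Type}

/-- Configurations of a transducer. -/
structure Cfg (T : Transducer A B) where
  state : T.State
  inputPos : ℕ
  work : Fin T.tapes → ℕ → T.Work
  workPos : Fin T.tapes → ℕ
  out : List B

/-- Symbol at position `p` of the input tape holding `w`: the left marker is at position `0`,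
the word `w` at positions `1, …, |w|`, the right marker at position `|w| + 1`. -/
def inputAt (w : List A) (p : ℕ) : InputSymbol A :=
  if p = 0 then .leftEnd else
    match w[p - 1]? with
    | some a => .sym a
    | none => .rightEnd

/-- Initial configuration. -/
def startCfg (T : Transducer A B) : T.Cfg where
  state := T.start
  inputPos := 0
  work := fun _ _ => T.blank
  workPos := fun _ => 0
  out := []

/-- One step on input `w`; the input head cannot move beyond the right marker. -/
def step (T : Transducer A B) (w : List A) (s : T.Cfg) : Option T.Cfg :=
  (T.trans s.state (inputAt w s.inputPos) (fun i => s.work i (s.workPos i))).map fun a =>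
    { state := a.state
      inputPos := min (a.inputMove.apply s.inputPos) (w.length + 1)
      work := fun i => Function.update (s.work i) (s.workPos i) (a.write i)
      workPos := fun i => (a.workMove i).apply (s.workPos i)
      out := s.out ++ a.emit }

/-- `s` is reached by the computation on input `w`. -/
def Reaches (T : Transducer A B) (w : List A) (s : T.Cfg) : Prop :=
  Relation.ReflTransGen (fun s₁ s₂ => T.step w s₁ = some s₂) T.startCfg s

/-- On input `w` the transducer halts with output `u`. -/
def Outputs (T : Transducer A B) (w : List A) (u : List B) : Prop :=
  ∃ s : T.Cfg, T.Reaches w s ∧ T.step w s = none ∧ s.out = u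

/-- On input `w` the transducer only visits the first `m` cells of each work tape. -/
def UsesSpace (T : Transducer A B) (w : List A) (m : ℕ) : Prop :=
  ∀ s : T.Cfg, T.Reaches w s → ∀ i, s.workPos i < m

end Transducer

/-! ## The classes `NC^i` -/

/-- Logarithmic space uniformity: some transducer working in space `O(log n)` on input `1^n`
writes down the `n`-th circuit of the family. -/
def LogspaceUniform (C : ℕ → Circuit) : Prop :=
  ∃ T : Transducer Unit CircuitSymbol, ∃ a : ℕ, ∀ n : ℕ,
    T.Outputs (List.replicate n ()) (C n).describe ∧
    T.UsesSpace (List.replicate n ()) (a * (Nat.log 2 n + 1))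

/-- `NC^i`: languages decided by logspace-uniform families of fan-in two Boolean circuits of
polynomial size and depth `O(log^i n)`. -/
def NC (i : ℕ) : Set (Language Bool) :=
  {L | ∃ C : ℕ → Circuit,
    LogspaceUniform C ∧
    (∀ n, (C n).WellFormed n) ∧
    (∃ p : Polynomial ℕ, ∀ n, (C n).size ≤ p.eval n) ∧
    (∃ a : ℕ, ∀ n, (C n).depth ≤ a * (Nat.log 2 n + 1) ^ i) ∧
    ∀ w : List Bool, w ∈ L ↔ (C w.length).output w = true}

/-!
Adding a grain on the first cell of a stable configuration produces an avalanche that stays in the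
segment and topples each cell at most once (`SandpileModel.toppled`). The set of cells that topple is
therefore the least set of cells closed under toppling, in the sense that a cell belongs to it as
soon as its own load plus the grains received from the cells of the set reaches the threshold.
Hence `x` does *not* topple if and only if some closed set contained in the segment avoids `x`
(`SandpileModel.eventuallyUnstable_iff`).

The existence of such a set is a local condition on a line: it can be checked cell by cell by looking
only at a window of constant width. To a segment of cells one associates the relation between the
windows at its two ends that are extended by some closed set. This relation belongs to a fixed finite
set, and the relation of the union of two adjacent segments is the composition of theirs
(`SandpileModel.summary_add`). Composing along a balanced binary tree of height `O(log n)` gives the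
answer; whether the relations have to account for the cell `x` is decided, at each level of the tree,
by one binary digit of `x` (`SandpileModel.stateIn_eq`). So the problem is solved by a tree automaton
with a constant number of states, and each of its nodes becomes a subcircuit of constant size, which
yields polynomial size and logarithmic depth (`TreeAutomaton.mem_NC_one`). Stability of the
configuration is a part of the state. The length of the input determines `n`, and the inputs whose
length is not that of an instance are rejected by a constant circuit.

For uniformity, all subcircuits are padded to the same number of gates, so that the positions of the
gates are given by simple arithmetic formulas. The description of the circuit is then the value of a
program (`Generator`) consisting of nested loops over counters of polynomial size, in which numbers
are denoted by the length of a generated word. A transducer keeps these counters in binary on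
finitely many work tapes of logarithmic length (`Generator.exists_transducer`). Transducers are
obtained from structured programs acting on tapes (`TapeProgram`), whose control states are lists of
subprograms still to be run.
-/

/-! ### Tape programs and transducers -/

/-- Programs acting on infinitely many work tapes with symbols `Option Bool`, of which a given
program inspects only finitely many. -/
inductive TapeProgram (B : Type) where
  /-- On each tape `i`, apply `f i` to the scanned symbol and move the head by `mv i`. -/
  | act (f : ℕ → Option Bool → Option Bool) (mv : ℕ → HeadMove)
  | emit (w : List B)
  | seq (a b : TapeProgram B)
  /-- Repeat `a` as long as the symbol scanned on tape `i` satisfies `p`. -/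
  | loop (i : ℕ) (p : Option Bool → Bool) (a : TapeProgram B)
  /-- As long as the input head is not on the right marker, move it right and run `a`. -/
  | scan (a : TapeProgram B)

/-- Contents of the work tapes, positions of their heads, and position of the input head. -/
@[ext]
structure Mem where
  tape : ℕ → ℕ → Option Bool
  head : ℕ → ℕ
  inp : ℕ

namespace TapeProgram

variable {B : Type}

/-- `Exec N m s μ o μ'`: on an input of length `N`, the program `s` started in memory `μ` halts in
memory `μ'` after emitting `o`, every work head staying below position `m` after each move. -/
inductive Exec (N m : ℕ) : TapeProgram B → Mem → List B → Mem → Prop where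
  | act {f mv μ} : (∀ i, (mv i).apply (μ.head i) < m) →
      Exec N m (.act f mv) μ []
        ⟨fun i => Function.update (μ.tape i) (μ.head i) (f i (μ.tape i (μ.head i))),
          fun i => (mv i).apply (μ.head i), μ.inp⟩
  | emit {w μ} : Exec N m (.emit w) μ w μ
  | seq {a b μ o μ' o' μ''} : Exec N m a μ o μ' → Exec N m b μ' o' μ'' →
      Exec N m (.seq a b) μ (o ++ o') μ''
  | loop_exit {i p a μ} : p (μ.tape i (μ.head i)) = false → Exec N m (.loop i p a) μ [] μ
  | loop_step {i p a μ o μ' o' μ''} : p (μ.tape i (μ.head i)) = true → Exec N m a μ o μ' →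
      Exec N m (.loop i p a) μ' o' μ'' → Exec N m (.loop i p a) μ (o ++ o') μ''
  | scan_exit {a μ} : μ.inp = N + 1 → Exec N m (.scan a) μ [] μ
  | scan_step {a μ o μ' o' μ''} : μ.inp ≤ N → Exec N m a { μ with inp := μ.inp + 1 } o μ' →
      Exec N m (.scan a) μ' o' μ'' → Exec N m (.scan a) μ (o ++ o') μ''

/-- The first tape index above all those inspected by the program. -/
def width : TapeProgram B → ℕ
  | .act _ _ => 0
  | .emit _ => 0
  | .seq a b => max a.width b.width
  | .loop i _ a => max (i + 1) a.width
  | .scan a => a.width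

/-- The control points met while running a program before `k`, a control point being the list of
the programs that remain to be run. -/
def conts : TapeProgram B → List (TapeProgram B) → Set (List (TapeProgram B))
  | .act f mv, k => {.act f mv :: k}
  | .emit w, k => {.emit w :: k}
  | .seq a b, k => {.seq a b :: k} ∪ a.conts (b :: k) ∪ b.conts k
  | .loop i p a, k => {.loop i p a :: k} ∪ a.conts (.loop i p a :: k)
  | .scan a, k => {.scan a :: k} ∪ a.conts (.scan a :: k)

theorem finite_conts (s : TapeProgram B) (k : List (TapeProgram B)) : (s.conts k).Finite := by
  induction s generalizing k with
  | act f mv => exact Set.finite_singleton _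
  | emit w => exact Set.finite_singleton _
  | seq a b iha ihb => exact ((Set.finite_singleton _).union (iha _)).union (ihb _)
  | loop i p a ih => exact (Set.finite_singleton _).union (ih _)
  | scan a ih => exact (Set.finite_singleton _).union (ih _)

theorem cons_mem_conts (s : TapeProgram B) (k : List (TapeProgram B)) : s :: k ∈ s.conts k := by
  cases s <;> simp [conts]

/-- Control points of a whole program; the empty list is the halting one. -/
abbrev Control (s : TapeProgram B) : Type := {l : List (TapeProgram B) // l ∈ insert [] (s.conts [])}

open Classical in
/-- A list of programs as a control point of `s` (the halting one if it is none). -/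
noncomputable def control (s : TapeProgram B) (l : List (TapeProgram B)) : Control s :=
  if h : l ∈ insert [] (s.conts []) then ⟨l, h⟩ else ⟨[], Set.mem_insert _ _⟩

theorem control_val {s : TapeProgram B} {l : List (TapeProgram B)}
    (h : l ∈ insert [] (s.conts [])) : (control s l).1 = l := by
  simp only [control, dif_pos h]

/-- The transition at a control point: one step of the first remaining program. A tape that the
transducer does not have (`r ≤ i`) reads as blank; this does not happen when `r` is the width of the
program. -/
def transition {r : ℕ} {Q : Type} (mk : List (TapeProgram B) → Q) :
    List (TapeProgram B) → InputSymbol Unit → (Fin r → Option Bool) →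
      Option (TransducerAction Q (Option Bool) B r)
  | [], _, _ => none
  | .act f mv :: k, _, γ => some ⟨mk k, .stay, fun i => f i (γ i), fun i => mv i, []⟩
  | .emit w :: k, _, γ => some ⟨mk k, .stay, γ, fun _ => .stay, w⟩
  | .seq a b :: k, _, γ => some ⟨mk (a :: b :: k), .stay, γ, fun _ => .stay, []⟩
  | .loop i p a :: k, _, γ =>
      if p (if h : i < r then γ ⟨i, h⟩ else none) then
        some ⟨mk (a :: .loop i p a :: k), .stay, γ, fun _ => .stay, []⟩
      else some ⟨mk k, .stay, γ, fun _ => .stay, []⟩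
  | .scan _ :: k, .rightEnd, γ => some ⟨mk k, .stay, γ, fun _ => .stay, []⟩
  | .scan a :: k, _, γ => some ⟨mk (a :: .scan a :: k), .right, γ, fun _ => .stay, []⟩

/-- The transducer running a program. -/
noncomputable def transducer (s : TapeProgram B) : Transducer Unit B where
  State := Control s
  Work := Option Bool
  state_finite := ((s.finite_conts []).insert []).to_subtype
  work_finite := inferInstance
  tapes := s.width
  start := control s [s]
  blank := none
  trans q := transition (control s) q.1

/-- The configuration of the transducer of `s` at control point `l`, in memory `μ`. -/
noncomputable def cfg (s : TapeProgram B) (l : List (TapeProgram B)) (μ : Mem) (o : List B) :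
    (transducer s).Cfg where
  state := control s l
  inputPos := μ.inp
  work i := μ.tape i
  workPos i := μ.head i
  out := o

end TapeProgram

namespace Transducer

variable {A B : Type}

/-- From configuration `s` the transducer halts with output `u`, without leaving the first `m`
cells of the work tapes. -/
def HaltsWithin (T : Transducer A B) (w : List A) (m : ℕ) (u : List B) (s : T.Cfg) : Prop :=
  (∃ s', Relation.ReflTransGen (fun s₁ s₂ => T.step w s₁ = some s₂) s s' ∧
    T.step w s' = none ∧ s'.out = u) ∧
  ∀ s', Relation.ReflTransGen (fun s₁ s₂ => T.step w s₁ = some s₂) s s' → ∀ i, s'.workPos i < m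

theorem HaltsWithin.of_step {T : Transducer A B} {w : List A} {m : ℕ} {u : List B} {s s' : T.Cfg}
    (hs : T.step w s = some s') (hm : ∀ i, s.workPos i < m) (h : T.HaltsWithin w m u s') :
    T.HaltsWithin w m u s := by
  obtain ⟨⟨f, hf, hn, ho⟩, hr⟩ := h
  refine ⟨⟨f, hf.head hs, hn, ho⟩, fun t ht => ?_⟩
  rcases Relation.ReflTransGen.cases_head ht with rfl | ⟨t', ht', htt⟩
  · exact hm
  · have : t' = s' := by
      have := hs.symm.trans ht'
      exact (Option.some.inj this).symm
    subst this
    exact hr _ htt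

theorem HaltsWithin.of_halt {T : Transducer A B} {w : List A} {m : ℕ} {s : T.Cfg}
    (hs : T.step w s = none) (hm : ∀ i, s.workPos i < m) : T.HaltsWithin w m s.out s := by
  refine ⟨⟨s, .refl, hs, rfl⟩, fun t ht => ?_⟩
  rcases Relation.ReflTransGen.cases_head ht with rfl | ⟨t', ht', _⟩
  · exact hm
  · simp [hs] at ht'

end Transducer

namespace TapeProgram

variable {B : Type}

theorem step_cfg {s : TapeProgram B} {N : ℕ} {l : List (TapeProgram B)} {μ : Mem} {o : List B}
    (hl : l ∈ insert [] (s.conts [])) :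
    (transducer s).step (List.replicate N ()) (cfg s l μ o) =
      (transition (r := s.width) (control s) l (Transducer.inputAt (List.replicate N ()) μ.inp)
        (fun i => μ.tape i (μ.head i))).map fun a =>
      { state := a.state
        inputPos := min (a.inputMove.apply μ.inp) (N + 1)
        work := fun i => Function.update (μ.tape i) (μ.head i) (a.write i)
        workPos := fun i => (a.workMove i).apply (μ.head i)
        out := o ++ a.emit } := by
  have h := control_val hl
  simp only [Transducer.step, cfg, transducer, h, List.length_replicate]

theorem unchanged {s : TapeProgram B} (q : Control s) (p : ℕ) (μ : Mem) (o : List B) :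
    ({ state := q
       inputPos := p
       work := fun i => Function.update (μ.tape i) (μ.head i) (μ.tape i (μ.head i))
       workPos := fun i => μ.head i
       out := o } : (transducer s).Cfg) =
    { state := q, inputPos := p, work := fun i => μ.tape i, workPos := fun i => μ.head i, out := o } := by
  congr 1
  exact funext fun i => Function.update_eq_self (f := μ.tape i) _

theorem inputAt_replicate_eq {N p : ℕ} (hp : p = N + 1) :
    Transducer.inputAt (List.replicate N ()) p = .rightEnd := by
  subst hp; simp [Transducer.inputAt]

theorem inputAt_replicate_ne {N p : ℕ} (hp : p ≤ N) :
    Transducer.inputAt (List.replicate N ()) p ≠ .rightEnd := by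
  unfold Transducer.inputAt
  split_ifs with h
  · simp
  · have : p - 1 < N := by omega
    simp [this]

theorem Exec.head_lt {N m : ℕ} {s : TapeProgram B} {μ μ' : Mem} {o : List B}
    (h : Exec N m s μ o μ') (hm : ∀ i, μ.head i < m) : ∀ i, μ'.head i < m := by
  induction h with
  | act h => exact h
  | emit => exact hm
  | seq _ _ ih ih' => exact ih' (ih hm)
  | loop_exit => exact hm
  | loop_step _ _ _ ih ih' => exact ih' (ih hm)
  | scan_exit => exact hm
  | scan_step _ _ _ ih ih' => exact ih' (ih hm)

theorem Exec.inp_le {N m : ℕ} {s : TapeProgram B} {μ μ' : Mem} {o : List B}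
    (h : Exec N m s μ o μ') (hm : μ.inp ≤ N + 1) : μ'.inp ≤ N + 1 := by
  induction h with
  | act h => exact hm
  | emit => exact hm
  | seq _ _ ih ih' => exact ih' (ih hm)
  | loop_exit => exact hm
  | loop_step _ _ _ ih ih' => exact ih' (ih hm)
  | scan_exit => exact hm
  | scan_step h _ _ ih ih' => exact ih' (ih (by simpa using h))

/-- Running the first program of the list of remaining programs, as a run of the transducer. The
statement is in continuation style: the machine behaves well before `s` if it does so after `s`. -/
theorem Exec.haltsWithin {N m : ℕ} {S s : TapeProgram B} {μ μ' : Mem} {o : List B}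
    (h : Exec N m s μ o μ') {u : List B} :
    ∀ {k : List (TapeProgram B)} {out : List B}, s.conts k ⊆ insert [] (S.conts []) →
      k ∈ insert [] (S.conts []) → s.width ≤ S.width → (∀ i, μ.head i < m) → μ.inp ≤ N + 1 →
      (transducer S).HaltsWithin (List.replicate N ()) m u (cfg S k μ' (out ++ o)) →
      (transducer S).HaltsWithin (List.replicate N ()) m u (cfg S (s :: k) μ out) := by
  induction h with
  | @act f mv μ h =>
    intro k out hc hk hw hm hi H
    refine .of_step ?_ (fun i => hm i) H
    rw [step_cfg (hc (cons_mem_conts _ _))]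
    simp [transition, cfg, HeadMove.apply, hi]
    rfl
  | @emit w μ =>
    intro k out hc hk hw hm hi H
    refine .of_step ?_ (fun i => hm i) H
    rw [step_cfg (hc (cons_mem_conts _ _))]
    simp [transition, cfg, HeadMove.apply, hi]
    exact unchanged _ _ _ _
  | @seq a b μ o μ' o' μ'' h h' ih ih' =>
    intro k out hc hk hw hm hi H
    have hc1 : a.conts (b :: k) ⊆ insert [] (S.conts []) :=
      fun x hx => hc (Or.inl (Or.inr hx))
    have hc2 : b.conts k ⊆ insert [] (S.conts []) := fun x hx => hc (Or.inr hx)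
    have hw' := max_le_iff.1 hw
    have H2 := ih' (out := out ++ o) hc2 hk hw'.2 (h.head_lt hm) (h.inp_le hi) (by simpa using H)
    have H1 := ih hc1 (hc2 (cons_mem_conts _ _)) hw'.1 hm hi H2
    refine .of_step ?_ (fun i => hm i) H1
    rw [step_cfg (hc (cons_mem_conts _ _))]
    simp [transition, cfg, HeadMove.apply, hi]
    exact unchanged _ _ _ _
  | @loop_exit i p a μ hp =>
    intro k out hc hk hw hm hi H
    have hw' : i < S.width := (max_le_iff.1 hw).1
    refine .of_step ?_ (fun i => hm i) H
    rw [step_cfg (hc (cons_mem_conts _ _))]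
    simp [transition, cfg, HeadMove.apply, hi, hp, hw']
    exact unchanged _ _ _ _
  | @loop_step i p a μ o μ' o' μ'' hp h h' ih ih' =>
    intro k out hc hk hw hm hi H
    have hw' := max_le_iff.1 hw
    have hw1 : i < S.width := hw'.1
    have hc1 : a.conts (.loop i p a :: k) ⊆ insert [] (S.conts []) := fun x hx => hc (Or.inr hx)
    have H2 := ih' (out := out ++ o) hc hk hw (h.head_lt hm) (h.inp_le hi) (by simpa using H)
    have H1 := ih hc1 (hc (cons_mem_conts _ _)) hw'.2 hm hi H2
    refine .of_step ?_ (fun i => hm i) H1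
    rw [step_cfg (hc (cons_mem_conts _ _))]
    simp [transition, cfg, HeadMove.apply, hi, hp, hw1]
    exact unchanged _ _ _ _
  | @scan_exit a μ hp =>
    intro k out hc hk hw hm hi H
    refine .of_step ?_ (fun i => hm i) H
    rw [step_cfg (hc (cons_mem_conts _ _)), inputAt_replicate_eq hp]
    simp [transition, cfg, HeadMove.apply, hi]
    exact unchanged _ _ _ _
  | @scan_step a μ o μ' o' μ'' hp h h' ih ih' =>
    intro k out hc hk hw hm hi H
    have hc1 : a.conts (.scan a :: k) ⊆ insert [] (S.conts []) := fun x hx => hc (Or.inr hx)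
    have hi' : ({ μ with inp := μ.inp + 1 } : Mem).inp ≤ N + 1 := by simpa using hp
    have H2 := ih' (out := out ++ o) hc hk hw (h.head_lt hm) (h.inp_le hi') (by simpa using H)
    have H1 := ih hc1 (hc (cons_mem_conts _ _)) hw hm hi' H2
    refine .of_step ?_ (fun i => hm i) H1
    rw [step_cfg (hc (cons_mem_conts _ _))]
    have := inputAt_replicate_ne hp
    generalize Transducer.inputAt (List.replicate N ()) μ.inp = y at this
    cases y
    case rightEnd => exact absurd rfl this
    all_goals
      simp [transition, cfg, HeadMove.apply, hp]
      exact unchanged _ _ _ _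

/-- The memory of a transducer at the start. -/
def initialMem : Mem := ⟨fun _ _ => none, fun _ => 0, 0⟩

/-- A program that runs from the initial memory within space `m` gives a transducer with the same
output and the same space. -/
theorem Exec.outputs {N m : ℕ} {s : TapeProgram B} {μ : Mem} {o : List B}
    (h : Exec N m s initialMem o μ) (hm : 0 < m) :
    (transducer s).Outputs (List.replicate N ()) o ∧
      (transducer s).UsesSpace (List.replicate N ()) m := by
  have hlast : (transducer s).HaltsWithin (List.replicate N ()) m o (cfg s [] μ ([] ++ o)) := by
    refine .of_halt ?_ fun i => h.head_lt (fun _ => hm) i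
    rw [step_cfg (Set.mem_insert _ _)]
    rfl
  exact h.haltsWithin (Set.subset_insert _ _) (Set.mem_insert _ _) le_rfl (fun _ => hm)
    (Nat.zero_le _) hlast

end TapeProgram

/-! ### Binary counters -/

@[simp] theorem HeadMove.apply_left (p : ℕ) : HeadMove.left.apply p = p - 1 := rfl

@[simp] theorem HeadMove.apply_stay (p : ℕ) : HeadMove.stay.apply p = p := rfl

@[simp] theorem HeadMove.apply_right (p : ℕ) : HeadMove.right.apply p = p + 1 := rfl

/-- The tape carrying the word `ds` on the cells `1, …, |ds|`. Cell `0` stays blank, so that a head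
moving left finds the beginning of the word. -/
def wordTape (ds : List Bool) : ℕ → Option Bool
  | 0 => none
  | p + 1 => ds[p]?

theorem wordTape_append (pre ds : List Bool) :
    wordTape (pre ++ ds) (pre.length + 1) = ds.head? := by
  simp [wordTape, List.getElem?_append_right, List.head?_eq_getElem?]

theorem update_wordTape (pre ds : List Bool) (x y : Bool) :
    Function.update (wordTape (pre ++ x :: ds)) (pre.length + 1) (some y) =
      wordTape (pre ++ y :: ds) := by
  funext p
  rcases p with _ | p
  · simp [Function.update, wordTape]
  · simp only [Function.update, wordTape]
    split_ifs with h
    · obtain rfl : p = pre.length := by omega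
      simp
    · rcases lt_or_gt_of_ne (show p ≠ pre.length by omega) with h' | h'
      · simp [List.getElem?_append_left h']
      · obtain ⟨q, rfl⟩ := Nat.exists_eq_add_of_lt h'
        simp only [List.getElem?_append_right (show pre.length ≤ pre.length + q + 1 by omega)]
        simp [show pre.length + q + 1 - pre.length = q + 1 by omega]

theorem update_wordTape_nil (pre : List Bool) (y : Bool) :
    Function.update (wordTape pre) (pre.length + 1) (some y) = wordTape (pre ++ [y]) := by
  funext p
  rcases p with _ | p
  · simp [Function.update, wordTape]
  · simp only [Function.update, wordTape]
    split_ifs with h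
    · obtain rfl : p = pre.length := by omega
      simp
    · rcases lt_or_gt_of_ne (show p ≠ pre.length by omega) with h' | h'
      · simp [List.getElem?_append_left h']
      · rw [List.getElem?_eq_none (by omega), List.getElem?_eq_none (by simp; omega)]

theorem update_wordTape_none (pre : List Bool) (x : Bool) :
    Function.update (wordTape (pre ++ [x])) (pre.length + 1) none = wordTape pre := by
  rw [← update_wordTape_nil, Function.update_idem]
  refine (Function.update_eq_self_iff).2 ?_
  simp [wordTape]

/-- Successor on binary words, least significant digit first. -/
def incWord : List Bool → List Bool
  | [] => [true]
  | false :: ds => true :: ds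
  | true :: ds => false :: incWord ds

/-- Predecessor on binary words, up to a leading zero. (On `0` it gives `0`.) -/
def decWord : List Bool → List Bool
  | [] => []
  | true :: ds => false :: ds
  | false :: ds => true :: decWord ds

/-- Remove one leading zero, if there is one. -/
def stripWord (ds : List Bool) : List Bool := if ds.getLast? = some false then ds.dropLast else ds

theorem length_decWord (ds : List Bool) : (decWord ds).length = ds.length := by
  induction ds with
  | nil => rfl
  | cons b ds ih => cases b <;> simp [decWord, ih]

theorem length_incWord_le (ds : List Bool) : (incWord ds).length ≤ ds.length + 1 := by
  induction ds with
  | nil => simp [incWord]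
  | cons b ds ih => cases b <;> simp [incWord, ih]

theorem bits_succ (v : ℕ) : (v + 1).bits = incWord v.bits := by
  induction v using Nat.strong_induction_on with
  | _ v ih =>
    obtain ⟨a, rfl | rfl⟩ : ∃ a, v = 2 * a ∨ v = 2 * a + 1 := ⟨v / 2, by omega⟩
    · rw [Nat.bit1_bits]
      rcases Nat.eq_zero_or_pos a with rfl | ha
      · simp [incWord]
      · rw [Nat.bit0_bits _ (by omega)]; rfl
    · rw [Nat.bit1_bits, show 2 * a + 1 + 1 = 2 * (a + 1) by ring, Nat.bit0_bits _ (by omega),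
        ih a (by omega)]
      rfl

theorem getLast?_bits (v : ℕ) : v.bits.getLast? ≠ some false := by
  induction v using Nat.strong_induction_on with
  | _ v ih =>
    obtain ⟨a, rfl | rfl⟩ : ∃ a, v = 2 * a ∨ v = 2 * a + 1 := ⟨v / 2, by omega⟩
    · rcases Nat.eq_zero_or_pos a with rfl | ha
      · simp
      · have := ih a (by omega)
        rw [Nat.bit0_bits _ (by omega), List.getLast?_cons]
        have h : a.bits ≠ [] := by
          intro h0
          have := congrArg List.length h0
          rw [Nat.size_eq_bits_len] at this
          have := Nat.size_eq_zero.1 this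
          omega
        rw [List.getLast?_eq_some_getLast h] at this ⊢
        simpa using this
    · rw [Nat.bit1_bits, List.getLast?_cons]
      rcases h : a.bits.getLast? with _ | b
      · simp
      · rcases Nat.eq_zero_or_pos a with rfl | ha
        · simp at h
        · have := ih a (by omega)
          rw [h] at this
          simpa using this

theorem stripWord_cons_true (ds : List Bool) : stripWord (true :: ds) = true :: stripWord ds := by
  rcases List.eq_nil_or_concat ds with rfl | ⟨l, b, rfl⟩
  · rfl
  · have h (l' : List Bool) : (l' ++ [b]).dropLast = l' := List.dropLast_concat
    have h' := h (true :: l)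
    rw [List.cons_append] at h'
    cases b <;> simp [stripWord, List.getLast?_cons, h']

theorem bits_pred (v : ℕ) : (v - 1).bits = stripWord (decWord v.bits) := by
  induction v using Nat.strong_induction_on with
  | _ v ih =>
    obtain ⟨a, rfl | rfl⟩ : ∃ a, v = 2 * a ∨ v = 2 * a + 1 := ⟨v / 2, by omega⟩
    · rcases Nat.eq_zero_or_pos a with rfl | ha
      · simp [decWord, stripWord]
      · rw [show 2 * a - 1 = 2 * (a - 1) + 1 by omega, Nat.bit1_bits, Nat.bit0_bits _ (by omega),
          decWord, stripWord_cons_true, ih a (by omega)]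
    · rw [Nat.bit1_bits, decWord, Nat.add_sub_cancel]
      rcases Nat.eq_zero_or_pos a with rfl | ha
      · simp [stripWord]
      · rw [Nat.bit0_bits _ (by omega), stripWord, if_neg]
        have := getLast?_bits (2 * a)
        rwa [Nat.bit0_bits _ (by omega)] at this

/-- The memory with tape `i` and its head replaced. -/
def Mem.set (μ : Mem) (i : ℕ) (t : ℕ → Option Bool) (h : ℕ) : Mem :=
  ⟨Function.update μ.tape i t, Function.update μ.head i h, μ.inp⟩

namespace TapeProgram

variable {B : Type} {N m i : ℕ} {μ : Mem}

/-- Act on tape `i` only. -/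
def on (i : ℕ) (f : Option Bool → Option Bool) (mv : HeadMove) : TapeProgram B :=
  .act (fun j => if j = i then f else id) (fun j => if j = i then mv else .stay)

theorem exec_on (hm : ∀ j, μ.head j < m) {t : ℕ → Option Bool} {h : ℕ} (f mv)
    (hh : HeadMove.apply mv h < m) :
    Exec N m (on i f mv : TapeProgram B) (μ.set i t h) []
      (μ.set i (Function.update t h (f (t h))) (mv.apply h)) := by
  have : μ.set i (Function.update t h (f (t h))) (mv.apply h) =
      ⟨fun j => Function.update ((μ.set i t h).tape j) ((μ.set i t h).head j)
          ((if j = i then f else id) ((μ.set i t h).tape j ((μ.set i t h).head j))),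
        fun j => (if j = i then mv else HeadMove.stay).apply ((μ.set i t h).head j),
        (μ.set i t h).inp⟩ := by
    ext1
    · funext j
      rcases eq_or_ne j i with rfl | hj
      · simp [Mem.set]
      · simp [Mem.set, hj]
    · funext j
      rcases eq_or_ne j i with rfl | hj
      · simp [Mem.set]
      · simp [Mem.set, hj, HeadMove.apply]
    · rfl
  rw [this]
  refine .act fun j => ?_
  rcases eq_or_ne j i with rfl | hj
  · simpa [Mem.set] using hh
  · simpa [Mem.set, hj, HeadMove.apply] using hm j

theorem exec_on_id (hm : ∀ j, μ.head j < m) {t : ℕ → Option Bool} {h : ℕ} (mv)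
    (hh : HeadMove.apply mv h < m) :
    Exec N m (on i id mv : TapeProgram B) (μ.set i t h) [] (μ.set i t (mv.apply h)) := by
  simpa using exec_on (B := B) (N := N) (i := i) (t := t) hm id mv hh

theorem Exec.seq_nil {a b : TapeProgram B} {μ μ' μ'' : Mem} (h : Exec N m a μ [] μ')
    (h' : Exec N m b μ' [] μ'') : Exec N m (.seq a b) μ [] μ'' := by
  simpa using Exec.seq h h'

theorem Exec.loop_step_nil {p a} {μ μ' μ'' : Mem} (hp : p (μ.tape i (μ.head i)) = true)
    (h : Exec N m (a : TapeProgram B) μ [] μ') (h' : Exec N m (.loop i p a) μ' [] μ'') :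
    Exec N m (.loop i p a) μ [] μ'' := by
  simpa using Exec.loop_step hp h h'

/-- Bring the head of tape `i` from inside its word back to cell `1`. -/
def rewind (i : ℕ) : TapeProgram B :=
  .seq (.loop i Option.isSome (on i id .left)) (on i id .right)

theorem exec_rewind (hm : ∀ j, μ.head j < m) (ds : List Bool) {h : ℕ} (hh : h ≤ ds.length)
    (hd : ds.length + 1 < m) :
    Exec N m (rewind i : TapeProgram B) (μ.set i (wordTape ds) h) []
      (μ.set i (wordTape ds) 1) := by
  refine .seq_nil (μ' := μ.set i (wordTape ds) 0) ?_ ?_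
  · induction h with
    | zero => exact .loop_exit (by simp [Mem.set, wordTape])
    | succ h ih =>
      refine .loop_step_nil ?_ (exec_on_id hm _ ?_) (ih (by omega))
      · simp [Mem.set, wordTape]; omega
      · simp [HeadMove.apply]; omega
  · exact exec_on_id hm .right (by simp only [HeadMove.apply]; omega)

/-- Add one to the counter on tape `i`. -/
def inc (i : ℕ) : TapeProgram B :=
  .seq (.loop i (· == some true) (on i (fun _ => some false) .right))
    (.seq (on i (fun _ => some true) .stay) (rewind i))

/-- The first phase of an increment turns the leading block `pre'` of ones into zeros, and leaves the
head on the first digit of the rest `ds'`, or just after the word if it is empty. -/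
theorem exec_carry (hm : ∀ j, μ.head j < m) (ds pre : List Bool)
    (hd : pre.length + ds.length + 1 < m) : ∃ pre' ds' : List Bool,
      Exec N m (.loop i (· == some true) (on i (fun _ => some false) .right) : TapeProgram B)
        (μ.set i (wordTape (pre ++ ds)) (pre.length + 1)) []
        (μ.set i (wordTape (pre' ++ ds')) (pre'.length + 1)) ∧
      ds'.head? ≠ some true ∧ pre' ++ incWord ds' = pre ++ incWord ds ∧
      pre'.length + ds'.length = pre.length + ds.length := by
  induction ds generalizing pre with
  | nil =>
    refine ⟨pre, [], .loop_exit ?_, by simp, rfl, rfl⟩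
    simp [Mem.set, wordTape]
  | cons b ds ih =>
    cases b with
    | false =>
      refine ⟨pre, false :: ds, .loop_exit ?_, by simp, rfl, rfl⟩
      simp [Mem.set, wordTape_append]
    | true =>
      obtain ⟨pre', ds', h, h1, h2, h3⟩ := ih (pre ++ [false]) (by simp at hd ⊢; omega)
      refine ⟨pre', ds', .loop_step_nil ?_ (exec_on hm _ _ ?_) ?_, h1, ?_, ?_⟩
      · simp [Mem.set, wordTape_append]
      · simp [HeadMove.apply] at hd ⊢; omega
      · rw [update_wordTape]
        simpa using h
      · simpa [incWord] using h2
      · simp at h3 ⊢; omega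

theorem exec_inc_word (hm : ∀ j, μ.head j < m) (ds : List Bool) (hd : ds.length + 2 < m) :
    Exec N m (inc i : TapeProgram B) (μ.set i (wordTape ds) 1) []
      (μ.set i (wordTape (incWord ds)) 1) := by
  obtain ⟨pre, ds', h, h1, h2, h3⟩ :=
    exec_carry (N := N) (i := i) (B := B) hm ds [] (by simp; omega)
  simp only [List.nil_append, List.length_nil, Nat.zero_add] at h h2 h3
  refine .seq_nil h (.seq_nil (exec_on hm _ _ ?_) ?_)
  · simp [HeadMove.apply]; omega
  · have hl := length_incWord_le ds
    have hr := exec_rewind (N := N) (i := i) (B := B) hm (incWord ds) (h := pre.length + 1)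
      (by
        have := congrArg List.length h2
        rcases ds' with _ | ⟨_ | _, tl⟩ <;> simp [incWord] at this h1 ⊢ <;> omega)
      (by omega)
    rw [← h2] at hr ⊢
    convert hr using 2
    rcases ds' with _ | ⟨_ | _, tl⟩
    · simp [incWord, update_wordTape_nil]
    · simp [incWord, update_wordTape]
    · simp at h1
    rfl

/-- Subtract one from the counter on tape `i`, if it is not zero: propagate the borrow, go to the last
digit, erase it if it is a leading zero, and go back. -/
def dec (i : ℕ) : TapeProgram B :=
  .seq (.loop i (· == some false) (on i (fun _ => some true) .right))
    (.seq (on i (Option.map fun _ => false) .stay)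
      (.seq (.loop i Option.isSome (on i id .right))
        (.seq (on i id .left)
          (.seq (.loop i (· == some false) (on i (fun _ => none) .stay))
            (.seq (on i id .left) (rewind i))))))

/-- The first phase of a decrement turns the leading block `pre'` of zeros into ones, and leaves the
head on the first digit of the rest `ds'`, or just after the word if it is empty. -/
theorem exec_borrow (hm : ∀ j, μ.head j < m) (ds pre : List Bool)
    (hd : pre.length + ds.length + 1 < m) : ∃ pre' ds' : List Bool,
      Exec N m (.loop i (· == some false) (on i (fun _ => some true) .right) : TapeProgram B)
        (μ.set i (wordTape (pre ++ ds)) (pre.length + 1)) []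
        (μ.set i (wordTape (pre' ++ ds')) (pre'.length + 1)) ∧
      ds'.head? ≠ some false ∧ pre' ++ decWord ds' = pre ++ decWord ds ∧
      pre'.length + ds'.length = pre.length + ds.length := by
  induction ds generalizing pre with
  | nil =>
    refine ⟨pre, [], .loop_exit ?_, by simp, rfl, rfl⟩
    simp [Mem.set, wordTape]
  | cons b ds ih =>
    cases b with
    | true =>
      refine ⟨pre, true :: ds, .loop_exit ?_, by simp, rfl, rfl⟩
      simp [Mem.set, wordTape_append]
    | false =>
      obtain ⟨pre', ds', h, h1, h2, h3⟩ := ih (pre ++ [true]) (by simp at hd ⊢; omega)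
      refine ⟨pre', ds', .loop_step_nil ?_ (exec_on hm _ _ ?_) ?_, h1, ?_, ?_⟩
      · simp [Mem.set, wordTape_append]
      · simp [HeadMove.apply] at hd ⊢; omega
      · rw [update_wordTape]
        simpa using h
      · simpa [decWord] using h2
      · simp at h3 ⊢; omega

theorem exec_toEnd (hm : ∀ j, μ.head j < m) (ds : List Bool) {q h : ℕ}
    (hh : h + q = ds.length) (hd : ds.length + 1 < m) :
    Exec N m (.loop i Option.isSome (on i id .right) : TapeProgram B)
      (μ.set i (wordTape ds) (h + 1)) [] (μ.set i (wordTape ds) (ds.length + 1)) := by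
  induction q generalizing h with
  | zero =>
    obtain rfl : h = ds.length := by omega
    exact .loop_exit (by simp [Mem.set, wordTape])
  | succ q ih =>
    refine .loop_step_nil ?_ (exec_on_id hm _ ?_) (ih (h := h + 1) (by omega))
    · simp [Mem.set, wordTape]; omega
    · simp [HeadMove.apply]; omega

theorem exec_strip (hm : ∀ j, μ.head j < m) (ds : List Bool) (hd : ds.length < m) :
    Exec N m (.loop i (· == some false) (on i (fun _ => none) .stay) : TapeProgram B)
      (μ.set i (wordTape ds) ds.length) [] (μ.set i (wordTape (stripWord ds)) ds.length) := by
  rcases List.eq_nil_or_concat ds with rfl | ⟨l, b, rfl⟩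
  · exact .loop_exit (by simp [Mem.set, wordTape])
  · have hread : wordTape (l ++ [b]) (l ++ [b]).length = some b := by simp [wordTape]
    cases b with
    | true =>
      have : stripWord (l ++ [true]) = l ++ [true] := by simp [stripWord]
      simp only [List.concat_eq_append]
      rw [this]
      exact .loop_exit (by simp [Mem.set, wordTape])
    | false =>
      have : stripWord (l ++ [false]) = l := by simp [stripWord]
      simp only [List.concat_eq_append]
      rw [this]
      refine .loop_step_nil ?_ (exec_on hm _ .stay (by simpa [HeadMove.apply] using hd)) ?_
      · simp [Mem.set, wordTape]
      · have := update_wordTape_none l false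
        simp only [List.length_append, List.length_cons, List.length_nil, Nat.zero_add,
          HeadMove.apply, this]
        exact .loop_exit (by simp [Mem.set, wordTape])

theorem exec_dec_word (hm : ∀ j, μ.head j < m) (ds : List Bool) (hd : ds.length + 2 < m) :
    Exec N m (dec i : TapeProgram B) (μ.set i (wordTape ds) 1) []
      (μ.set i (wordTape (stripWord (decWord ds))) 1) := by
  obtain ⟨pre, ds', h, h1, h2, h3⟩ :=
    exec_borrow (N := N) (i := i) (B := B) hm ds [] (by simp; omega)
  simp only [List.nil_append, List.length_nil, Nat.zero_add] at h h2 h3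
  have hl := length_decWord ds
  have hs : (decWord ds).length ≤ (stripWord (decWord ds)).length + 1 ∧
      (stripWord (decWord ds)).length ≤ (decWord ds).length := by
    unfold stripWord; split_ifs <;> simp; omega
  refine .seq_nil h (.seq_nil (μ' := μ.set i (wordTape (decWord ds)) (pre.length + 1)) ?_ ?_)
  · have := exec_on (N := N) (i := i) (B := B) hm (t := wordTape (pre ++ ds'))
      (h := pre.length + 1) (Option.map fun _ => false) .stay (by simp [HeadMove.apply]; omega)
    convert this using 2
    rw [wordTape_append, ← h2]
    rcases ds' with _ | ⟨_ | _, tl⟩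
    · simp [decWord, wordTape]
    · simp at h1
    · simp [decWord, update_wordTape]
    rfl
  · refine .seq_nil (exec_toEnd (q := ds'.length) hm _ (by omega) (by omega)) ?_
    refine .seq_nil (exec_on_id hm _ (by simp [HeadMove.apply]; omega)) ?_
    simp only [HeadMove.apply, Nat.add_sub_cancel]
    refine .seq_nil (exec_strip hm _ (by omega)) ?_
    refine .seq_nil (exec_on_id hm _ (by simp [HeadMove.apply]; omega)) ?_
    exact exec_rewind hm _ (by simp [HeadMove.apply]; omega) (by omega)

end TapeProgram

/-- The memory whose tape `i` holds the number `σ i` in binary, all heads being on cell `1`. -/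
def counterMem (σ : ℕ → ℕ) (p : ℕ) : Mem := ⟨fun i => wordTape (σ i).bits, fun _ => 1, p⟩

theorem counterMem_set (σ : ℕ → ℕ) (p i v : ℕ) :
    (counterMem σ p).set i (wordTape v.bits) 1 = counterMem (Function.update σ i v) p := by
  ext1
  · funext j
    rcases eq_or_ne j i with rfl | hj <;> simp [Mem.set, counterMem, *]
  · funext j
    rcases eq_or_ne j i with rfl | hj <;> simp [Mem.set, counterMem, *]
  · rfl

theorem counterMem_set_self (σ : ℕ → ℕ) (p i : ℕ) :
    (counterMem σ p).set i (wordTape (σ i).bits) 1 = counterMem σ p := by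
  rw [counterMem_set, Function.update_eq_self]

namespace TapeProgram

variable {B : Type} {N W : ℕ} {p : ℕ}

/-- Execution on counters, in a space sufficient for numbers below `2 ^ W`: `W` digits and the
blank cell before them, one more digit and the blank after it when a counter grows. -/
def Runs (N W p : ℕ) (s : TapeProgram B) (σ : ℕ → ℕ) (o : List B) (σ' : ℕ → ℕ) : Prop :=
  Exec N (W + 3) s (counterMem σ p) o (counterMem σ' p)

theorem runs_inc {σ : ℕ → ℕ} {i : ℕ} (h : σ i < 2 ^ W) :
    Runs N W p (inc i : TapeProgram B) σ [] (Function.update σ i (σ i + 1)) := by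
  have hl : (σ i).bits.length ≤ W := by rw [Nat.size_eq_bits_len]; exact Nat.size_le.2 h
  have := exec_inc_word (B := B) (N := N) (m := W + 3) (i := i) (μ := counterMem σ p)
    (fun _ => by simp [counterMem]) (σ i).bits (by omega)
  rwa [counterMem_set_self, ← bits_succ, counterMem_set] at this

theorem runs_dec {σ : ℕ → ℕ} {i : ℕ} (h : σ i < 2 ^ W) :
    Runs N W p (dec i : TapeProgram B) σ [] (Function.update σ i (σ i - 1)) := by
  have hl : (σ i).bits.length ≤ W := by rw [Nat.size_eq_bits_len]; exact Nat.size_le.2 h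
  have := exec_dec_word (B := B) (N := N) (m := W + 3) (i := i) (μ := counterMem σ p)
    (fun _ => by simp [counterMem]) (σ i).bits (by omega)
  rwa [counterMem_set_self, ← bits_pred, counterMem_set] at this

/-- Repeat `a` as long as counter `i` is not zero. -/
def whilePos (i : ℕ) (a : TapeProgram B) : TapeProgram B := .loop i Option.isSome a

theorem counterMem_isSome (σ : ℕ → ℕ) (p i : ℕ) :
    ((counterMem σ p).tape i ((counterMem σ p).head i)).isSome = decide (σ i ≠ 0) := by
  have : (wordTape (σ i).bits 1).isSome = decide (0 < (σ i).bits.length) := by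
    simp only [wordTape]
    rcases (σ i).bits <;> simp
  simp only [counterMem, this, Nat.size_eq_bits_len, Nat.size_pos]
  simp [Nat.pos_iff_ne_zero]

theorem runs_while_exit {σ : ℕ → ℕ} {i : ℕ} (a : TapeProgram B) (h : σ i = 0) :
    Runs N W p (whilePos i a) σ [] σ :=
  .loop_exit (by rw [counterMem_isSome]; simp [h])

theorem runs_while_step {σ σ' σ'' : ℕ → ℕ} {i : ℕ} {a : TapeProgram B} {o o' : List B}
    (h : σ i ≠ 0) (ha : Runs N W p a σ o σ') (hw : Runs N W p (whilePos i a) σ' o' σ'') :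
    Runs N W p (whilePos i a) σ (o ++ o') σ'' :=
  .loop_step (by rw [counterMem_isSome]; simp [h]) ha hw

theorem Runs.seq {a b : TapeProgram B} {σ σ' σ'' : ℕ → ℕ} {o o' : List B}
    (h : Runs N W p a σ o σ') (h' : Runs N W p b σ' o' σ'') :
    Runs N W p (.seq a b) σ (o ++ o') σ'' := Exec.seq h h'

theorem runs_emit {σ : ℕ → ℕ} (w : List B) : Runs N W p (.emit w) σ w σ := Exec.emit

end TapeProgram

/-! ### Generators: nested counting loops in logarithmic space -/

/-- Programs with nested loops over variables that they cannot assign to. Their value is a word;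
where a number is needed, it is the length of a word. Variables are de Bruijn indices. -/
inductive Generator where
  | emit (w : List CircuitSymbol)
  | var (i : ℕ)
  | seq (p q : Generator)
  /-- Run `p` with a new variable ranging, in increasing order, over the numbers below `b`. -/
  | loop (b p : Generator)
  /-- Run `p` if `c` is zero, and `q` otherwise. -/
  | ifz (c p q : Generator)
  /-- Truncated difference. -/
  | monus (p q : Generator)
  /-- Number of binary digits. -/
  | size (p : Generator)

namespace Generator

/-- The word generated by a program, given the values of its variables. -/
def den : Generator → List ℕ → List CircuitSymbol
  | .emit w, _ => w
  | .var i, l => List.replicate (l.getD i 0) .tick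
  | .seq p q, l => p.den l ++ q.den l
  | .loop b p, l => (List.range (b.den l).length).flatMap fun i => p.den (i :: l)
  | .ifz c p q, l => if (c.den l).length = 0 then p.den l else q.den l
  | .monus p q, l => List.replicate ((p.den l).length - (q.den l).length) .tick
  | .size p, l => List.replicate (p.den l).length.size .tick

/-- All numbers computed during the evaluation are below `2 ^ W`. -/
def Fits (W : ℕ) : Generator → List ℕ → Prop
  | .emit _, _ => True
  | .var _, _ => True
  | .seq p q, l => p.Fits W l ∧ q.Fits W l
  | .loop b p, l => b.Fits W l ∧ (b.den l).length < 2 ^ W ∧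
      ∀ i < (b.den l).length, p.Fits W (i :: l)
  | .ifz c p q, l => c.Fits W l ∧ (c.den l).length < 2 ^ W ∧ p.Fits W l ∧ q.Fits W l
  | .monus p q, l => p.Fits W l ∧ (p.den l).length < 2 ^ W ∧ q.Fits W l ∧ (q.den l).length < 2 ^ W
  | .size p, l => p.Fits W l ∧ (p.den l).length < 2 ^ W

theorem length_flatMap_range_le {B : Type} (f : ℕ → List B) (n b : ℕ)
    (h : ∀ i < n, (f i).length ≤ b) : ((List.range n).flatMap f).length ≤ n * b := by
  induction n with
  | zero => simp
  | succ n ih =>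
    rw [List.range_succ, List.flatMap_append, List.length_append]
    have := ih fun i hi => h i (by omega)
    have := h n (by omega)
    simp only [List.flatMap_cons, List.flatMap_nil, List.append_nil]
    nlinarith

/-- The numbers computed by a generator are polynomially bounded in terms of the variables. -/
theorem exists_pow_bound (p : Generator) : ∃ c : ℕ, ∀ X : ℕ, 2 ≤ X → ∀ l : List ℕ,
    (∀ x ∈ l, x ≤ X) → (p.den l).length ≤ X ^ c ∧ ∀ W, X ^ c < 2 ^ W → p.Fits W l := by
  induction p with
  | emit w =>
    refine ⟨w.length, fun X hX l _ => ⟨?_, fun _ _ => trivial⟩⟩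
    exact (Nat.lt_pow_self (by omega)).le
  | var i =>
    refine ⟨1, fun X hX l hl => ⟨?_, fun _ _ => trivial⟩⟩
    simp only [den, List.length_replicate, pow_one, List.getD_eq_getElem?_getD]
    rcases h : l[i]? with _ | x
    · simp
    · exact hl x (List.mem_of_getElem? h)
  | seq p q ihp ihq =>
    obtain ⟨c, hc⟩ := ihp
    obtain ⟨c', hc'⟩ := ihq
    refine ⟨max c c' + 1, fun X hX l hl => ?_⟩
    have h1 : X ^ c ≤ X ^ max c c' := Nat.pow_le_pow_right (by omega) (le_max_left _ _)
    have h2 : X ^ c' ≤ X ^ max c c' := Nat.pow_le_pow_right (by omega) (le_max_right _ _)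
    have h3 : X ^ max c c' * 2 ≤ X ^ (max c c' + 1) := by
      rw [pow_succ]; exact Nat.mul_le_mul_left _ hX
    obtain ⟨h4, h5⟩ := hc X hX l hl
    obtain ⟨h6, h7⟩ := hc' X hX l hl
    refine ⟨?_, fun W hW => ⟨h5 W (by omega), h7 W (by omega)⟩⟩
    simp only [den, List.length_append]
    omega
  | loop b p ihb ihp =>
    obtain ⟨c, hc⟩ := ihb
    obtain ⟨c', hc'⟩ := ihp
    refine ⟨c + (c + 1) * c', fun X hX l hl => ?_⟩
    obtain ⟨h4, h5⟩ := hc X hX l hl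
    have hX0 : 0 < X := by omega
    have h1 : X ^ c ≤ X ^ (c + (c + 1) * c') := Nat.pow_le_pow_right hX0 (by omega)
    -- The body is evaluated at most `X ^ c` times, with variables bounded by `X ^ (c + 1)`.
    have h2 : (X ^ (c + 1)) ^ c' ≤ X ^ (c + (c + 1) * c') := by
      rw [← pow_mul]; exact Nat.pow_le_pow_right hX0 (by omega)
    have key (i : ℕ) (hi : i < (b.den l).length) := hc' (X ^ (c + 1))
      (hX.trans (Nat.le_self_pow (by omega) X)) (i :: l) (by
        intro x hx
        rcases List.mem_cons.1 hx with rfl | hx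
        · exact (hi.le.trans h4).trans (Nat.pow_le_pow_right hX0 (by omega))
        · exact (hl x hx).trans (Nat.le_self_pow (by omega) X))
    refine ⟨?_, fun W hW => ⟨h5 W (by omega), by omega, fun i hi => (key i hi).2 W (by omega)⟩⟩
    refine (length_flatMap_range_le _ _ ((X ^ (c + 1)) ^ c') fun i hi => (key i hi).1).trans ?_
    rw [pow_add X c ((c + 1) * c'), pow_mul]
    exact Nat.mul_le_mul_right _ h4
  | ifz a p q iha ihp ihq =>
    obtain ⟨c, hc⟩ := iha
    obtain ⟨c', hc'⟩ := ihp
    obtain ⟨c'', hc''⟩ := ihq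
    refine ⟨c + c' + c'', fun X hX l hl => ?_⟩
    have h1 : X ^ c ≤ X ^ (c + c' + c'') := Nat.pow_le_pow_right (by omega) (by omega)
    have h2 : X ^ c' ≤ X ^ (c + c' + c'') := Nat.pow_le_pow_right (by omega) (by omega)
    have h3 : X ^ c'' ≤ X ^ (c + c' + c'') := Nat.pow_le_pow_right (by omega) (by omega)
    obtain ⟨h4, h5⟩ := hc X hX l hl
    obtain ⟨h6, h7⟩ := hc' X hX l hl
    obtain ⟨h8, h9⟩ := hc'' X hX l hl
    refine ⟨?_, fun W hW => ⟨h5 W (by omega), by omega, h7 W (by omega), h9 W (by omega)⟩⟩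
    simp only [den]
    split_ifs <;> omega
  | monus p q ihp ihq =>
    obtain ⟨c, hc⟩ := ihp
    obtain ⟨c', hc'⟩ := ihq
    refine ⟨c + c', fun X hX l hl => ?_⟩
    have h1 : X ^ c ≤ X ^ (c + c') := Nat.pow_le_pow_right (by omega) (by omega)
    have h2 : X ^ c' ≤ X ^ (c + c') := Nat.pow_le_pow_right (by omega) (by omega)
    obtain ⟨h4, h5⟩ := hc X hX l hl
    obtain ⟨h6, h7⟩ := hc' X hX l hl
    refine ⟨?_, fun W hW => ⟨h5 W (by omega), by omega, h7 W (by omega), by omega⟩⟩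
    simp only [den, List.length_replicate]
    omega
  | size p ih =>
    obtain ⟨c, hc⟩ := ih
    refine ⟨c, fun X hX l hl => ?_⟩
    obtain ⟨h4, h5⟩ := hc X hX l hl
    refine ⟨?_, fun W hW => ⟨h5 W hW, by omega⟩⟩
    simp only [den, List.length_replicate]
    exact (Nat.size_le.2 Nat.lt_two_pow_self).trans h4

open TapeProgram

/-- Send a word to the output (`none`), or its length to a counter. -/
def put (t : Option ℕ) (w : List CircuitSymbol) : TapeProgram CircuitSymbol :=
  match t with
  | none => .emit w
  | some r => w.foldr (fun _ s => .seq (inc r) s) (.emit [])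

/-- Set a counter to zero. -/
def clear (i : ℕ) : TapeProgram CircuitSymbol := whilePos i (.seq (dec i) (.emit []))

/-- A tape program for a generator. The variables are held by the counters `ρ`, the counters from
`d` on are free, and the result goes to `t`. Free counters are zero before and after the program.
* A variable is read destructively and restored from the counter `d`.
* In a loop, the counter `d` holds the number of remaining rounds and `d + 1` the loop variable.
* In a test, the counter `d + 1` is a flag that is cleared if the second branch is taken, so that the
  first branch is then skipped.
* The number of digits is the number of halvings, with rounding down, that lead to zero. -/
def compile : Generator → List ℕ → ℕ → Option ℕ → TapeProgram CircuitSymbol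
  | .emit w, _, _, t => put t w
  | .var i, ρ, d, t =>
    match ρ[i]? with
    | none => .emit []
    | some r => .seq (whilePos r (.seq (dec r) (.seq (inc d) (put t [.tick]))))
        (whilePos d (.seq (dec d) (inc r)))
  | .seq p q, ρ, d, t => .seq (p.compile ρ d t) (q.compile ρ d t)
  | .loop b p, ρ, d, t => .seq (b.compile ρ (d + 1) (some d))
      (.seq (whilePos d (.seq (dec d) (.seq (p.compile ((d + 1) :: ρ) (d + 2) t) (inc (d + 1)))))
        (clear (d + 1)))
  | .ifz c p q, ρ, d, t => .seq (c.compile ρ (d + 1) (some d))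
      (.seq (inc (d + 1))
        (.seq (whilePos d (.seq (clear d) (.seq (dec (d + 1)) (q.compile ρ (d + 2) t))))
          (whilePos (d + 1) (.seq (dec (d + 1)) (p.compile ρ (d + 2) t)))))
  | .monus p q, ρ, d, t => .seq (p.compile ρ (d + 1) (some d))
      (.seq (q.compile ρ (d + 2) (some (d + 1)))
        (.seq (whilePos (d + 1) (.seq (dec (d + 1)) (dec d)))
          (whilePos d (.seq (dec d) (put t [.tick])))))
  | .size p, ρ, d, t => .seq (p.compile ρ (d + 1) (some d))
      (whilePos d (.seq (dec d)
        (.seq (whilePos d (.seq (dec d) (.seq (dec d) (inc (d + 1)))))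
          (.seq (whilePos (d + 1) (.seq (dec (d + 1)) (inc d))) (put t [.tick])))))

/-- The counters after `n` symbols were sent to `t`. -/
def post (t : Option ℕ) (σ : ℕ → ℕ) (n : ℕ) : ℕ → ℕ :=
  match t with
  | none => σ
  | some r => Function.update σ r (σ r + n)

/-- The output after the word `w` was sent to `t`. -/
def sent (t : Option ℕ) (w : List CircuitSymbol) : List CircuitSymbol :=
  match t with
  | none => w
  | some _ => []

theorem sent_append (t : Option ℕ) (w w' : List CircuitSymbol) :
    sent t (w ++ w') = sent t w ++ sent t w' := by
  cases t <;> simp [sent]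

theorem sent_flatMap (t : Option ℕ) (L : List ℕ) (f : ℕ → List CircuitSymbol) :
    sent t (L.flatMap f) = L.flatMap fun i => sent t (f i) := by
  cases t <;> simp [sent]

theorem post_zero (t : Option ℕ) (σ : ℕ → ℕ) : post t σ 0 = σ := by
  cases t <;> simp [post]

theorem post_post (t : Option ℕ) (σ : ℕ → ℕ) (a b : ℕ) :
    post t (post t σ a) b = post t σ (a + b) := by
  cases t <;> simp [post, Nat.add_assoc]

theorem post_apply (t : Option ℕ) (σ : ℕ → ℕ) (n r : ℕ) :
    post t σ n r = if some r = t then σ r + n else σ r := by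
  cases t with
  | none => simp [post]
  | some s =>
    simp only [post, Function.update_apply, Option.some.injEq]
    split_ifs with h
    · rw [h]
    · rfl

variable {N W p : ℕ}

theorem _root_.TapeProgram.Runs.of_eq {s : TapeProgram CircuitSymbol} {σ τ τ' : ℕ → ℕ}
    {o o' : List CircuitSymbol} (h : Runs N W p s σ o τ) (ho : o = o') (hτ : τ = τ') :
    Runs N W p s σ o' τ' := ho ▸ hτ ▸ h

theorem runs_put (t : Option ℕ) (w : List CircuitSymbol) (σ : ℕ → ℕ)
    (h : ∀ r, some r = t → σ r + w.length < 2 ^ W) :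
    Runs N W p (put t w) σ (sent t w) (post t σ w.length) := by
  cases t with
  | none => exact runs_emit w
  | some r =>
    replace h := h r rfl
    induction w generalizing σ with
    | nil => simpa [put, sent, post] using runs_emit []
    | cons x w ih =>
      simp only [List.length_cons] at h
      have r1 := runs_inc (B := CircuitSymbol) (N := N) (p := p) (W := W) (σ := σ) (i := r)
        (by omega)
      refine (r1.seq (ih (Function.update σ r (σ r + 1)) ?_)).of_eq rfl ?_
      · simp only [Function.update_self]; omega
      · simp [post, Nat.add_assoc, Nat.add_comm 1]

theorem flatMap_nil_right (L : List ℕ) :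
    (L.flatMap fun _ => ([] : List CircuitSymbol)) = [] := by
  induction L <;> simp [*]

/-- A loop that counts the counter `d` down from `v`; `st k` is the state after `k` rounds. -/
theorem runs_countdown {d v : ℕ} {a : TapeProgram CircuitSymbol} (st : ℕ → ℕ → ℕ)
    (o : ℕ → List CircuitSymbol) (hv : v < 2 ^ W) (hst : ∀ k ≤ v, st k d = v - k)
    (ha : ∀ k < v, Runs N W p a (Function.update (st k) d (v - k - 1)) (o k) (st (k + 1))) :
    Runs N W p (whilePos d (.seq (dec d) a)) (st 0) ((List.range v).flatMap o) (st v) := by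
  induction v generalizing st o with
  | zero => exact runs_while_exit _ (by simpa using hst 0 le_rfl)
  | succ v ih =>
    have h0 : st 0 d = v + 1 := by simpa using hst 0 (by omega)
    have hd : Runs N W p (dec d : TapeProgram CircuitSymbol) (st 0) []
        (Function.update (st 0) d (v + 1 - 0 - 1)) := by
      have := runs_dec (B := CircuitSymbol) (N := N) (p := p) (W := W) (σ := st 0) (i := d)
        (by omega)
      rwa [h0] at this
    have h1 := ih (fun k => st (k + 1)) (fun k => o (k + 1)) (by omega)
      (fun k hk => by rw [hst _ (by omega)]; omega)
      (fun k hk => by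
        have := ha (k + 1) (by omega)
        rwa [show v + 1 - (k + 1) - 1 = v - k - 1 by omega] at this)
    refine (runs_while_step (by omega) (hd.seq (ha 0 (by omega))) h1).of_eq ?_ rfl
    simp [List.range_succ_eq_map, List.flatMap_map]

theorem runs_clear (i : ℕ) (σ : ℕ → ℕ) (h : σ i < 2 ^ W) :
    Runs N W p (clear i) σ [] (Function.update σ i 0) := by
  have := runs_countdown (N := N) (p := p) (W := W) (d := i) (v := σ i) (a := .emit [])
    (fun k => Function.update σ i (σ i - k)) (fun _ => []) h (fun k _ => by simp)
    (fun k hk => by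
      refine (runs_emit []).of_eq rfl ?_
      simp [Nat.sub_sub])
  simpa [clear, flatMap_nil_right] using this

/-- Moves the half of the counter `d`, rounded up, to the counter `d + 1`. The rounding comes from the
decrement being truncated at zero. -/
theorem runs_halve (d : ℕ) (a : ℕ) : ∀ (b : ℕ) (σ : ℕ → ℕ), a + b < 2 ^ W → σ d = a →
    σ (d + 1) = b →
    Runs N W p (whilePos d (.seq (dec d) (.seq (dec d) (inc (d + 1)))) : TapeProgram CircuitSymbol)
      σ [] (Function.update (Function.update σ d 0) (d + 1) (b + (a + 1) / 2)) := by
  induction a using Nat.strong_induction_on with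
  | _ a ih =>
    intro b σ hab hd hd1
    rcases Nat.eq_zero_or_pos a with rfl | ha
    · refine (runs_while_exit _ hd).of_eq rfl ?_
      funext r
      simp only [Function.update_apply]
      split_ifs with h h'
      · rw [h, hd1]; omega
      · rw [h', hd]
      · rfl
    · have r1 := runs_dec (B := CircuitSymbol) (N := N) (p := p) (W := W) (σ := σ) (i := d)
        (by omega)
      have r2 := runs_dec (B := CircuitSymbol) (N := N) (p := p) (W := W)
        (σ := Function.update σ d (σ d - 1)) (i := d) (by simp; omega)
      have r3 := runs_inc (B := CircuitSymbol) (N := N) (p := p) (W := W)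
        (σ := Function.update (Function.update σ d (σ d - 1)) d
          (Function.update σ d (σ d - 1) d - 1)) (i := d + 1) (by simp; omega)
      have r4 := ih (a - 2) (by omega) (b + 1) _ (by omega) (by simp [hd, Nat.sub_sub])
        (by simp [hd1] : Function.update (Function.update (Function.update σ d (σ d - 1)) d
          (Function.update σ d (σ d - 1) d - 1)) (d + 1)
          (Function.update (Function.update σ d (σ d - 1)) d
          (Function.update σ d (σ d - 1) d - 1) (d + 1) + 1) (d + 1) = b + 1)
      refine (runs_while_step (by omega) (r1.seq (r2.seq r3)) r4).of_eq rfl ?_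
      funext r
      simp only [Function.update_apply]
      split_ifs <;> omega

theorem runs_move (d : ℕ) (σ : ℕ → ℕ) (i : ℕ) (hi : i ≠ d) (h : σ d + σ i < 2 ^ W) :
    Runs N W p (whilePos d (.seq (dec d) (inc i)) : TapeProgram CircuitSymbol) σ []
      (Function.update (Function.update σ d 0) i (σ i + σ d)) := by
  have := runs_countdown (N := N) (p := p) (W := W) (d := d) (v := σ d) (a := inc i)
    (fun k => Function.update (Function.update σ d (σ d - k)) i (σ i + k)) (fun _ => [])
    (by omega) (fun k _ => by simp [Ne.symm hi])
    (fun k hk => by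
      refine (runs_inc (by simp [hi]; omega)).of_eq rfl ?_
      funext r
      simp only [Function.update_apply]
      split_ifs <;> omega)
  simpa [flatMap_nil_right] using this

/-- The loop of the program for `size`, started with the number `v` in counter `d`. As the counter is
decremented once on entering the loop, halving with rounding up turns `v` into `v / 2`. -/
theorem runs_size (d : ℕ) (t : Option ℕ) (ht : ∀ r, some r = t → r < d) (v : ℕ) :
    ∀ σ : ℕ → ℕ, v < 2 ^ W → σ d = v → σ (d + 1) = 0 →
    (∀ r, some r = t → σ r + v.size < 2 ^ W) →
    Runs N W p (whilePos d (.seq (dec d)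
        (.seq (whilePos d (.seq (dec d) (.seq (dec d) (inc (d + 1)))))
          (.seq (whilePos (d + 1) (.seq (dec (d + 1)) (inc d))) (put t [.tick]))))) σ
      (sent t (List.replicate v.size .tick)) (Function.update (post t σ v.size) d 0) := by
  induction v using Nat.strong_induction_on with
  | _ v ih =>
    intro σ hv hd hd1 htv
    rcases Nat.eq_zero_or_pos v with rfl | hpos
    · refine (runs_while_exit _ hd).of_eq (by cases t <;> simp [sent]) ?_
      funext r
      simp only [Nat.size_zero, post_zero, Function.update_apply]
      split_ifs with h
      · rw [h, hd]
      · rfl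
    · have hsize : v.size = (v / 2).size + 1 := by
        have h1 : v ≠ 0 := by omega
        have h2 : v = Nat.bit (v.testBit 0) (v / 2) := by
          simp [← Nat.shiftRight_one]
        conv_lhs => rw [h2]
        rw [Nat.size_bit (by rw [← h2]; exact h1)]
      have r1 := runs_dec (B := CircuitSymbol) (N := N) (p := p) (W := W) (σ := σ) (i := d)
        (by omega)
      have r2 := runs_halve (N := N) (p := p) (W := W) d (v - 1) 0
        (Function.update σ d (σ d - 1)) (by omega) (by simp [hd]) (by simp [hd1])
      have r3 := runs_move (N := N) (p := p) (W := W) (d + 1) _ d (by omega)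
        (by simp; omega : Function.update (Function.update (Function.update σ d (σ d - 1)) d 0)
          (d + 1) (0 + (v - 1 + 1) / 2) (d + 1) +
          Function.update (Function.update (Function.update σ d (σ d - 1)) d 0)
          (d + 1) (0 + (v - 1 + 1) / 2) d < 2 ^ W)
      have e : Function.update (Function.update (Function.update (Function.update
          (Function.update σ d (σ d - 1)) d 0) (d + 1) (0 + (v - 1 + 1) / 2)) (d + 1) 0) d
          (Function.update (Function.update (Function.update σ d (σ d - 1)) d 0)
            (d + 1) (0 + (v - 1 + 1) / 2) d + Function.update (Function.update
            (Function.update σ d (σ d - 1)) d 0) (d + 1) (0 + (v - 1 + 1) / 2) (d + 1)) =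
          Function.update σ d (v / 2) := by
        funext r
        simp only [Function.update_apply]
        split_ifs <;> first | omega | rfl | skip
        all_goals subst_vars; omega
      rw [e] at r3
      have r4 := runs_put (N := N) (p := p) (W := W) t [.tick] (Function.update σ d (v / 2))
        (fun r hr => by
          have := htv r hr
          have := ht r hr
          rw [Function.update_of_ne (by omega)]
          simp only [List.length_singleton]; omega)
      have r5 := ih (v / 2) (by omega) (post t (Function.update σ d (v / 2)) [CircuitSymbol.tick].length)
        (by omega) (by
          rw [post_apply, if_neg fun h => by have := ht _ h; omega]; simp)
        (by rw [post_apply, if_neg fun h => by have := ht _ h; omega]; simpa using hd1)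
        (fun r hr => by
          have := htv r hr
          have := ht r hr
          rw [post_apply, if_pos hr, Function.update_of_ne (by omega)]
          simp only [List.length_singleton]; omega)
      refine (runs_while_step (by omega) (r1.seq (r2.seq (r3.seq r4))) r5).of_eq ?_ ?_
      · simp only [List.nil_append]
        rw [← sent_append, hsize, List.replicate_succ]
        rfl
      · rw [post_post]
        funext r
        simp only [Function.update_apply, post_apply, hsize, List.length_singleton]
        split_ifs <;> omega

/-- The tape program of a generator sends the generated word to its target, and leaves all other
counters as they were. The target is neither a variable nor a free counter. -/
theorem runs_compile (hW : 0 < W) (g : Generator) : ∀ (l ρ : List ℕ) (d : ℕ) (t : Option ℕ)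
    (σ : ℕ → ℕ), ρ.map σ = l → (∀ r ∈ ρ, r < d) → (∀ r, d ≤ r → σ r = 0) →
    (∀ r, some r = t → r < d ∧ r ∉ ρ ∧ σ r + (g.den l).length < 2 ^ W) →
    (∀ x ∈ l, x < 2 ^ W) → g.Fits W l →
    Runs N W p (g.compile ρ d t) σ (sent t (g.den l)) (post t σ (g.den l).length) := by
  have h1W : 1 < 2 ^ W := Nat.one_lt_two_pow (by omega)
  induction g with
  | emit w =>
    intro l ρ d t σ _ _ _ ht _ _
    exact runs_put t w σ fun r hr => (ht r hr).2.2
  | var i =>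
    intro l ρ d t σ hl hρ hσ ht hx _
    simp only [compile, den] at ht ⊢
    rcases hi : ρ[i]? with _ | r
    · have : l.getD i 0 = 0 := by rw [← hl]; simp [hi]
      rw [this, List.length_replicate, post_zero]
      exact (runs_emit []).of_eq (by cases t <;> simp [sent]) rfl
    · have hr : r ∈ ρ := List.mem_of_getElem? hi
      have hv : l.getD i 0 = σ r := by rw [← hl]; simp [hi]
      have hlt : σ r < 2 ^ W := hx _ (by rw [← hl]; exact List.mem_map_of_mem hr)
      have hrd := hρ r hr
      have hrt : some r ≠ t := fun h => (ht r h).2.1 hr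
      have hdt : some d ≠ t := fun h => by have := (ht d h).1; omega
      have hd0 := hσ d le_rfl
      rw [hv] at ht ⊢
      simp only [List.length_replicate] at ht ⊢
      have r1 := runs_countdown (N := N) (p := p) (W := W) (d := r) (v := σ r)
        (a := .seq (inc d) (put t [.tick]))
        (fun k => Function.update (Function.update (post t σ k) r (σ r - k)) d k)
        (fun _ => sent t [.tick]) hlt
        (fun k hk => by simp [show r ≠ d by omega])
        (fun k hk => by
          refine ((runs_inc ?_).seq (runs_put t _ _ ?_)).of_eq rfl ?_
          · simp only [Function.update_apply]
            split_ifs <;> omega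
          · intro s hs
            have := ht s hs
            have h1 : s ≠ r := by rintro rfl; exact hrt hs
            simp only [Function.update_apply, post_apply, hs, List.length_singleton]
            split_ifs <;> omega
          · funext s
            by_cases h1 : some s = t
            · have h2 : s ≠ r := by rintro rfl; exact hrt h1
              have h3 : s ≠ d := by rintro rfl; exact hdt h1
              simp [Function.update_apply, post_apply, h1, h2, h3, Nat.add_assoc]
            · simp only [Function.update_apply, post_apply, if_neg h1]
              split_ifs <;> omega)
      have e0 : Function.update (Function.update (post t σ 0) r (σ r - 0)) d 0 = σ := by
        rw [post_zero]
        funext s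
        simp only [Function.update_apply]
        split_ifs with h1 h2
        · rw [h1, hd0]
        · rw [h2]; rfl
        · rfl
      have r2 := runs_move (N := N) (p := p) (W := W) d
        (Function.update (Function.update (post t σ (σ r)) r (σ r - σ r)) d (σ r)) r
        (by omega) (by simp [show r ≠ d by omega]; omega)
      rw [e0] at r1
      refine (r1.seq r2).of_eq ?_ ?_
      · rw [← sent_flatMap, List.append_nil]
        congr 1
        generalize σ r = v
        clear * -
        induction v with
        | zero => rfl
        | succ v ih =>
          rw [List.range_succ, List.flatMap_append, ih, List.replicate_succ']
          simp
      · funext s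
        by_cases h1 : some s = t
        · have h2 : s ≠ r := by rintro rfl; exact hrt h1
          have h3 : s ≠ d := by rintro rfl; exact hdt h1
          simp [Function.update_apply, post_apply, h1, h2, h3]
        · simp only [Function.update_apply, post_apply, if_neg h1]
          split_ifs <;> first | omega | rfl | skip
          all_goals subst_vars; omega
  | seq p q ihp ihq =>
    intro l ρ d t σ hl hρ hσ ht hx hF
    simp only [den, List.length_append] at ht
    refine ((ihp l ρ d t σ hl hρ hσ (fun r hr => ?_) hx hF.1).seq
      (ihq l ρ d t _ ?_ hρ ?_ (fun r hr => ?_) hx hF.2)).of_eq ?_ ?_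
    · have := ht r hr
      exact ⟨this.1, this.2.1, by omega⟩
    · rw [← hl]
      refine List.map_congr_left fun r hr => ?_
      rw [post_apply, if_neg fun h => (ht r h).2.1 hr]
    · intro r hr
      rw [post_apply, if_neg fun h => by have := (ht r h).1; omega]
      exact hσ r hr
    · have := ht r hr
      rw [post_apply, if_pos hr]
      exact ⟨this.1, this.2.1, by omega⟩
    · rw [← sent_append]; rfl
    · rw [post_post]; simp [den]
  | loop b g ihb ihg =>
    intro l ρ d t σ hl hρ hσ ht hx hF
    obtain ⟨hb, hbW, hg⟩ := hF
    have hd0 := hσ d le_rfl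
    have hd1 := hσ (d + 1) (by omega)
    have hdt : some d ≠ t := fun h => by have := (ht d h).1; omega
    have hdt1 : some (d + 1) ≠ t := fun h => by have := (ht _ h).1; omega
    simp only [den] at ht ⊢
    have r1 := ihb l ρ (d + 1) (some d) σ hl (fun r hr => by have := hρ r hr; omega)
      (fun r hr => hσ r (by omega)) (fun r hr => by
        obtain rfl : r = d := Option.some.inj hr
        exact ⟨by omega, fun h => by have := hρ r h; omega, by omega⟩) hx hb
    generalize hv : (b.den l).length = v at *
    have hpost : post (some d) σ v = Function.update σ d v := by simp [post, hd0]
    rw [hpost] at r1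
    set n : ℕ → ℕ := fun k => ((List.range k).flatMap fun i => g.den (i :: l)).length with hn
    have hn1 (k : ℕ) : n (k + 1) = n k + (g.den (k :: l)).length := by
      simp [hn, List.range_succ]
    have hmono : Monotone n := monotone_nat_of_le_succ fun k => by rw [hn1]; omega
    have r2 := runs_countdown (N := N) (p := p) (W := W) (d := d) (v := v)
      (a := .seq (g.compile ((d + 1) :: ρ) (d + 2) t) (inc (d + 1)))
      (fun k => Function.update (Function.update (post t σ (n k)) d (v - k)) (d + 1) k)
      (fun k => sent t (g.den (k :: l))) hbW
      (fun k hk => by simp)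
      (fun k hk => by
        refine ((ihg (k :: l) ((d + 1) :: ρ) (d + 2) t _ ?_ ?_ ?_ ?_ ?_ (hg k hk)).seq
          (runs_inc ?_)).of_eq (List.append_nil _) ?_
        · rw [List.map_cons]
          congr 1
          · simp
          · rw [← hl]
            refine List.map_congr_left fun r hr => ?_
            have := hρ r hr
            have h1 : some r ≠ t := fun h => (ht r h).2.1 hr
            simp [post_apply, h1, show r ≠ d by omega,
              show r ≠ d + 1 by omega]
        · intro r hr
          rcases List.mem_cons.1 hr with rfl | hr
          · omega
          · have := hρ r hr; omega
        · intro r hr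
          have h1 : some r ≠ t := fun h => by have := (ht r h).1; omega
          simp only [Function.update_apply, post_apply, if_neg h1]
          rw [if_neg (by omega), if_neg (by omega), if_neg (by omega)]
          exact hσ r (by omega)
        · intro r hr
          have h2 := ht r hr
          refine ⟨by omega, ?_, ?_⟩
          · rw [List.mem_cons]
            rintro (h | h)
            · omega
            · exact h2.2.1 h
          · simp only [Function.update_apply, post_apply, if_pos hr]
            rw [if_neg (by omega), if_neg (by omega), if_neg (by omega)]
            have h3 := hmono (show k + 1 ≤ v by omega)
            rw [hn1] at h3
            have h4 := h2.2.2
            change σ r + n v < 2 ^ W at h4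
            omega
        · intro x hx'
          rcases List.mem_cons.1 hx' with rfl | hx'
          · omega
          · exact hx x hx'
        · rw [post_apply, if_neg hdt1]
          simp; omega
        · funext s
          by_cases h1 : some s = t
          · have h2 : s ≠ d + 1 := by rintro rfl; exact hdt1 h1
            have h3 : s ≠ d := by rintro rfl; exact hdt h1
            simp [post_apply, h1, h2, h3, hn1, Nat.add_assoc]
          · simp only [Function.update_apply, post_apply, if_neg h1, if_neg hdt1]
            split_ifs <;> omega)
    have e0 : Function.update (Function.update (post t σ (n 0)) d (v - 0)) (d + 1) 0 =
        Function.update σ d v := by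
      have : n 0 = 0 := by simp [hn]
      rw [this, post_zero]
      funext s
      simp only [Function.update_apply]
      split_ifs with h1 h2 h3
      · omega
      · rw [h1, hd1]
      · rfl
      · rfl
    rw [e0] at r2
    have r3 := runs_clear (N := N) (p := p) (W := W) (d + 1)
      (Function.update (Function.update (post t σ (n v)) d (v - v)) (d + 1) v)
      (by simpa using hbW)
    refine (r1.seq (r2.seq r3)).of_eq ?_ ?_
    · cases t <;> simp [sent]
    · change _ = post t σ (n v)
      funext s
      by_cases h1 : some s = t
      · have h2 : s ≠ d + 1 := by rintro rfl; exact hdt1 h1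
        have h3 : s ≠ d := by rintro rfl; exact hdt h1
        simp [post_apply, h1, h2, h3]
      · simp only [Function.update_apply, post_apply, if_neg h1]
        split_ifs with h2 h3
        · rw [h2, hd1]
        · rw [h3, hd0]; omega
        · rfl
  | ifz c g g' ihc ihg ihg' =>
    intro l ρ d t σ hl hρ hσ ht hx hF
    obtain ⟨hc, hcW, hg, hg'⟩ := hF
    have hd0 := hσ d le_rfl
    have hd1 := hσ (d + 1) (by omega)
    have hdt : some d ≠ t := fun h => by have := (ht d h).1; omega
    have hdt1 : some (d + 1) ≠ t := fun h => by have := (ht _ h).1; omega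
    have r1 := ihc l ρ (d + 1) (some d) σ hl (fun r hr => by have := hρ r hr; omega)
      (fun r hr => hσ r (by omega)) (fun r hr => by
        obtain rfl : r = d := Option.some.inj hr
        exact ⟨by omega, fun h => by have := hρ r h; omega, by omega⟩) hx hc
    simp only [den] at ht ⊢
    generalize hv : (c.den l).length = v at *
    have hpost : post (some d) σ v = Function.update σ d v := by simp [post, hd0]
    rw [hpost] at r1
    have r2 : Runs N W p (inc (d + 1) : TapeProgram CircuitSymbol) (Function.update σ d v) []
        (Function.update (Function.update σ d v) (d + 1) 1) := by
      refine (runs_inc ?_).of_eq rfl ?_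
      · simp [hd1]
      · simp [hd1]
    have hρ' : ∀ r ∈ ρ, r < d + 2 := fun r hr => by have := hρ r hr; omega
    have hσ' : ∀ r, d + 2 ≤ r → σ r = 0 := fun r hr => hσ r (by omega)
    rcases Nat.eq_zero_or_pos v with hv0 | hv0
    · rw [if_pos hv0] at ht ⊢
      subst hv0
      have r3 := runs_while_exit (N := N) (p := p) (W := W)
        (σ := Function.update (Function.update σ d 0) (d + 1) 1) (i := d)
        (.seq (clear d) (.seq (dec (d + 1)) (g'.compile ρ (d + 2) t))) (by simp)
      have r4 : Runs N W p (dec (d + 1) : TapeProgram CircuitSymbol)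
          (Function.update (Function.update σ d 0) (d + 1) 1) [] σ := by
        refine (runs_dec (by simpa using h1W)).of_eq rfl ?_
        funext s
        simp only [Function.update_apply]
        split_ifs with h1 h2
        · rw [h1, hd1]
        · rw [h2, hd0]
        · rfl
      have r5 := ihg l ρ (d + 2) t σ hl hρ' hσ'
        (fun r hr => by have := ht r hr; exact ⟨by omega, this.2.1, this.2.2⟩) hx hg
      have r6 := runs_while_step (N := N) (p := p) (W := W) (i := d + 1) (by simp) (r4.seq r5)
        (runs_while_exit _ (by rw [post_apply, if_neg hdt1, hd1]))
      refine (r1.seq (r2.seq (r3.seq r6))).of_eq ?_ rfl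
      simp [sent]
    · rw [if_neg (by omega)] at ht ⊢
      have r3 : Runs N W p (clear d) (Function.update (Function.update σ d v) (d + 1) 1) []
          (Function.update σ (d + 1) 1) := by
        refine (runs_clear d _ (by simpa [Function.update_apply] using hcW)).of_eq rfl ?_
        funext s
        simp only [Function.update_apply]
        split_ifs with h1 h2 h3 <;> first | omega | rfl | (rw [h1, hd0])
      have r4 : Runs N W p (dec (d + 1) : TapeProgram CircuitSymbol)
          (Function.update σ (d + 1) 1) [] σ := by
        refine (runs_dec (by simpa using h1W)).of_eq rfl ?_
        funext s
        simp only [Function.update_apply]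
        split_ifs with h1
        · rw [h1, hd1]
        · rfl
      have r5 := ihg' l ρ (d + 2) t σ hl hρ' hσ'
        (fun r hr => by have := ht r hr; exact ⟨by omega, this.2.1, this.2.2⟩) hx hg'
      have r6 := runs_while_step (N := N) (p := p) (W := W) (i := d)
        (σ := Function.update (Function.update σ d v) (d + 1) 1) (by simp; omega)
        (r3.seq (r4.seq r5)) (runs_while_exit _ (by rw [post_apply, if_neg hdt, hd0]))
      have r7 := runs_while_exit (N := N) (p := p) (W := W)
        (σ := post t σ (g'.den l).length) (i := d + 1)
        (.seq (dec (d + 1)) (g.compile ρ (d + 2) t)) (by rw [post_apply, if_neg hdt1, hd1])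
      refine (r1.seq (r2.seq (r6.seq r7))).of_eq ?_ rfl
      simp [sent]
  | monus g g' ihg ihg' =>
    intro l ρ d t σ hl hρ hσ ht hx hF
    obtain ⟨hg, hgW, hg', hgW'⟩ := hF
    have hd0 := hσ d le_rfl
    have hd1 := hσ (d + 1) (by omega)
    have hdt : some d ≠ t := fun h => by have := (ht d h).1; omega
    have hdt1 : some (d + 1) ≠ t := fun h => by have := (ht _ h).1; omega
    have r1 := ihg l ρ (d + 1) (some d) σ hl (fun r hr => by have := hρ r hr; omega)
      (fun r hr => hσ r (by omega)) (fun r hr => by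
        obtain rfl : r = d := Option.some.inj hr
        exact ⟨by omega, fun h => by have := hρ r h; omega, by omega⟩) hx hg
    have r2 := ihg' l ρ (d + 2) (some (d + 1)) (post (some d) σ (g.den l).length)
      (by
        rw [← hl]
        refine List.map_congr_left fun r hr => ?_
        have := hρ r hr
        simp [post, show r ≠ d by omega])
      (fun r hr => by have := hρ r hr; omega)
      (fun r hr => by simp [post, show r ≠ d by omega, hσ r (by omega)])
      (fun r hr => by
        obtain rfl : r = d + 1 := Option.some.inj hr
        refine ⟨by omega, fun h => by have := hρ _ h; omega, ?_⟩
        simpa [post, hd1] using hgW') hx hg'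
    simp only [den, List.length_replicate] at ht ⊢
    generalize (g.den l).length = v at *
    generalize (g'.den l).length = v' at *
    have e1 : post (some (d + 1)) (post (some d) σ v) v' =
        Function.update (Function.update σ d v) (d + 1) v' := by simp [post, hd0, hd1]
    rw [e1] at r2
    have r3 := runs_countdown (N := N) (p := p) (W := W) (d := d + 1) (v := v') (a := dec d)
      (fun k => Function.update (Function.update σ d (v - k)) (d + 1) (v' - k)) (fun _ => [])
      hgW' (fun k hk => by simp) (fun k hk => by
        refine (runs_dec (by simp; omega)).of_eq rfl ?_
        funext s
        simp only [Function.update_apply]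
        split_ifs <;> omega)
    have r4 := runs_countdown (N := N) (p := p) (W := W) (d := d) (v := v - v')
      (a := put t [.tick]) (fun k => Function.update (post t σ k) d (v - v' - k))
      (fun _ => sent t [.tick]) (by omega) (fun k hk => by simp) (fun k hk => by
        refine (runs_put t _ _ ?_).of_eq rfl ?_
        · intro s hs
          have := ht s hs
          simp only [Function.update_apply, post_apply, hs, List.length_singleton]
          split_ifs <;> omega
        · funext s
          by_cases h1 : some s = t
          · have h3 : s ≠ d := by rintro rfl; exact hdt h1
            simp [post_apply, h1, h3, Nat.add_assoc]
          · simp only [Function.update_apply, post_apply, if_neg h1]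
            split_ifs <;> omega)
    have e2 : Function.update (Function.update σ d (v - v')) (d + 1) (v' - v') =
        Function.update (post t σ 0) d (v - v' - 0) := by
      rw [post_zero]
      funext s
      simp only [Function.update_apply]
      split_ifs with h1 h2
      · omega
      · rw [h1, hd1]; omega
      · rfl
      · rfl
    rw [e2] at r3
    refine (r1.seq (r2.seq (r3.seq r4))).of_eq ?_ ?_
    · have : (List.replicate (v - v') CircuitSymbol.tick) =
          (List.range (v - v')).flatMap fun _ => [CircuitSymbol.tick] := by
        generalize v - v' = u
        clear * -
        induction u with
        | zero => rfl
        | succ v ih =>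
          rw [List.range_succ, List.flatMap_append, ← ih, List.replicate_succ']
          simp
      rw [this, sent_flatMap]
      simp [sent]
    · funext s
      simp only [Function.update_apply]
      split_ifs with h1
      · rw [h1, post_apply, if_neg hdt, hd0]; omega
      · rfl
  | size g ih =>
    intro l ρ d t σ hl hρ hσ ht hx hF
    obtain ⟨hg, hgW⟩ := hF
    have hd0 := hσ d le_rfl
    have hd1 := hσ (d + 1) (by omega)
    have hdt : some d ≠ t := fun h => by have := (ht d h).1; omega
    have r1 := ih l ρ (d + 1) (some d) σ hl (fun r hr => by have := hρ r hr; omega)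
      (fun r hr => hσ r (by omega)) (fun r hr => by
        obtain rfl : r = d := Option.some.inj hr
        exact ⟨by omega, fun h => by have := hρ r h; omega, by omega⟩) hx hg
    simp only [den, List.length_replicate] at ht ⊢
    have r2 := runs_size (N := N) (p := p) (W := W) d t (fun r hr => (ht r hr).1)
      (g.den l).length (post (some d) σ (g.den l).length) hgW (by simp [post, hd0])
      (by simp [post, hd1])
      (fun r hr => by
        have := ht r hr
        simpa [post, Function.update_apply, show r ≠ d by omega] using this.2.2)
    refine (r1.seq r2).of_eq (by simp [sent]) ?_
    funext s
    simp only [Function.update_apply, post_apply]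
    have h1 : ∀ x, (some x = some d) = (x = d) := by simp
    simp only [h1]
    split_ifs with h2 h3 h4 <;> first | rfl | (subst h2; first | contradiction | omega)

end Generator

open TapeProgram in
/-- The word generated from the length of the input (plus one) is written down by a transducer in
logarithmic space. -/
theorem Generator.exists_transducer (g : Generator) : ∃ T : Transducer Unit CircuitSymbol, ∃ a : ℕ,
    ∀ N : ℕ, T.Outputs (List.replicate N ()) (g.den [N + 1]) ∧
      T.UsesSpace (List.replicate N ()) (a * (Nat.log 2 N + 1)) := by
  obtain ⟨c, hc⟩ := g.exists_pow_bound
  let s : TapeProgram CircuitSymbol := .seq (.act (fun _ => id) (fun _ => .right))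
    (.seq (.scan (inc 0)) (g.compile [0] 1 none))
  refine ⟨transducer s, 3 * c + 6, fun N => ?_⟩
  set W := c * (Nat.log 2 (N + 2) + 1) + Nat.log 2 (N + 2) + 1 with hW
  have hX : N + 2 < 2 ^ (Nat.log 2 (N + 2) + 1) := Nat.lt_pow_succ_log_self (by omega) _
  have hXc : (N + 2) ^ c < 2 ^ W := by
    refine lt_of_le_of_lt (Nat.pow_le_pow_left hX.le c) ?_
    rw [← pow_mul, Nat.mul_comm]
    exact Nat.pow_lt_pow_right (by omega) (by omega)
  have hNW : N + 2 < 2 ^ W := hX.trans_le (Nat.pow_le_pow_right (by omega) (by omega))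
  have hlog : Nat.log 2 (N + 2) ≤ Nat.log 2 N + 2 := by
    refine Nat.lt_succ_iff.1 (Nat.log_lt_of_lt_pow (by omega) ?_)
    have := Nat.lt_pow_succ_log_self (b := 2) (by omega) N
    rw [show (Nat.log 2 N + 2).succ = Nat.log 2 N + 1 + 2 from rfl, pow_add]
    omega
  have hspace : W + 3 ≤ (3 * c + 6) * (Nat.log 2 N + 1) := by
    have h1 : c * (Nat.log 2 (N + 2) + 1) ≤ c * (Nat.log 2 N + 3) :=
      Nat.mul_le_mul_left _ (by omega)
    nlinarith [Nat.zero_le (c * Nat.log 2 N)]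
  -- The input head starts on the left marker, so `N + 1` moves bring it to the right marker.
  have hscan : ∀ q k : ℕ, k + q = N + 1 → Exec N (W + 3)
      (.scan (inc 0) : TapeProgram CircuitSymbol)
      (counterMem (Function.update (fun _ => 0) 0 k) k) []
      (counterMem (Function.update (fun _ => 0) 0 (N + 1)) (N + 1)) := by
    intro q
    induction q with
    | zero =>
      intro k hk
      obtain rfl : k = N + 1 := by omega
      exact .scan_exit rfl
    | succ q ih =>
      intro k hk
      have h1 := runs_inc (B := CircuitSymbol) (N := N) (p := k + 1) (W := W)
        (σ := Function.update (fun _ => 0) 0 k) (i := 0) (by simp; omega)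
      simp only [Function.update_self, Function.update_idem] at h1
      have hk : (counterMem (Function.update (fun _ => 0) 0 k) k).inp ≤ N := by
        simp only [counterMem]; omega
      simpa using Exec.scan_step hk h1 (ih (k + 1) (by omega))
  have hgen := runs_compile (N := N) (p := N + 1) (W := W) (by omega) g [N + 1] [0] 1 none
    (Function.update (fun _ => 0) 0 (N + 1)) (by simp) (by simp)
    (fun r hr => by simp [show r ≠ 0 by omega]) (by simp) (by simp; omega)
    ((hc (N + 2) (by omega) [N + 1] (by simp)).2 W hXc)
  have hinit : Exec N (W + 3) (.act (fun _ => id) (fun _ => .right) : TapeProgram CircuitSymbol)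
      initialMem [] (counterMem (Function.update (fun _ => 0) 0 0) 0) := by
    have : counterMem (Function.update (fun _ => 0) 0 0) 0 =
        ⟨fun i => Function.update (initialMem.tape i) (initialMem.head i)
            (id (initialMem.tape i (initialMem.head i))),
          fun i => HeadMove.right.apply (initialMem.head i), initialMem.inp⟩ := by
      ext i q
      · rcases q with _ | q <;> simp [counterMem, initialMem, wordTape]
      · simp [counterMem, initialMem]
      · rfl
    rw [this]
    exact .act fun i => by simp [initialMem]
  obtain ⟨h1, h2⟩ := (hinit.seq ((hscan (N + 1) 0 (by omega)).seq hgen)).outputs (by omega)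
  simp only [List.nil_append, sent] at h1
  exact ⟨h1, fun c hc i => (h2 c hc i).trans_le hspace⟩

/-- `F` is generated by nested loops in logarithmic space from its list of arguments. -/
def IsGenerated (F : List ℕ → List CircuitSymbol) : Prop := ∃ g : Generator, ∀ l, g.den l = F l

/-- `f` is the length of a generated word. -/
def IsCounted (f : List ℕ → ℕ) : Prop := ∃ g : Generator, ∀ l, (g.den l).length = f l

namespace IsGenerated

theorem emit (w : List CircuitSymbol) : IsGenerated fun _ => w := ⟨.emit w, fun _ => rfl⟩

theorem append {F G : List ℕ → List CircuitSymbol} (hF : IsGenerated F) (hG : IsGenerated G) :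
    IsGenerated fun l => F l ++ G l := by
  obtain ⟨f, hf⟩ := hF
  obtain ⟨g, hg⟩ := hG
  exact ⟨.seq f g, fun l => by simp [Generator.den, hf, hg]⟩

theorem flatMap_range {b : List ℕ → ℕ} {F : List ℕ → List CircuitSymbol} (hb : IsCounted b)
    (hF : IsGenerated F) : IsGenerated fun l => (List.range (b l)).flatMap fun i => F (i :: l) := by
  obtain ⟨f, hf⟩ := hF
  obtain ⟨g, hg⟩ := hb
  exact ⟨.loop g f, fun l => by simp [Generator.den, hf, hg]⟩

theorem flatMap_const (s : ℕ) {F : ℕ → List ℕ → List CircuitSymbol} (hF : ∀ i, IsGenerated (F i)) :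
    IsGenerated fun l => (List.range s).flatMap fun i => F i l := by
  induction s with
  | zero => exact emit []
  | succ s ih => simpa [List.range_succ] using ih.append (hF s)

theorem ite_le {f g : List ℕ → ℕ} {F G : List ℕ → List CircuitSymbol} (hf : IsCounted f)
    (hg : IsCounted g) (hF : IsGenerated F) (hG : IsGenerated G) :
    IsGenerated fun l => if f l ≤ g l then F l else G l := by
  obtain ⟨f', hf⟩ := hf
  obtain ⟨g', hg⟩ := hg
  obtain ⟨F', hF⟩ := hF
  obtain ⟨G', hG⟩ := hG
  refine ⟨.ifz (.monus f' g') F' G', fun l => ?_⟩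
  simp [Generator.den, hf, hg, hF, hG, Nat.sub_eq_zero_iff_le]

theorem ticks {f : List ℕ → ℕ} (hf : IsCounted f) :
    IsGenerated fun l => List.replicate (f l) .tick := by
  obtain ⟨f', hf⟩ := hf
  refine ⟨.monus f' (.emit []), fun l => ?_⟩
  simp [Generator.den, hf]

end IsGenerated

namespace IsCounted

theorem const (c : ℕ) : IsCounted fun _ => c :=
  ⟨.emit (List.replicate c .tick), fun _ => by simp [Generator.den]⟩

theorem var (i : ℕ) : IsCounted fun l => l.getD i 0 := ⟨.var i, fun _ => by simp [Generator.den]⟩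

theorem add {f g : List ℕ → ℕ} (hf : IsCounted f) (hg : IsCounted g) :
    IsCounted fun l => f l + g l := by
  obtain ⟨f', hf⟩ := hf
  obtain ⟨g', hg⟩ := hg
  exact ⟨.seq f' g', fun l => by simp [Generator.den, hf, hg]⟩

theorem sub {f g : List ℕ → ℕ} (hf : IsCounted f) (hg : IsCounted g) :
    IsCounted fun l => f l - g l := by
  obtain ⟨f', hf⟩ := hf
  obtain ⟨g', hg⟩ := hg
  exact ⟨.monus f' g', fun l => by simp [Generator.den, hf, hg]⟩

theorem const_mul (c : ℕ) {f : List ℕ → ℕ} (hf : IsCounted f) : IsCounted fun l => c * f l := by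
  induction c with
  | zero => simpa using const 0
  | succ c ih => simpa [Nat.succ_mul] using ih.add hf

/-- In a product, the second factor is evaluated below one more binder. -/
theorem mul {f g : List ℕ → ℕ} (hf : IsCounted f) (hg : IsCounted fun l => g l.tail) :
    IsCounted fun l => f l * g l := by
  obtain ⟨f', hf⟩ := hf
  obtain ⟨g', hg⟩ := hg
  refine ⟨.loop f' g', fun l => ?_⟩
  simp [Generator.den, hf, hg, List.length_flatMap]

theorem pow {f : List ℕ → ℕ} (hf : ∀ j, IsCounted fun l => f (List.tail^[j] l)) (k : ℕ) :
    IsCounted fun l => f l ^ k := by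
  suffices h : ∀ j, IsCounted fun l => f (List.tail^[j] l) ^ k from h 0
  induction k with
  | zero => exact fun j => by simpa using const 1
  | succ k ih =>
    intro j
    simp only [pow_succ]
    exact (ih j).mul (g := fun l => f (List.tail^[j] l)) (by simpa using hf (j + 1))

theorem size {f : List ℕ → ℕ} (hf : IsCounted f) : IsCounted fun l => (f l).size := by
  obtain ⟨f', hf⟩ := hf
  exact ⟨.size f', fun l => by simp [Generator.den, hf]⟩

theorem log {f : List ℕ → ℕ} (hf : IsCounted f) : IsCounted fun l => Nat.log 2 (f l) := by
  refine (funext fun l => ?_ : (fun l => (f l).size - 1) = fun l => Nat.log 2 (f l)) ▸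
    hf.size.sub (const 1)
  rcases Nat.eq_zero_or_pos (f l) with h | h
  · simp [h]
  · refine (Nat.log_eq_of_pow_le_of_lt_pow ?_ ?_).symm
    · exact Nat.lt_size.1 (by have := Nat.size_pos.2 h; omega)
    · exact Nat.size_le.1 (by omega)

end IsCounted

/-! ### Circuits assembled from formulas -/

namespace Gate

/-- The positions used by a gate. -/
def operands : Gate → List ℕ
  | .var _ => []
  | .const _ => []
  | .neg j => [j]
  | .conj j₁ j₂ => [j₁, j₂]
  | .disj j₁ j₂ => [j₁, j₂]

/-- Value of a gate, given the input bits and the values of all positions. -/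
def eval (w v : ℕ → Bool) : Gate → Bool
  | .var i => w i
  | .const b => b
  | .neg j => !(v j)
  | .conj j₁ j₂ => v j₁ && v j₂
  | .disj j₁ j₂ => v j₁ || v j₂

end Gate

namespace Circuit

section Fold

variable {β : Type} (f : Gate → List β → β)

theorem length_foldl_append (C : List Gate) :
    (C.foldl (fun acc g => acc ++ [f g acc]) []).length = C.length := by
  induction C using List.reverseRecOn with
  | nil => rfl
  | append_singleton C g ih => simp [ih]

theorem getElem?_foldl_append (C : List Gate) (p : ℕ) (g : Gate) (h : C[p]? = some g) :
    (C.foldl (fun acc g => acc ++ [f g acc]) [])[p]? =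
      some (f g ((C.foldl (fun acc g => acc ++ [f g acc]) []).take p)) := by
  induction C using List.reverseRecOn with
  | nil => simp at h
  | append_singleton C g' ih =>
    have hl := length_foldl_append f C
    simp only [List.foldl_append, List.foldl_cons, List.foldl_nil]
    rcases lt_trichotomy p C.length with hp | rfl | hp
    · rw [List.getElem?_append_left hp] at h
      rw [List.getElem?_append_left (by omega), ih h, List.take_append_of_le_length (by omega)]
    · simp only [List.getElem?_append_right le_rfl, Nat.sub_self, List.getElem?_cons_zero,
        Option.some.injEq] at h
      subst h
      rw [← hl, List.getElem?_append_right le_rfl, List.take_append_of_le_length le_rfl,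
        List.take_length]
      simp
    · rw [List.getElem?_eq_none (by simp; omega)] at h
      simp at h

end Fold

theorem getD_take {β : Type} (l : List β) (d : β) {p j : ℕ} (h : j < p) :
    (l.take p).getD j d = l.getD j d := by
  simp [List.getD_eq_getElem?_getD, h]

/-- The value of the gate at position `p`. -/
def val (C : Circuit) (w : List Bool) (p : ℕ) : Bool := (C.values w).getD p false

/-- In a well-formed circuit the values satisfy the equations of the gates. -/
theorem val_eq {C : Circuit} {N : ℕ} (hC : C.WellFormed N) (w : List Bool) {p : ℕ} {g : Gate}
    (h : C[p]? = some g) : C.val w p = g.eval (fun i => w.getD i false) (C.val w) := by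
  have h1 := getElem?_foldl_append (fun g acc => g.value w acc) C p g h
  have h2 := hC.2 p g h
  have h3 : C.val w p = g.value w ((C.values w).take p) := by
    rw [val, List.getD_eq_getElem?_getD]
    exact congrArg (Option.getD · false) h1
  rw [h3]
  cases g <;> simp only [Gate.Valid] at h2 <;> simp only [Gate.value, Gate.eval, val]
  · rw [getD_take _ _ h2]
  · rw [getD_take _ _ h2.1, getD_take _ _ h2.2]
  · rw [getD_take _ _ h2.1, getD_take _ _ h2.2]

theorem output_eq (C : Circuit) (w : List Bool) :
    C.output w = C.val w (C.length - 1) := by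
  have hl : (C.values w).length = C.length :=
    length_foldl_append (fun g acc => g.value w acc) C
  rw [output, val, List.getLastD_eq_getLast?, List.getLast?_eq_getElem?, hl,
    List.getD_eq_getElem?_getD]

/-- A labelling of the positions that increases from the operands of a gate to the gate bounds the
depth. -/
theorem depth_le {C : Circuit} {N D : ℕ} (hC : C.WellFormed N) (δ : ℕ → ℕ)
    (hδ : ∀ p g, C[p]? = some g → ∀ j ∈ g.operands, δ j < δ p)
    (hD : ∀ p < C.length, δ p ≤ D) : C.depth ≤ D := by
  have hl : C.depths.length = C.length := length_foldl_append (fun g acc => g.depth acc) C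
  have key : ∀ p, p < C.length → C.depths.getD p 0 ≤ δ p := by
    intro p
    induction p using Nat.strong_induction_on with
    | _ p ih =>
      intro hp
      have h := List.getElem?_eq_getElem hp
      set g := C[p] with hg
      have h1 := getElem?_foldl_append (fun g acc => g.depth acc) C p g h
      have h2 := hC.2 p g h
      have h3 : C.depths.getD p 0 = g.depth (C.depths.take p) := by
        rw [List.getD_eq_getElem?_getD]
        exact congrArg (Option.getD · 0) h1
      have h4 : ∀ j ∈ g.operands, j < p → C.depths.getD j 0 + 1 ≤ δ p := fun j hj hjp => by
        have := ih j hjp (by omega)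
        have := hδ p g h j hj
        omega
      rw [h3]
      clear_value g
      cases g <;> simp only [Gate.Valid] at h2 <;> simp only [Gate.depth]
      · omega
      · omega
      · rw [getD_take _ _ h2]
        exact h4 _ (by simp [Gate.operands]) h2
      · rw [getD_take _ _ h2.1, getD_take _ _ h2.2]
        have := h4 _ (by simp [Gate.operands]) h2.1
        have := h4 _ (by simp [Gate.operands]) h2.2
        omega
      · rw [getD_take _ _ h2.1, getD_take _ _ h2.2]
        have := h4 _ (by simp [Gate.operands]) h2.1
        have := h4 _ (by simp [Gate.operands]) h2.2
        omega
  have hfold : ∀ l : List ℕ, (∀ x ∈ l, x ≤ D) → l.foldr max 0 ≤ D := by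
    intro l hl
    induction l with
    | nil => simp
    | cons a l ih =>
      simp only [List.mem_cons, forall_eq_or_imp] at hl
      simpa using ⟨hl.1, ih hl.2⟩
  refine hfold _ fun x hx => ?_
  obtain ⟨p, hp, rfl⟩ := List.getElem_of_mem hx
  have := key p (by omega)
  rw [List.getD_eq_getElem _ _ hp] at this
  exact this.trans (hD p (by omega))

end Circuit

/-- Boolean formulas over input bits and over the values of other formulas of a sequence. -/
inductive BoolFormula (α : Type) where
  | inp (i : α)
  | ref (t : α)
  | const (b : Bool)
  | neg (φ : BoolFormula α)
  | conj (φ ψ : BoolFormula α)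
  | disj (φ ψ : BoolFormula α)

namespace BoolFormula

variable {α β : Type}

/-- Rename the input bits and the references. -/
def map (f : α → β) : BoolFormula α → BoolFormula β
  | .inp i => .inp (f i)
  | .ref t => .ref (f t)
  | .const b => .const b
  | .neg φ => .neg (φ.map f)
  | .conj φ ψ => .conj (φ.map f) (ψ.map f)
  | .disj φ ψ => .disj (φ.map f) (ψ.map f)

/-- Value of a formula, given the input bits and the values of the references. -/
def eval (w v : α → Bool) : BoolFormula α → Bool
  | .inp i => w i
  | .ref t => v t
  | .const b => b
  | .neg φ => !(φ.eval w v)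
  | .conj φ ψ => φ.eval w v && ψ.eval w v
  | .disj φ ψ => φ.eval w v || ψ.eval w v

/-- The number of nodes of a formula. -/
def size : BoolFormula α → ℕ
  | .inp _ => 1
  | .ref _ => 1
  | .const _ => 1
  | .neg φ => φ.size + 1
  | .conj φ ψ => φ.size + ψ.size + 1
  | .disj φ ψ => φ.size + ψ.size + 1

/-- Every input index satisfies `P` and every reference satisfies `R`. -/
def All (P R : α → Prop) : BoolFormula α → Prop
  | .inp i => P i
  | .ref t => R t
  | .const _ => True
  | .neg φ => φ.All P R
  | .conj φ ψ => φ.All P R ∧ ψ.All P R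
  | .disj φ ψ => φ.All P R ∧ ψ.All P R

theorem size_pos (φ : BoolFormula α) : 0 < φ.size := by cases φ <;> simp [size]

theorem size_map (f : α → β) (φ : BoolFormula α) : (φ.map f).size = φ.size := by
  induction φ <;> simp [map, size, *]

/-- The Boolean function `f` of the values of the formulas in the list, by Shannon expansion. -/
def table : List (BoolFormula α) → (List Bool → Bool) → BoolFormula α
  | [], f => .const (f [])
  | φ :: l, f => .disj (.conj φ (table l fun b => f (true :: b)))
      (.conj (.neg φ) (table l fun b => f (false :: b)))

theorem eval_table (w v : α → Bool) (l : List (BoolFormula α)) (f : List Bool → Bool) :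
    (table l f).eval w v = f (l.map (eval w v)) := by
  induction l generalizing f with
  | nil => rfl
  | cons φ l ih =>
    simp only [table, eval, ih, List.map_cons]
    cases φ.eval w v <;> simp

theorem map_table (g : α → β) (l : List (BoolFormula α)) (f : List Bool → Bool) :
    (table l f).map g = table (l.map (map g)) f := by
  induction l generalizing f with
  | nil => rfl
  | cons φ l ih => simp only [table, map, ih, List.map_cons]

theorem all_table {P R : α → Prop} {l : List (BoolFormula α)} (f : List Bool → Bool)
    (h : ∀ φ ∈ l, φ.All P R) : (table l f).All P R := by
  induction l generalizing f with
  | nil => trivial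
  | cons φ l ih =>
    simp only [List.mem_cons, forall_eq_or_imp] at h
    exact ⟨⟨h.1, ih _ h.2⟩, h.1, ih _ h.2⟩

/-- The two subtables and four more gates are dominated by a factor `8`. -/
theorem size_table {l : List (BoolFormula α)} (f : List Bool → Bool)
    (h : ∀ φ ∈ l, φ.size = 1) : (table l f).size ≤ 8 ^ (l.length + 1) := by
  induction l generalizing f with
  | nil => simp [table, size]
  | cons φ l ih =>
    simp only [List.mem_cons, forall_eq_or_imp] at h
    have h1 := ih (fun b => f (true :: b)) h.2
    have h2 := ih (fun b => f (false :: b)) h.2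
    have h3 : 0 < 8 ^ (l.length + 1) := by positivity
    simp only [table, size, h.1, List.length_cons, pow_succ 8 (l.length + 1)]
    omega

/-- The gates of a formula from position `base` on; the last one carries its value. The value
referred to by `t` stands at position `(t + 1) * B`, and is copied as a disjunction with itself. -/
def gates (B : ℕ) : ℕ → BoolFormula ℕ → List Gate
  | _, .inp i => [.var i]
  | _, .ref t => [.disj ((t + 1) * B) ((t + 1) * B)]
  | _, .const b => [.const b]
  | base, .neg φ => gates B base φ ++ [.neg (base + (φ.size - 1))]
  | base, .conj φ ψ => gates B base φ ++ (gates B (base + φ.size) ψ ++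
      [.conj (base + (φ.size - 1)) (base + (φ.size + ψ.size - 1))])
  | base, .disj φ ψ => gates B base φ ++ (gates B (base + φ.size) ψ ++
      [.disj (base + (φ.size - 1)) (base + (φ.size + ψ.size - 1))])

theorem length_gates (B base : ℕ) (φ : BoolFormula ℕ) : (gates B base φ).length = φ.size := by
  induction φ generalizing base <;> simp [gates, size, *, Nat.add_assoc]

/-- If the values of all positions satisfy the equations of the gates of a formula, then the position
of its last gate has the value of the formula. -/
theorem eval_gates {B base : ℕ} {φ : BoolFormula ℕ} {w v : ℕ → Bool}
    (h : ∀ i g, (gates B base φ)[i]? = some g → v (base + i) = g.eval w v) :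
    v (base + (φ.size - 1)) = φ.eval w fun t => v ((t + 1) * B) := by
  induction φ generalizing base with
  | inp i => exact h 0 _ rfl
  | ref t => simpa [Gate.eval, eval, size] using h 0 _ rfl
  | const b => exact h 0 _ rfl
  | neg φ ih =>
    have h1 := ih (base := base) fun i g hi => h i g (by
      rw [gates, List.getElem?_append_left]
      · exact hi
      · exact (List.getElem?_eq_some_iff.1 hi).1)
    have h2 := h φ.size (.neg (base + (φ.size - 1))) (by
      rw [gates, List.getElem?_append_right (by rw [length_gates]), length_gates]
      simp)
    simpa [size, eval, h1, Gate.eval] using h2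
  | conj φ ψ ih ih' =>
    have h1 := ih (base := base) fun i g hi => h i g (by
      rw [gates, List.getElem?_append_left]
      · exact hi
      · exact (List.getElem?_eq_some_iff.1 hi).1)
    have h2 := ih' (base := base + φ.size) fun i g hi => by
      rw [Nat.add_assoc]
      refine h (φ.size + i) g ?_
      rw [gates, List.getElem?_append_right (by rw [length_gates]; omega), length_gates,
        Nat.add_sub_cancel_left, List.getElem?_append_left]
      · exact hi
      · exact (List.getElem?_eq_some_iff.1 hi).1
    have h3 := h (φ.size + ψ.size) (.conj (base + (φ.size - 1)) (base + (φ.size + ψ.size - 1))) (by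
      rw [gates, List.getElem?_append_right (by rw [length_gates]; omega), length_gates,
        Nat.add_sub_cancel_left, List.getElem?_append_right (by rw [length_gates]), length_gates]
      simp)
    have h4 : base + (φ.size + ψ.size - 1) = base + φ.size + (ψ.size - 1) := by
      have := ψ.size_pos; omega
    simpa [size, eval, h1, h2, h4, Gate.eval] using h3
  | disj φ ψ ih ih' =>
    have h1 := ih (base := base) fun i g hi => h i g (by
      rw [gates, List.getElem?_append_left]
      · exact hi
      · exact (List.getElem?_eq_some_iff.1 hi).1)
    have h2 := ih' (base := base + φ.size) fun i g hi => by
      rw [Nat.add_assoc]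
      refine h (φ.size + i) g ?_
      rw [gates, List.getElem?_append_right (by rw [length_gates]; omega), length_gates,
        Nat.add_sub_cancel_left, List.getElem?_append_left]
      · exact hi
      · exact (List.getElem?_eq_some_iff.1 hi).1
    have h3 := h (φ.size + ψ.size) (.disj (base + (φ.size - 1)) (base + (φ.size + ψ.size - 1))) (by
      rw [gates, List.getElem?_append_right (by rw [length_gates]; omega), length_gates,
        Nat.add_sub_cancel_left, List.getElem?_append_right (by rw [length_gates]), length_gates]
      simp)
    have h4 : base + (φ.size + ψ.size - 1) = base + φ.size + (ψ.size - 1) := by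
      have := ψ.size_pos; omega
    simpa [size, eval, h1, h2, h4, Gate.eval] using h3

/-- A gate of a formula uses an earlier gate of the formula, a referenced value, or an input bit of
the formula. -/
theorem gates_operands {B base : ℕ} {φ : BoolFormula ℕ} {P R : ℕ → Prop} (hφ : φ.All P R)
    {i : ℕ} {g : Gate} (h : (gates B base φ)[i]? = some g) :
    (∀ j ∈ g.operands, (base ≤ j ∧ j < base + i) ∨ ∃ t, R t ∧ j = (t + 1) * B) ∧
      ∀ q, g = .var q → P q := by
  have single {g' : Gate} {i : ℕ} (h : [g'][i]? = some g) : i = 0 ∧ g' = g := by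
    rcases i with _ | i <;> simp_all
  induction φ generalizing base i with
  | inp q =>
    obtain ⟨rfl, rfl⟩ := single h
    refine ⟨by simp [Gate.operands], fun q' hq => ?_⟩
    cases hq
    exact hφ
  | ref t =>
    obtain ⟨rfl, rfl⟩ := single h
    exact ⟨by simpa [Gate.operands] using .inr ⟨t, hφ, .inl rfl⟩, by simp⟩
  | const b =>
    obtain ⟨rfl, rfl⟩ := single h
    exact ⟨by simp [Gate.operands], by simp⟩
  | neg φ ih =>
    rw [gates, List.getElem?_append, length_gates] at h
    split_ifs at h with hi
    · exact ih hφ h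
    · obtain ⟨h1, rfl⟩ := single h
      have := φ.size_pos
      refine ⟨?_, by simp⟩
      simp only [Gate.operands, List.mem_singleton, forall_eq]
      left; omega
  | conj φ ψ ih ih' =>
    rw [gates, List.getElem?_append, length_gates, List.getElem?_append, length_gates] at h
    split_ifs at h with hi hi'
    · exact ih hφ.1 h
    · obtain ⟨h1, h2⟩ := ih' hφ.2 h
      refine ⟨fun j hj => (h1 j hj).imp (fun h => by omega) id, h2⟩
    · obtain ⟨h1, rfl⟩ := single h
      have := φ.size_pos
      have := ψ.size_pos
      refine ⟨?_, by simp⟩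
      simp only [Gate.operands, List.mem_cons, List.not_mem_nil, or_false, forall_eq_or_imp,
        forall_eq]
      constructor <;> left <;> omega
  | disj φ ψ ih ih' =>
    rw [gates, List.getElem?_append, length_gates, List.getElem?_append, length_gates] at h
    split_ifs at h with hi hi'
    · exact ih hφ.1 h
    · obtain ⟨h1, h2⟩ := ih' hφ.2 h
      refine ⟨fun j hj => (h1 j hj).imp (fun h => by omega) id, h2⟩
    · obtain ⟨h1, rfl⟩ := single h
      have := φ.size_pos
      have := ψ.size_pos
      refine ⟨?_, by simp⟩
      simp only [Gate.operands, List.mem_cons, List.not_mem_nil, or_false, forall_eq_or_imp,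
        forall_eq]
      constructor <;> left <;> omega

/-- The gates of the formula with number `t`, padded in front to exactly `B` gates. -/
def slot (B t : ℕ) (φ : BoolFormula ℕ) : List Gate :=
  List.replicate (B - φ.size) (.const false) ++ gates B (1 + t * B + (B - φ.size)) φ

theorem length_slot {B t : ℕ} {φ : BoolFormula ℕ} (h : φ.size ≤ B) : (slot B t φ).length = B := by
  simp [slot, length_gates, h]

end BoolFormula

/-- The circuit that evaluates the first `T` formulas of a sequence. Formula `t` occupies the slot of
`B` gates that ends at position `(t + 1) * B`. -/
def slotCircuit (B T : ℕ) (Φ : ℕ → BoolFormula ℕ) : Circuit :=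
  .const false :: (List.range T).flatMap fun t => (Φ t).slot B t

theorem getElem?_flatMap_range {β : Type} {B : ℕ} (f : ℕ → List β) (hf : ∀ t, (f t).length = B)
    {T t i : ℕ} (ht : t < T) (hi : i < B) :
    ((List.range T).flatMap f)[t * B + i]? = (f t)[i]? := by
  have hlen : ∀ T, ((List.range T).flatMap f).length = T * B := fun T => by
    simp [List.length_flatMap, hf]
  induction T with
  | zero => omega
  | succ T ih =>
    rw [List.range_succ, List.flatMap_append]
    rcases Nat.lt_or_ge t T with h | h
    · rw [List.getElem?_append_left, ih h]
      rw [hlen]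
      calc t * B + i < (t + 1) * B := by rw [Nat.succ_mul]; omega
        _ ≤ T * B := Nat.mul_le_mul_right _ h
    · obtain rfl : t = T := by omega
      rw [List.getElem?_append_right (by rw [hlen]; omega), hlen]
      simp

namespace slotCircuit

variable {B T N : ℕ} {Φ : ℕ → BoolFormula ℕ}

theorem length_eq (hB : ∀ t, (Φ t).size ≤ B) : (slotCircuit B T Φ).length = 1 + T * B := by
  simp [slotCircuit, List.length_flatMap, BoolFormula.length_slot (hB _), Nat.add_comm]

theorem getElem?_eq (hB : ∀ t, (Φ t).size ≤ B) {t i : ℕ} (ht : t < T) (hi : i < B) :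
    (slotCircuit B T Φ)[1 + t * B + i]? = ((Φ t).slot B t)[i]? := by
  rw [slotCircuit, show 1 + t * B + i = t * B + i + 1 by ring, List.getElem?_cons_succ,
    getElem?_flatMap_range (B := B) (fun t => (Φ t).slot B t)
      (fun t => BoolFormula.length_slot (hB t)) ht hi]

/-- A gate of the circuit either is a constant or is a gate of one of the formulas. -/
theorem gate_cases (hB : ∀ t, (Φ t).size ≤ B) {p : ℕ} {g : Gate}
    (h : (slotCircuit B T Φ)[p]? = some g) : g = .const false ∨ ∃ t i, t < T ∧ i < (Φ t).size ∧
      p = 1 + t * B + (B - (Φ t).size) + i ∧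
      (BoolFormula.gates B (1 + t * B + (B - (Φ t).size)) (Φ t))[i]? = some g := by
  have hp := (List.getElem?_eq_some_iff.1 h).1
  rw [length_eq hB] at hp
  have hB0 : 0 < B := (Φ 0).size_pos.trans_le (hB 0)
  rcases p with _ | p
  · left
    simpa [slotCircuit] using h.symm
  · have ht : p / B < T := Nat.div_lt_of_lt_mul (by rw [Nat.mul_comm]; omega)
    have hi : p % B < B := Nat.mod_lt _ hB0
    have hp' : p + 1 = 1 + p / B * B + p % B := by
      have := Nat.div_add_mod' p B; omega
    rw [hp', getElem?_eq hB ht hi, BoolFormula.slot, List.getElem?_append] at h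
    split_ifs at h with h1
    · left
      rw [List.getElem?_replicate] at h
      simp only [List.length_replicate] at h1
      rw [if_pos h1] at h
      exact (Option.some.inj h).symm
    · right
      simp only [List.length_replicate] at h1 h
      refine ⟨p / B, p % B - (B - (Φ (p / B)).size), ht, ?_, ?_, h⟩
      · have := hB (p / B); omega
      · omega

theorem wellFormed (hB : ∀ t, (Φ t).size ≤ B)
    (hΦ : ∀ t < T, (Φ t).All (· < N) (· < t)) : (slotCircuit B T Φ).WellFormed N := by
  refine ⟨by simp [slotCircuit], fun p g h => ?_⟩
  rcases gate_cases hB h with rfl | ⟨t, i, ht, hi, rfl, hg⟩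
  · trivial
  · obtain ⟨h1, h2⟩ := BoolFormula.gates_operands (hΦ t ht) hg
    have h3 : ∀ j ∈ g.operands, j < 1 + t * B + (B - (Φ t).size) + i := by
      intro j hj
      rcases h1 j hj with h | ⟨t', ht', rfl⟩
      · exact h.2
      · have : (t' + 1) * B ≤ t * B := Nat.mul_le_mul_right _ ht'
        omega
    cases g with
    | var q => exact h2 q rfl
    | const b => trivial
    | neg j => exact h3 _ (by simp [Gate.operands])
    | conj j j' => exact ⟨h3 _ (by simp [Gate.operands]), h3 _ (by simp [Gate.operands])⟩
    | disj j j' => exact ⟨h3 _ (by simp [Gate.operands]), h3 _ (by simp [Gate.operands])⟩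

/-- The value of formula `t` in the circuit. -/
def slotVal (B T : ℕ) (Φ : ℕ → BoolFormula ℕ) (w : List Bool) (t : ℕ) : Bool :=
  (slotCircuit B T Φ).val w ((t + 1) * B)

theorem slotVal_eq (hB : ∀ t, (Φ t).size ≤ B)
    (hΦ : ∀ t < T, (Φ t).All (· < N) (· < t)) (w : List Bool) {t : ℕ} (ht : t < T) :
    slotVal B T Φ w t = (Φ t).eval (fun i => w.getD i false) (slotVal B T Φ w) := by
  have hs := hB t
  have hpos := (Φ t).size_pos
  have := BoolFormula.eval_gates (B := B) (base := 1 + t * B + (B - (Φ t).size)) (φ := Φ t)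
    (w := fun i => w.getD i false) (v := (slotCircuit B T Φ).val w) fun i g hg => by
      have hi := (List.getElem?_eq_some_iff.1 hg).1
      rw [BoolFormula.length_gates] at hi
      refine Circuit.val_eq (wellFormed hB hΦ) w ?_
      rw [show 1 + t * B + (B - (Φ t).size) + i = 1 + t * B + (B - (Φ t).size + i) by ring,
        getElem?_eq hB ht (by omega), BoolFormula.slot, List.getElem?_append_right (by simp)]
      simpa using hg
  rw [← show (t + 1) * B = 1 + t * B + (B - (Φ t).size) + ((Φ t).size - 1) by
    rw [Nat.succ_mul]; omega] at this
  exact this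

theorem output_eq (hB : ∀ t, (Φ t).size ≤ B) (w : List Bool) :
    (slotCircuit B (T + 1) Φ).output w = slotVal B (T + 1) Φ w T := by
  rw [Circuit.output_eq, length_eq hB, slotVal, Nat.add_sub_cancel_left]

/-- If references go to formulas of a lower level, the depth is linear in the number of levels. -/
theorem depth_le (hB : ∀ t, (Φ t).size ≤ B)
    (hΦ : ∀ t < T, (Φ t).All (· < N) (· < t)) (lev : ℕ → ℕ) {Λ : ℕ}
    (hlev : ∀ t < T, (Φ t).All (fun _ => True) fun t' => lev t' < lev t)
    (hΛ : ∀ t < T, lev t ≤ Λ) : (slotCircuit B T Φ).depth ≤ (lev 0 + Λ + 1) * B := by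
  have hB0 : 0 < B := (Φ 0).size_pos.trans_le (hB 0)
  refine Circuit.depth_le (wellFormed hB hΦ)
    -- Inside a slot the labels increase with the position; at most `B` are used for each level.
    (fun p => lev ((p - 1) / B) * B + (p - 1) % B) ?_ ?_
  · intro p g h j hj
    rcases gate_cases hB h with rfl | ⟨t, i, ht, hi, rfl, hg⟩
    · simp [Gate.operands] at hj
    · have hs := hB t
      have hdm : ∀ q < B, (1 + t * B + q - 1) / B = t ∧ (1 + t * B + q - 1) % B = q := by
        intro q hq
        rw [show 1 + t * B + q - 1 = q + t * B by omega, Nat.add_mul_div_right _ _ hB0,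
          Nat.add_mul_mod_self_right, Nat.div_eq_of_lt hq, Nat.mod_eq_of_lt hq]
        simp
      obtain ⟨h1, -⟩ := BoolFormula.gates_operands (hlev t ht) hg
      have e := hdm (B - (Φ t).size + i) (by omega)
      simp only [Nat.add_assoc] at e ⊢
      rw [e.1, e.2]
      rcases h1 j hj with h | ⟨t', ht', rfl⟩
      · obtain ⟨q, rfl⟩ := Nat.exists_eq_add_of_le h.1
        have e' := hdm (B - (Φ t).size + q) (by omega)
        simp only [Nat.add_assoc] at e' ⊢
        rw [e'.1, e'.2]
        omega
      · have h5 : (t' + 1) * B - 1 = (B - 1) + t' * B := by rw [Nat.succ_mul]; omega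
        rw [h5, Nat.add_mul_div_right _ _ hB0, Nat.add_mul_mod_self_right,
          Nat.div_eq_of_lt (by omega), Nat.mod_eq_of_lt (by omega), Nat.zero_add]
        have : (lev t' + 1) * B ≤ lev t * B := Nat.mul_le_mul_right _ ht'
        rw [Nat.succ_mul] at this
        omega
  · intro p hp
    rw [length_eq hB] at hp
    have hm : (p - 1) % B < B := Nat.mod_lt _ hB0
    have hle : lev ((p - 1) / B) ≤ lev 0 + Λ := by
      rcases Nat.eq_zero_or_pos T with rfl | hT
      · obtain rfl : p = 0 := by omega
        simp
      · have : (p - 1) / B < T := Nat.div_lt_of_lt_mul (by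
          rw [Nat.mul_comm]
          have := Nat.mul_pos hT hB0
          omega)
        exact (hΛ _ this).trans (by omega)
    have := Nat.mul_le_mul_right B hle
    rw [Nat.succ_mul]
    omega

end slotCircuit

/-! ### Generating the description of a circuit -/

namespace BoolFormula

/-- The gates of a fixed formula whose indices are counted from the arguments are generated from these
arguments. -/
theorem isGenerated_gates (B : ℕ) {φ : BoolFormula (List ℕ → ℕ)} (hφ : φ.All IsCounted IsCounted)
    {base : List ℕ → ℕ} (hbase : IsCounted base) :
    IsGenerated fun l => Circuit.describe (gates B (base l) (φ.map (· l))) := by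
  have two (a b : CircuitSymbol) {f g : List ℕ → ℕ} (hf : IsCounted f) (hg : IsCounted g) :
      IsGenerated fun l => a :: (List.replicate (f l) CircuitSymbol.tick ++
        b :: List.replicate (g l) CircuitSymbol.tick) := by
    simpa using (IsGenerated.emit [a]).append
      ((IsGenerated.ticks hf).append ((IsGenerated.emit [b]).append (IsGenerated.ticks hg)))
  induction φ generalizing base with
  | inp i =>
    simpa [map, gates, Circuit.describe, Gate.describe] using
      (IsGenerated.emit [.var]).append (IsGenerated.ticks hφ)
  | ref t =>
    have : IsCounted fun l => (t l + 1) * B := by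
      simpa [Nat.mul_comm] using (IsCounted.add hφ (.const 1)).const_mul B
    simpa [map, gates, Circuit.describe, Gate.describe] using two .disj .sep this this
  | const b =>
    simpa [map, gates, Circuit.describe, Gate.describe] using IsGenerated.emit [.const b]
  | neg φ ih =>
    have h1 := ih hφ hbase
    have h2 := (IsGenerated.emit [.neg]).append
      (IsGenerated.ticks (hbase.add (.const (φ.size - 1))))
    simpa [map, gates, Circuit.describe, Gate.describe, size_map] using h1.append h2
  | conj φ ψ ih ih' =>
    have h1 := ih hφ.1 hbase
    have h2 := ih' hφ.2 (hbase.add (.const φ.size))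
    have h3 := two .conj .sep (hbase.add (.const (φ.size - 1)))
      (hbase.add (.const (φ.size + ψ.size - 1)))
    simpa [map, gates, Circuit.describe, Gate.describe, size_map] using h1.append (h2.append h3)
  | disj φ ψ ih ih' =>
    have h1 := ih hφ.1 hbase
    have h2 := ih' hφ.2 (hbase.add (.const φ.size))
    have h3 := two .disj .sep (hbase.add (.const (φ.size - 1)))
      (hbase.add (.const (φ.size + ψ.size - 1)))
    simpa [map, gates, Circuit.describe, Gate.describe, size_map] using h1.append (h2.append h3)

theorem isGenerated_slot (B : ℕ) {φ : BoolFormula (List ℕ → ℕ)} (hφ : φ.All IsCounted IsCounted)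
    {t : List ℕ → ℕ} (ht : IsCounted t) :
    IsGenerated fun l => Circuit.describe (slot B (t l) (φ.map (· l))) := by
  have h1 : IsCounted fun l => 1 + t l * B + (B - φ.size) := by
    simpa [Nat.mul_comm] using ((IsCounted.const 1).add (ht.const_mul B)).add (.const (B - φ.size))
  have h2 := (IsGenerated.emit (Circuit.describe (List.replicate (B - φ.size) (.const false)))).append
    (isGenerated_gates B hφ h1)
  simpa [slot, Circuit.describe, size_map] using h2

end BoolFormula

/-! ### Balanced trees of bounded nodes -/

/-- A bottom-up automaton on perfect binary trees, whose leaves carry words of `m` bits and whose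
inner nodes carry one bit that only depends on their level. A state is a word of `s` bits, given bit
by bit. -/
structure TreeAutomaton (m : ℕ) where
  s : ℕ
  s_pos : 0 < s
  /-- Bit `g` of the state at a leaf carrying the given word. -/
  leaf : ℕ → List Bool → Bool
  /-- Bit `g` of the state at a node, from the bit of its level followed by the states of its two
  children. -/
  node : ℕ → List Bool → Bool
  accept : List Bool → Bool

namespace TreeAutomaton

variable {m : ℕ} (A : TreeAutomaton m)

/-- The state of the node number `j` of level `e` (the leaves are at level `0`). -/
def state (leafWord : ℕ → List Bool) (levelBit : ℕ → Bool) : ℕ → ℕ → List Bool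
  | 0, j => (List.range A.s).map fun g => A.leaf g (leafWord j)
  | e + 1, j => (List.range A.s).map fun g => A.node g
      (levelBit e :: (state leafWord levelBit e (2 * j) ++ state leafWord levelBit e (2 * j + 1)))

/-- The length of an input: `n` blocks of `m` bits, one bit, and `k * (⌊log₂ n⌋ + 1)` bits. -/
def inputLength (m k n : ℕ) : ℕ := m * n + 1 + k * (Nat.log 2 n + 1)

/-- The word at leaf `j`: block `j` of the input, or zeros beyond the last block. -/
def blockWord (m n : ℕ) (w : List Bool) (j : ℕ) : List Bool :=
  if j + 1 ≤ n then (List.range m).map fun b => w.getD (m * j + b) false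
  else List.replicate m false

/-- The bit of level `e`: bit `e` of the last part of the input, or zero beyond it. -/
def tailBit (m k n : ℕ) (w : List Bool) (e : ℕ) : Bool :=
  if e + 1 ≤ k * (Nat.log 2 n + 1) then w.getD (m * n + 1 + e) false else false

/-- Height of a tree with `2 ^ height ≥ n` leaves, and at least one level for each tail bit. -/
def height (k n : ℕ) : ℕ := (k + 1) * (Nat.log 2 n + 1)

/-- A bound on the number of leaves. It is also the number of positions reserved for each level. -/
def span (k n : ℕ) : ℕ := (2 * n + 2) ^ (k + 1)

theorem two_pow_height_le (k n : ℕ) : 2 ^ height k n ≤ span k n := by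
  rw [height, span, Nat.mul_comm, pow_mul]
  refine Nat.pow_le_pow_left ?_ _
  rcases Nat.eq_zero_or_pos n with rfl | hn
  · simp
  · rw [pow_succ]
    have := Nat.pow_log_le_self 2 (x := n) (by omega)
    omega

/-- The length of an input determines the number of its blocks. -/
theorem inputLength_strictMono (hm : 0 < m) (k : ℕ) : StrictMono (inputLength m k) := by
  intro a b hab
  have h1 : m * a < m * b := Nat.mul_lt_mul_of_pos_left hab hm
  have h2 : k * (Nat.log 2 a + 1) ≤ k * (Nat.log 2 b + 1) :=
    Nat.mul_le_mul_left _ (by have := Nat.log_mono_right (b := 2) hab.le; omega)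
  unfold inputLength
  omega

/-- The table of bit `g` of an inner node, from its level bit `x` and from the numbers `a`, `b` of the
formulas of the first bits of its children. -/
def nodeTable {α : Type} (g : ℕ) (x : BoolFormula α) (a b : ℕ → α) : BoolFormula α :=
  .table (x :: ((List.range A.s).map (fun i => .ref (a i)) ++
    (List.range A.s).map fun i => .ref (b i))) (A.node g)

/-- The formula of bit `g` of node `j` of level `e`. Nodes that are not the root of a complete
subtree within the reserved positions are set to a constant. -/
def bitFormula (k n e j g : ℕ) : BoolFormula ℕ :=
  if e ≤ 0 then
    if j + 1 ≤ n then .table ((List.range m).map fun b => .inp (m * j + b)) (A.leaf g)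
    else .const (A.leaf g (List.replicate m false))
  else if 2 * j + 2 ≤ span k n then
    if e ≤ k * (Nat.log 2 n + 1) then
      A.nodeTable g (.inp (m * n + 1 + (e - 1)))
        (fun i => A.s * (span k n * (e - 1) + 2 * j) + i)
        (fun i => A.s * (span k n * (e - 1) + (2 * j + 1)) + i)
    else
      A.nodeTable g (.const false)
        (fun i => A.s * (span k n * (e - 1) + 2 * j) + i)
        (fun i => A.s * (span k n * (e - 1) + (2 * j + 1)) + i)
  else .const false

/-- The output formula: acceptance at the root, and the bit after the blocks is zero. -/
def outFormula (k n : ℕ) : BoolFormula ℕ :=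
  .conj (.neg (.inp (m * n)))
    (.table ((List.range A.s).map fun i => .ref (A.s * (span k n * height k n) + i)) A.accept)

/-- A bound on the sizes of the formulas. -/
def slotSize : ℕ := 8 ^ (m + 2 * A.s + 2) + 3

/-- The formulas of all the bits of all the nodes, level by level, and last the output. -/
def formula (k n t : ℕ) : BoolFormula ℕ :=
  if t < A.s * (span k n * (height k n + 1)) then
    A.bitFormula k n (t / A.s / span k n) (t / A.s % span k n) (t % A.s)
  else A.outFormula k n

/-- The circuit for inputs of length `N`, that rejects if `N` is not the length of an input. The loop
over `n` finds the number of blocks: at most one `n` contributes slots. -/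
def circuit (k N : ℕ) : Circuit :=
  .const false :: (List.range (N + 1)).flatMap fun n =>
    if inputLength m k n = N then
      (List.range (A.s * (span k n * (height k n + 1)) + 1)).flatMap fun t =>
        (A.formula k n t).slot A.slotSize t
    else []

theorem flatMap_range_single {β : Type} (F : ℕ → List β) (p : ℕ → Prop) [DecidablePred p] {n K : ℕ}
    (hn : n < K) (hpn : p n) (h : ∀ n' < K, p n' → n' = n) :
    ((List.range K).flatMap fun n' => if p n' then F n' else []) = F n := by
  induction K with
  | zero => omega
  | succ K ih =>
    rw [List.range_succ, List.flatMap_append]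
    rcases Nat.lt_or_ge n K with hK | hK
    · rw [ih hK fun n' hn' => h n' (by omega)]
      have : ¬p K := fun hp => by have := h K (by omega) hp; omega
      simp [this]
    · obtain rfl : n = K := by omega
      have : ((List.range n).flatMap fun n' => if p n' then F n' else []) = [] := by
        simp only [List.flatMap_eq_nil_iff, List.mem_range]
        intro n' hn'
        rw [if_neg fun hp => by have := h n' (by omega) hp; omega]
      rw [this]
      simp [hpn]

theorem circuit_eq (hm : 0 < m) {k n N : ℕ} (h : inputLength m k n = N) :
    A.circuit k N = slotCircuit A.slotSize (A.s * (span k n * (height k n + 1)) + 1)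
      (A.formula k n) := by
  have hn : n < N + 1 := by
    have := (inputLength_strictMono hm k).le_apply (x := n)
    omega
  rw [circuit, slotCircuit, flatMap_range_single _ (fun n => inputLength m k n = N) hn h
    fun n' _ h' => (inputLength_strictMono hm k).injective (h'.trans h.symm)]

theorem circuit_eq_const {k N : ℕ} (h : ∀ n, inputLength m k n ≠ N) :
    A.circuit k N = [.const false] := by
  simp [circuit, h]

section Formulas

variable (k n : ℕ)

theorem size_nodeTable_le {α : Type} (g : ℕ) (x : BoolFormula α) (hx : x.size = 1) (a b : ℕ → α) :
    (A.nodeTable g x a b).size ≤ A.slotSize := by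
  have h1 := BoolFormula.size_table (l := x :: ((List.range A.s).map (fun i => .ref (a i)) ++
    (List.range A.s).map fun i => .ref (b i))) (A.node g) (by
      intro φ hφ
      simp only [List.mem_cons, List.mem_append, List.mem_map] at hφ
      rcases hφ with rfl | ⟨i, -, rfl⟩ | ⟨i, -, rfl⟩
      · exact hx
      · rfl
      · rfl)
  refine h1.trans ?_
  have : (x :: ((List.range A.s).map (fun i => .ref (a i)) ++
    (List.range A.s).map fun i => .ref (b i))).length + 1 ≤ m + 2 * A.s + 2 := by
    simp; omega
  exact (Nat.pow_le_pow_right (by omega) this).trans (by simp [slotSize])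

theorem size_formula_le (t : ℕ) : (A.formula k n t).size ≤ A.slotSize := by
  have hleaf (L : List (BoolFormula ℕ)) (f) (hL : ∀ φ ∈ L, φ.size = 1)
      (hlen : L.length ≤ m + 2 * A.s) : (BoolFormula.table L f).size + 3 ≤ A.slotSize := by
    have h1 := BoolFormula.size_table f hL
    have h2 : 8 ^ (L.length + 1) ≤ 8 ^ (m + 2 * A.s + 2) :=
      Nat.pow_le_pow_right (by omega) (by omega)
    simp only [slotSize]
    omega
  have hconst : 1 ≤ A.slotSize := by simp [slotSize]
  unfold formula bitFormula
  split_ifs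
  · have := hleaf ((List.range m).map fun b => .inp (m * (t / A.s % span k n) + b))
      (A.leaf (t % A.s)) (by simp [BoolFormula.size]) (by simp)
    omega
  · exact hconst
  · exact A.size_nodeTable_le _ _ rfl _ _
  · exact A.size_nodeTable_le _ _ rfl _ _
  · exact hconst
  · have := hleaf ((List.range A.s).map fun i => .ref (A.s * (span k n * height k n) + i)) A.accept
      (by simp [BoolFormula.size]) (by simp; omega)
    simp only [outFormula, BoolFormula.size]
    omega

/-- The level of a formula; the output formula is one level above the root. -/
def level (t : ℕ) : ℕ := t / (A.s * span k n)

theorem span_pos : 0 < span k n := by simp [span]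

theorem level_index {e j i : ℕ} (hj : j < span k n) (hi : i < A.s) :
    A.level k n (A.s * (span k n * e + j) + i) = e := by
  rw [level, ← Nat.div_div_eq_div_mul, Nat.mul_add_div A.s_pos, Nat.div_eq_of_lt hi, Nat.add_zero,
    Nat.mul_add_div (span_pos k n), Nat.div_eq_of_lt hj, Nat.add_zero]

theorem index_lt {e j i : ℕ} {e' : ℕ} (hj : j < span k n) (hi : i < A.s) (he : e < e') :
    A.s * (span k n * e + j) + i < A.s * (span k n * e') := by
  have h1 : span k n * e + j + 1 ≤ span k n * e' := by
    have := Nat.mul_le_mul_left (span k n) he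
    rw [Nat.mul_succ] at this
    omega
  have := Nat.mul_le_mul_left A.s h1
  rw [Nat.mul_succ] at this
  omega

/-- The formulas read existing input bits, and refer to earlier formulas of a lower level. -/
theorem formula_all {N t : ℕ} (hN : inputLength m k n = N)
    (ht : t < A.s * (span k n * (height k n + 1)) + 1) :
    (A.formula k n t).All (· < N) fun t' => t' < t ∧ A.level k n t' < A.level k n t := by
  have hS := span_pos k n
  have hs := A.s_pos
  simp only [inputLength] at hN
  have hnode (e j : ℕ) (g : ℕ) (x : BoolFormula ℕ)
      (hx : x.All (· < N) fun t' => t' < t ∧ A.level k n t' < A.level k n t) (he : 0 < e)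
      (hj : 2 * j + 2 ≤ span k n) (hle : A.s * (span k n * e) ≤ t)
      (hlev : A.level k n t = e) :
      (A.nodeTable g x (fun i => A.s * (span k n * (e - 1) + 2 * j) + i)
        (fun i => A.s * (span k n * (e - 1) + (2 * j + 1)) + i)).All (· < N)
          fun t' => t' < t ∧ A.level k n t' < A.level k n t := by
    refine BoolFormula.all_table _ fun φ hφ => ?_
    simp only [List.mem_cons, List.mem_append, List.mem_map, List.mem_range] at hφ
    rcases hφ with rfl | ⟨i, hi, rfl⟩ | ⟨i, hi, rfl⟩
    · exact hx
    · have h1 := A.index_lt k n (e := e - 1) (e' := e) (show 2 * j < span k n by omega) hi (by omega)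
      have h2 := A.level_index k n (e := e - 1) (show 2 * j < span k n by omega) hi
      exact ⟨by omega, by omega⟩
    · have h1 := A.index_lt k n (e := e - 1) (e' := e) (show 2 * j + 1 < span k n by omega) hi
        (by omega)
      have h2 := A.level_index k n (e := e - 1) (show 2 * j + 1 < span k n by omega) hi
      exact ⟨by omega, by omega⟩
  have hlev : t / A.s / span k n = A.level k n t := Nat.div_div_eq_div_mul ..
  have hle : A.s * (span k n * (t / A.s / span k n)) ≤ t := by
    rw [← Nat.mul_assoc, Nat.div_div_eq_div_mul]
    exact Nat.mul_div_le _ _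
  unfold formula bitFormula
  split_ifs with h1 h2 h3 h4 h5
  · refine BoolFormula.all_table _ fun φ hφ => ?_
    simp only [List.mem_map, List.mem_range] at hφ
    obtain ⟨b, hb, rfl⟩ := hφ
    have := Nat.mul_le_mul_left m h3
    rw [Nat.mul_succ] at this
    simp only [BoolFormula.All]
    omega
  · trivial
  · refine hnode _ _ _ _ ?_ (by omega) h4 hle hlev.symm
    simp only [BoolFormula.All]
    omega
  · exact hnode _ _ _ _ trivial (by omega) h4 hle hlev.symm
  · trivial
  · obtain rfl : t = A.s * (span k n * (height k n + 1)) := by omega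
    have hl : A.level k n (A.s * (span k n * (height k n + 1))) = height k n + 1 := by
      simpa using A.level_index k n (e := height k n + 1) (j := 0) (i := 0) hS hs
    refine ⟨by simp only [BoolFormula.All]; omega, BoolFormula.all_table _ fun φ hφ => ?_⟩
    simp only [List.mem_map, List.mem_range] at hφ
    obtain ⟨i, hi, rfl⟩ := hφ
    have h1 := A.index_lt k n (e := height k n) (e' := height k n + 1) hS hi (by omega)
    have h2 := A.level_index k n (e := height k n) hS hi
    simp only [Nat.add_zero] at h1 h2
    exact ⟨h1, by omega⟩

end Formulas

theorem formula_index {k n e j g : ℕ} (he : e < height k n + 1) (hj : j < span k n) (hg : g < A.s) :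
    A.formula k n (A.s * (span k n * e + j) + g) = A.bitFormula k n e j g := by
  rw [formula, if_pos (A.index_lt k n hj hg he), Nat.mul_add_div A.s_pos, Nat.div_eq_of_lt hg,
    Nat.mul_add_mod, Nat.mod_eq_of_lt hg]
  simp only [Nat.add_zero]
  rw [Nat.mul_add_div (span_pos k n), Nat.mul_add_mod, Nat.div_eq_of_lt hj, Nat.mod_eq_of_lt hj,
    Nat.add_zero]

theorem _root_.BoolFormula.All.mono {α : Type} {P R P' R' : α → Prop} {φ : BoolFormula α}
    (h : φ.All P R) (hP : ∀ a, P a → P' a) (hR : ∀ a, R a → R' a) : φ.All P' R' := by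
  induction φ with
  | inp i => exact hP _ h
  | ref t => exact hR _ h
  | const b => trivial
  | neg φ ih => exact ih h
  | conj φ ψ ih ih' => exact ⟨ih h.1, ih' h.2⟩
  | disj φ ψ ih ih' => exact ⟨ih h.1, ih' h.2⟩

/-- The circuit computes the states of the nodes whose leaves all lie within the reserved
positions. -/
theorem slotVal_index {k n N : ℕ} (hN : inputLength m k n = N) (w : List Bool) (e : ℕ) :
    ∀ j, (j + 1) * 2 ^ e ≤ span k n → e ≤ height k n → ∀ g < A.s,
    slotCircuit.slotVal A.slotSize (A.s * (span k n * (height k n + 1)) + 1) (A.formula k n) w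
      (A.s * (span k n * e + j) + g) =
    (A.state (blockWord m n w) (tailBit m k n w) e j).getD g false := by
  have hS := span_pos k n
  induction e with
  | zero =>
    intro j hj he g hg
    have hj' : j < span k n := by simpa using hj
    have hlt := A.index_lt k n (e := 0) hj' hg (show 0 < height k n + 1 by omega)
    rw [slotCircuit.slotVal_eq (N := N) (A.size_formula_le k n)
      (fun t ht => (A.formula_all k n hN ht).mono (fun _ h => h) fun _ h => h.1) w (by omega)]
    rw [A.formula_index (by omega) hj' hg]
    simp only [bitFormula, le_refl, if_true, state, blockWord]
    rw [List.getD_eq_getElem _ _ (by simpa using hg)]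
    simp only [List.getElem_map, List.getElem_range]
    split_ifs
    · rw [BoolFormula.eval_table]
      simp [Function.comp_def, BoolFormula.eval]
    · rfl
  | succ e ih =>
    intro j hj he g hg
    rw [pow_succ] at hj
    have h2 : 1 ≤ 2 ^ e := Nat.one_le_two_pow
    have hj2 : 2 * j + 2 ≤ span k n := by nlinarith
    have hj' : j < span k n := by omega
    have hlt := A.index_lt k n (e := e + 1) hj' hg (show e + 1 < height k n + 1 by omega)
    rw [slotCircuit.slotVal_eq (N := N) (A.size_formula_le k n)
      (fun t ht => (A.formula_all k n hN ht).mono (fun _ h => h) fun _ h => h.1) w (by omega)]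
    rw [A.formula_index (by omega) hj' hg]
    have ih1 := ih (2 * j) (by nlinarith) (by omega)
    have ih2 := ih (2 * j + 1) (by nlinarith) (by omega)
    have hst : ∀ j, (A.state (blockWord m n w) (tailBit m k n w) e j).length = A.s := by
      intro j; cases e <;> simp [state]
    have hmap (j : ℕ) (h : ∀ g < A.s,
        slotCircuit.slotVal A.slotSize (A.s * (span k n * (height k n + 1)) + 1) (A.formula k n) w
          (A.s * (span k n * e + j) + g) =
        (A.state (blockWord m n w) (tailBit m k n w) e j).getD g false) :
        ((List.range A.s).map fun i => slotCircuit.slotVal A.slotSize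
          (A.s * (span k n * (height k n + 1)) + 1) (A.formula k n) w
          (A.s * (span k n * e + j) + i)) =
        A.state (blockWord m n w) (tailBit m k n w) e j := by
      refine List.ext_getElem (by simp [hst]) fun i h1 h2 => ?_
      rw [List.getElem_map, List.getElem_range, h i (by simpa using h1),
        List.getD_eq_getElem _ _ h2]
    simp only [bitFormula, show ¬(e + 1 ≤ 0) by omega, if_false, if_pos hj2, state,
      Nat.add_sub_cancel]
    rw [List.getD_eq_getElem _ _ (by simpa using hg)]
    simp only [List.getElem_map, List.getElem_range]
    simp only [tailBit] at hmap ⊢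
    split_ifs
    · rw [nodeTable, BoolFormula.eval_table]
      simp [Function.comp_def, BoolFormula.eval, hmap _ ih1, hmap _ ih2]
    · rw [nodeTable, BoolFormula.eval_table]
      simp [Function.comp_def, BoolFormula.eval, hmap _ ih1, hmap _ ih2]

/-- What the circuit computes. -/
theorem output_circuit (hm : 0 < m) {k n N : ℕ} (hN : inputLength m k n = N) (w : List Bool) :
    (A.circuit k N).output w = (!w.getD (m * n) false &&
      A.accept (A.state (blockWord m n w) (tailBit m k n w) (height k n) 0)) := by
  rw [A.circuit_eq hm hN, slotCircuit.output_eq (A.size_formula_le k n),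
    slotCircuit.slotVal_eq (N := N) (A.size_formula_le k n)
      (fun t ht => (A.formula_all k n hN ht).mono (fun _ h => h) fun _ h => h.1) w (by omega),
    formula, if_neg (lt_irrefl _), outFormula]
  simp only [BoolFormula.eval, BoolFormula.eval_table, List.map_map, Function.comp_def]
  have h := A.slotVal_index hN w (height k n) 0 (by simpa using two_pow_height_le k n) le_rfl
  have hst : (A.state (blockWord m n w) (tailBit m k n w) (height k n) 0).length = A.s := by
    generalize height k n = e
    cases e <;> simp [state]
  congr 2
  refine List.ext_getElem (by simp [hst]) fun i h1 h2 => ?_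
  rw [List.getElem_map, List.getElem_range, ← List.getD_eq_getElem _ false h2,
    ← h i (by simpa using h1)]
  simp

end TreeAutomaton

/-! ### Uniformity of the circuits of a tree automaton -/

namespace TreeAutomaton

variable {m : ℕ} (A : TreeAutomaton m)

theorem flatMap_range_mul {β : Type} (a b : ℕ) (f : ℕ → List β) :
    (List.range (b * a)).flatMap f =
      (List.range a).flatMap fun i => (List.range b).flatMap fun j => f (b * i + j) := by
  induction a with
  | zero => simp
  | succ a ih =>
    rw [Nat.mul_succ, List.range_add, List.flatMap_append, ih, List.range_succ,
      List.flatMap_append]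
    simp [List.flatMap_map]

section Counted

open IsCounted

theorem isCounted_tailLength (k i : ℕ) :
    IsCounted fun l => k * (Nat.log 2 (l.getD i 0) + 1) :=
  ((var i).log.add (.const 1)).const_mul k

theorem isCounted_inputLength (m k i : ℕ) : IsCounted fun l => inputLength m k (l.getD i 0) :=
  (((var i).const_mul m).add (.const 1)).add (isCounted_tailLength k i)

theorem isCounted_height (k i : ℕ) : IsCounted fun l => height k (l.getD i 0) :=
  isCounted_tailLength (k + 1) i

theorem getD_iterate_tail (l : List ℕ) (i j : ℕ) :
    (List.tail^[j] l).getD i 0 = l.getD (i + j) 0 := by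
  induction j generalizing l with
  | zero => rfl
  | succ j ih =>
    rw [Function.iterate_succ_apply, ih]
    cases l <;> simp [← Nat.add_assoc]

theorem isCounted_span (k i : ℕ) : IsCounted fun l => span k (l.getD i 0) := by
  refine IsCounted.pow (f := fun l => 2 * l.getD i 0 + 2) (fun j => ?_) (k + 1)
  simp only [getD_iterate_tail]
  exact ((var (i + j)).const_mul 2).add (.const 2)

theorem getD_tail (l : List ℕ) (i : ℕ) : l.tail.getD i 0 = l.getD (i + 1) 0 :=
  getD_iterate_tail l i 1

end Counted

theorem isGenerated_table {B : ℕ} {L : List (BoolFormula (List ℕ → ℕ))} (f : List Bool → Bool)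
    (hL : ∀ φ ∈ L, φ.All IsCounted IsCounted) {t : List ℕ → ℕ} (ht : IsCounted t) :
    IsGenerated fun l => Circuit.describe
      ((BoolFormula.table (L.map (BoolFormula.map (· l))) f).slot B (t l)) := by
  simpa only [BoolFormula.map_table] using
    BoolFormula.isGenerated_slot B (BoolFormula.all_table f hL) ht

/-- The description of a slot of the circuit is generated from the variables `j` (node), `e` (level)
and `n` (number of blocks). -/
theorem isGenerated_bitFormula (k g : ℕ) {t : List ℕ → ℕ} (ht : IsCounted t) :
    IsGenerated fun l => Circuit.describe
      ((A.bitFormula k (l.getD 2 0) (l.getD 1 0) (l.getD 0 0) g).slot A.slotSize (t l)) := by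
  have hv := IsCounted.var
  have hconst (b : Bool) : IsGenerated fun l => Circuit.describe
      ((BoolFormula.const b).slot A.slotSize (t l)) :=
    BoolFormula.isGenerated_slot A.slotSize (φ := .const b) trivial ht
  have hleaf : IsGenerated fun l => Circuit.describe
      ((BoolFormula.table ((List.range m).map fun b => .inp (m * l.getD 0 0 + b))
        (A.leaf g)).slot A.slotSize (t l)) := by
    have := isGenerated_table (B := A.slotSize)
      (L := (List.range m).map fun b => .inp fun l : List ℕ => m * l.getD 0 0 + b) (A.leaf g) (by
        simp only [List.mem_map, List.mem_range]
        rintro _ ⟨b, -, rfl⟩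
        exact ((hv 0).const_mul m).add (.const b)) ht
    simpa [Function.comp_def, BoolFormula.map] using this
  have hchild (c i : ℕ) : IsCounted fun l =>
      A.s * (span k (l.getD 2 0) * (l.getD 1 0 - 1) + (2 * l.getD 0 0 + c)) + i := by
    refine ((((isCounted_span k 2).mul (g := fun l => l.getD 1 0 - 1) ?_).add
      (((hv 0).const_mul 2).add (.const c))).const_mul A.s).add (.const i)
    simp only [getD_tail]
    exact (hv 2).sub (.const 1)
  have hnode (x : BoolFormula (List ℕ → ℕ)) (hx : x.All IsCounted IsCounted) :
      IsGenerated fun l => Circuit.describe ((A.nodeTable g (x.map (· l))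
        (fun i => A.s * (span k (l.getD 2 0) * (l.getD 1 0 - 1) + (2 * l.getD 0 0 + 0)) + i)
        (fun i => A.s * (span k (l.getD 2 0) * (l.getD 1 0 - 1) + (2 * l.getD 0 0 + 1)) + i)).slot
          A.slotSize (t l)) := by
    have := isGenerated_table (B := A.slotSize)
      (L := x :: ((List.range A.s).map (fun i => .ref fun l : List ℕ =>
          A.s * (span k (l.getD 2 0) * (l.getD 1 0 - 1) + (2 * l.getD 0 0 + 0)) + i) ++
        (List.range A.s).map fun i => .ref fun l : List ℕ =>
          A.s * (span k (l.getD 2 0) * (l.getD 1 0 - 1) + (2 * l.getD 0 0 + 1)) + i))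
      (A.node g) (by
        simp only [List.mem_cons, List.mem_append, List.mem_map, List.mem_range]
        rintro _ (rfl | ⟨i, -, rfl⟩ | ⟨i, -, rfl⟩)
        · exact hx
        · exact hchild 0 i
        · exact hchild 1 i) ht
    simpa only [nodeTable, List.map_cons, List.map_append, List.map_map, Function.comp_def,
      BoolFormula.map] using this
  have h1 := hnode (.inp fun l => m * l.getD 2 0 + 1 + (l.getD 1 0 - 1))
    ((((hv 2).const_mul m).add (.const 1)).add ((hv 1).sub (.const 1)))
  have h2 := hnode (.const false) trivial
  have := IsGenerated.ite_le (hv 1) (.const 0)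
    (.ite_le ((hv 0).add (.const 1)) (hv 2) hleaf (hconst (A.leaf g (List.replicate m false))))
    (.ite_le (((hv 0).const_mul 2).add (.const 2)) (isCounted_span k 2)
      (.ite_le (hv 1) (isCounted_tailLength k 2) h1 h2) (hconst false))
  convert this using 2 with l
  unfold bitFormula
  split_ifs <;> rfl

theorem isGenerated_outFormula (k : ℕ) {t : List ℕ → ℕ} (ht : IsCounted t) :
    IsGenerated fun l => Circuit.describe
      ((A.outFormula k (l.getD 0 0)).slot A.slotSize (t l)) := by
  have := BoolFormula.isGenerated_slot A.slotSize (t := t)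
    (φ := .conj (.neg (.inp fun l => m * l.getD 0 0))
      (.table ((List.range A.s).map fun i => .ref fun l =>
        A.s * (span k (l.getD 0 0) * height k (l.getD 0 0)) + i) A.accept)) (by
      refine ⟨(IsCounted.var 0).const_mul m, BoolFormula.all_table _ fun φ hφ => ?_⟩
      simp only [List.mem_map, List.mem_range] at hφ
      obtain ⟨i, -, rfl⟩ := hφ
      refine (((isCounted_span k 0).mul (g := fun l => height k (l.getD 0 0)) ?_).const_mul
        A.s).add (.const i)
      simp only [getD_tail]
      exact isCounted_height k 1) ht
  simpa only [outFormula, BoolFormula.map, BoolFormula.map_table, List.map_map, Function.comp_def]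
    using this

theorem describe_flatMap (L : List ℕ) (f : ℕ → List Gate) :
    Circuit.describe (L.flatMap f) = L.flatMap fun i => Circuit.describe (f i) := by
  simp [Circuit.describe, List.flatMap_assoc]

/-- The slots for `n` blocks, as nested loops over levels, nodes and bits. -/
theorem isGenerated_slots (k : ℕ) : IsGenerated fun l => Circuit.describe
    ((List.range (A.s * (span k (l.getD 0 0) * (height k (l.getD 0 0) + 1)) + 1)).flatMap fun t =>
      (A.formula k (l.getD 0 0) t).slot A.slotSize t) := by
  have hindex (g : ℕ) : IsCounted fun l : List ℕ =>
      A.s * (span k (l.getD 2 0) * l.getD 1 0 + l.getD 0 0) + g := by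
    refine ((((isCounted_span k 2).mul (g := fun l => l.getD 1 0) ?_).add
      (.var 0)).const_mul A.s).add (.const g)
    simp only [getD_tail]
    exact .var 2
  have htop : IsCounted fun l : List ℕ =>
      A.s * (span k (l.getD 0 0) * (height k (l.getD 0 0) + 1)) := by
    refine ((isCounted_span k 0).mul (g := fun l => height k (l.getD 0 0) + 1) ?_).const_mul A.s
    simp only [getD_tail]
    exact (isCounted_height k 1).add (.const 1)
  have := (IsGenerated.flatMap_range ((isCounted_height k 0).add (.const 1))
    (IsGenerated.flatMap_range (isCounted_span k 1)
      (IsGenerated.flatMap_const A.s fun g => A.isGenerated_bitFormula k g (hindex g)))).append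
    (A.isGenerated_outFormula k htop)
  convert this using 2 with l
  simp only [List.getD_cons_succ, List.getD_cons_zero]
  generalize l.getD 0 0 = n
  rw [List.range_succ, List.flatMap_append, Circuit.describe, List.flatMap_append]
  congr 1
  · rw [← Circuit.describe, describe_flatMap, flatMap_range_mul, flatMap_range_mul]
    refine List.flatMap_congr fun e he => List.flatMap_congr fun j hj =>
      List.flatMap_congr fun g hg => ?_
    simp only [List.mem_range] at he hj hg
    rw [A.formula_index he hj hg]
  · simp [formula, Circuit.describe]

theorem logspaceUniform_circuit (k : ℕ) : LogspaceUniform (A.circuit k) := by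
  have h1 := (isCounted_inputLength m k 0).add (.const 1)
  obtain ⟨g, hg⟩ := (IsGenerated.emit (Circuit.describe [.const false])).append
    (IsGenerated.flatMap_range (.var 0) (.ite_le h1 (.var 1)
      (.ite_le (.var 1) h1 (A.isGenerated_slots k) (.emit [])) (.emit [])))
  obtain ⟨T, a, h⟩ := g.exists_transducer
  refine ⟨T, a, fun N => ?_⟩
  have : (A.circuit k N).describe = g.den [N + 1] := by
    rw [hg, circuit, Circuit.describe, List.flatMap_cons, ← Circuit.describe, describe_flatMap]
    simp only [List.getD_cons_succ, List.getD_cons_zero]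
    congr 1
    refine List.flatMap_congr fun n _ => ?_
    split_ifs <;> first | rfl | omega
  rw [this]
  exact h N

/-- A language whose words, apart from their length and one bit, are recognized by a tree automaton,
is in `NC¹`. -/
theorem mem_NC_one (hm : 0 < m) (k : ℕ) (L : Language Bool)
    (hL : ∀ w, w ∈ L ↔ ∃ n, w.length = inputLength m k n ∧ w.getD (m * n) false = false ∧
      A.accept (A.state (blockWord m n w) (tailBit m k n w) (height k n) 0) = true) :
    L ∈ NC 1 := by
  refine ⟨A.circuit k, A.logspaceUniform_circuit k, fun N => ?_, ?_, ?_, fun w => ?_⟩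
  · by_cases h : ∃ n, inputLength m k n = N
    · obtain ⟨n, h⟩ := h
      rw [A.circuit_eq hm h]
      exact slotCircuit.wellFormed (A.size_formula_le k n)
        fun t ht => (A.formula_all k n h ht).mono (fun _ h => h) fun _ h => h.1
    · rw [A.circuit_eq_const (not_exists.1 h)]
      refine ⟨by simp, fun p g h => ?_⟩
      rcases p with _ | p
      · simp at h; subst h; trivial
      · simp at h
  · refine ⟨1 + (A.s • ((2 * .X + 2) ^ (k + 1) * ((k + 1) * (.X + 1) + 1)) + 1) * A.slotSize,
      fun N => ?_⟩
    by_cases h : ∃ n, inputLength m k n = N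
    · obtain ⟨n, h⟩ := h
      have hn : n ≤ N := by
        have := (inputLength_strictMono hm k).le_apply (x := n)
        omega
      rw [A.circuit_eq hm h, Circuit.size, slotCircuit.length_eq (A.size_formula_le k n)]
      simp only [Polynomial.eval_add, Polynomial.eval_mul, Polynomial.eval_smul,
        Polynomial.eval_pow, Polynomial.eval_one, Polynomial.eval_X, Polynomial.eval_natCast,
        Polynomial.eval_ofNat, Nat.cast_id, smul_eq_mul, height, span]
      have h1 : Nat.log 2 n ≤ N := (Nat.log_le_self 2 n).trans hn
      gcongr
    · rw [A.circuit_eq_const (not_exists.1 h)]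
      simp [Circuit.size]
  · refine ⟨(k + 3) * A.slotSize, fun N => ?_⟩
    by_cases h : ∃ n, inputLength m k n = N
    · obtain ⟨n, h⟩ := h
      have hn : n ≤ N := by
        have := (inputLength_strictMono hm k).le_apply (x := n)
        omega
      rw [A.circuit_eq hm h]
      have h1 : Nat.log 2 n ≤ Nat.log 2 N := Nat.log_mono_right hn
      have h2 := slotCircuit.depth_le (A.size_formula_le k n)
        (fun t ht => (A.formula_all k n h ht).mono (fun _ h => h) fun _ h => h.1) (A.level k n)
        (Λ := height k n + 1)
        (fun t ht => (A.formula_all k n h ht).mono (fun _ _ => trivial) fun _ h => h.2) (by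
          intro t ht
          rw [level, ← Nat.mul_div_cancel_left (height k n + 1)
            (Nat.mul_pos A.s_pos (span_pos k n)), Nat.mul_assoc]
          exact Nat.div_le_div_right (by omega))
      refine h2.trans ?_
      have h3 : A.level k n 0 = 0 := by simp [level]
      rw [h3, pow_one, Nat.zero_add, Nat.mul_right_comm]
      refine Nat.mul_le_mul_right _ ?_
      rw [height]
      nlinarith
    · rw [A.circuit_eq_const (not_exists.1 h)]
      simp [Circuit.depth, Circuit.depths, Gate.depth]
  · rw [hL]
    constructor
    · rintro ⟨n, h1, h2, h3⟩
      rw [A.output_circuit hm h1.symm, h2, h3]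
      rfl
    · intro h
      by_cases hn : ∃ n, inputLength m k n = w.length
      · obtain ⟨n, hn⟩ := hn
        rw [A.output_circuit hm hn] at h
        simp only [Bool.and_eq_true, Bool.not_eq_true'] at h
        exact ⟨n, hn.symm, h.1, h.2⟩
      · rw [A.circuit_eq_const (not_exists.1 hn)] at h
        simp [Circuit.output, Circuit.values, Gate.value] at h

end TreeAutomaton

/-! ### Avalanches started on the first column -/

namespace SandpileModel

variable (M : SandpileModel)

theorem exists_pos : ∃ v ∈ M.nbhd, 0 < v := by
  by_contra! h
  have h1 : ∀ x ∈ AddSubmonoid.closure (M.nbhd : Set ℤ), x ≤ 0 := fun x hx => by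
    induction hx using AddSubmonoid.closure_induction with
    | mem x hx => exact h x hx
    | zero => exact le_rfl
    | add x y _ _ hx hy => omega
  have := h1 1 (by rw [M.complete]; trivial)
  omega

theorem exists_neg : ∃ v ∈ M.nbhd, v < 0 := by
  by_contra! h
  have h1 : ∀ x ∈ AddSubmonoid.closure (M.nbhd : Set ℤ), 0 ≤ x := fun x hx => by
    induction hx using AddSubmonoid.closure_induction with
    | mem x hx => exact h x hx
    | zero => exact le_rfl
    | add x y _ _ hx hy => omega
  have := h1 (-1) (by rw [M.complete]; trivial)
  omega

open Classical in
/-- The number of grains that `x` receives when every cell of `S` topples once. -/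
noncomputable def received (S : Set ℤ) (x : ℤ) : ℕ :=
  ∑ v ∈ M.nbhd, if x - v ∈ S then M.dist v else 0

theorem received_mono {S T : Set ℤ} (h : S ⊆ T) (x : ℤ) : M.received S x ≤ M.received T x := by
  refine Finset.sum_le_sum fun v _ => ?_
  by_cases hv : x - v ∈ S
  · simp [hv, h hv]
  · simp [hv]

theorem received_le (S : Set ℤ) (x : ℤ) : M.received S x ≤ M.threshold := by
  refine Finset.sum_le_sum fun v _ => ?_
  split_ifs <;> simp

theorem received_lt {S : Set ℤ} {x v : ℤ} (hv : v ∈ M.nbhd) (h : x - v ∉ S) :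
    M.received S x < M.threshold := by
  refine Finset.sum_lt_sum (fun v _ => ?_) ⟨v, hv, ?_⟩
  · split_ifs <;> simp
  · rw [if_neg h]
    exact M.dist_pos v hv

/-- A cell receives fewer grains than the threshold from cells all lying to its right. -/
theorem received_lt_of_gt {S : Set ℤ} {x : ℤ} (h : ∀ y ∈ S, x < y) :
    M.received S x < M.threshold := by
  obtain ⟨v, hv, hpos⟩ := M.exists_pos
  exact M.received_lt hv fun hS => by have := h _ hS; omega

/-- A cell receives fewer grains than the threshold from cells all lying to its left. -/
theorem received_lt_of_lt {S : Set ℤ} {x : ℤ} (h : ∀ y ∈ S, y < x) :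
    M.received S x < M.threshold := by
  obtain ⟨v, hv, hneg⟩ := M.exists_neg
  exact M.received_lt hv fun hS => by have := h _ hS; omega

/-- The cells that toppled before time `t`, if no cell topples twice: those whose initial load,
together with the grains received from the cells that toppled before, reaches the threshold. -/
def toppled (c : ℤ → ℕ) : ℕ → Set ℤ
  | 0 => ∅
  | t + 1 => {x | M.threshold ≤ c x + M.received (toppled c t) x}

theorem toppled_subset_succ (c : ℤ → ℕ) (t : ℕ) : M.toppled c t ⊆ M.toppled c (t + 1) := by
  induction t with
  | zero => exact Set.empty_subset _
  | succ t ih =>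
    intro x hx
    have h1 := M.received_mono ih x
    have h2 : M.threshold ≤ c x + M.received (M.toppled c t) x := hx
    exact h2.trans (by omega)

section FirstColumn

variable {M} {n R : ℕ} {c : ℤ → ℕ}

theorem addGrain_of_neg (hc : SupportedOnSegment n c) {x : ℤ} (hx : x < 0) :
    addGrain c 0 x = 0 := by
  have : c x = 0 := by
    by_contra h
    have := hc x h
    omega
  simp [addGrain, this, hx.ne]

theorem addGrain_of_ge (hc : SupportedOnSegment n c) (hn : n ≤ R) (hR : 0 < R) {x : ℤ}
    (hx : R ≤ x) : addGrain c 0 x = 0 := by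
  have : c x = 0 := by
    by_contra h
    have := hc x h
    omega
  simp [addGrain, this, show x ≠ 0 by omega]

/-- Nothing topples to the left of the first column: the leftmost toppled cell would need the grains
of all its neighbors. -/
theorem toppled_nonneg (hc : SupportedOnSegment n c) (t : ℕ) :
    ∀ x ∈ M.toppled (addGrain c 0) t, 0 ≤ x := by
  induction t with
  | zero => simp [toppled]
  | succ t ih =>
    intro x hx
    by_contra! hneg
    have h1 : M.threshold ≤ addGrain c 0 x + M.received (M.toppled (addGrain c 0) t) x := hx
    have h2 := M.received_lt_of_gt (x := x) fun y hy => hneg.trans_le (ih y hy)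
    rw [addGrain_of_neg hc hneg] at h1
    omega

/-- Likewise, nothing topples to the right of a segment containing the support. -/
theorem toppled_lt (hc : SupportedOnSegment n c) (hn : n ≤ R) (hR : 0 < R) (t : ℕ) :
    ∀ x ∈ M.toppled (addGrain c 0) t, x < R := by
  induction t with
  | zero => simp [toppled]
  | succ t ih =>
    intro x hx
    by_contra! hge
    have h1 : M.threshold ≤ addGrain c 0 x + M.received (M.toppled (addGrain c 0) t) x := hx
    have h2 := M.received_lt_of_lt (x := x) fun y hy => (ih y hy).trans_le hge
    rw [addGrain_of_ge hc hn hR hge] at h1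
    omega

/-- With the grains received from cells that toppled once, no cell reaches the threshold twice. The
first cell has one grain more than the others, but never receives anything from its left. -/
theorem add_received_lt (hc : SupportedOnSegment n c) (hs : M.Stable c) (t : ℕ) (x : ℤ) :
    addGrain c 0 x + M.received (M.toppled (addGrain c 0) t) x < M.threshold + M.threshold := by
  have h1 := hs x
  rcases eq_or_ne x 0 with rfl | hx
  · obtain ⟨v, hv, hpos⟩ := M.exists_pos
    have h2 := M.received_lt (x := 0) hv
      (fun h => by have := toppled_nonneg (M := M) hc t _ h; omega)
    simp only [addGrain, if_true]
    omega
  · have h2 := M.received_le (M.toppled (addGrain c 0) t) x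
    simp only [addGrain, hx, if_false]
    omega

open Classical in
/-- If at time `t` every cell of `toppled t` has toppled exactly once, and no other cell has, then the
unstable cells are the new cells of `toppled (t + 1)`. -/
theorem unstable_iff_of_balance (hc : SupportedOnSegment n c) (hs : M.Stable c) {t : ℕ} {d : ℤ → ℕ}
    (hd : ∀ x, d x + (if x ∈ M.toppled (addGrain c 0) t then M.threshold else 0) =
      addGrain c 0 x + M.received (M.toppled (addGrain c 0) t) x) (x : ℤ) :
    M.threshold ≤ d x ↔
      x ∈ M.toppled (addGrain c 0) (t + 1) ∧ x ∉ M.toppled (addGrain c 0) t := by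
  have h1 := hd x
  have h2 := add_received_lt hc hs t x
  have h3 : x ∈ M.toppled (addGrain c 0) (t + 1) ↔
    M.threshold ≤ addGrain c 0 x + M.received (M.toppled (addGrain c 0) t) x := Iff.rfl
  rw [h3]
  split_ifs at h1 with h
  · simp only [h, not_true_eq_false, and_false, iff_false]
    omega
  · simp only [h, not_false_eq_true, and_true]
    omega

open Classical in
/-- The parallel evolution: by time `t` every cell of `toppled t` has toppled exactly once, and no
other cell has. -/
theorem balance (hc : SupportedOnSegment n c) (hs : M.Stable c) (t : ℕ) (x : ℤ) :
    M.step^[t] (addGrain c 0) x + (if x ∈ M.toppled (addGrain c 0) t then M.threshold else 0) =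
      addGrain c 0 x + M.received (M.toppled (addGrain c 0) t) x := by
  induction t generalizing x with
  | zero => simp [toppled, received]
  | succ t ih =>
    have hu := unstable_iff_of_balance hc hs ih
    rw [Function.iterate_succ_apply']
    generalize M.step^[t] (addGrain c 0) = d at ih hu
    have h1 := ih x
    have h2 : M.received (M.toppled (addGrain c 0) (t + 1)) x =
        M.received (M.toppled (addGrain c 0) t) x +
          ∑ v ∈ M.nbhd, if M.threshold ≤ d (x - v) then M.dist v else 0 := by
      simp only [received, ← Finset.sum_add_distrib]
      refine Finset.sum_congr rfl fun v _ => ?_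
      have hsub := M.toppled_subset_succ (addGrain c 0) t
      by_cases hv : x - v ∈ M.toppled (addGrain c 0) t
      · simp [hu, hv, hsub hv]
      · simp [hu, hv]
    rw [h2, step]
    have hsub : x ∈ M.toppled (addGrain c 0) t → x ∈ M.toppled (addGrain c 0) (t + 1) :=
      fun h => M.toppled_subset_succ (addGrain c 0) t h
    have hux := hu x
    by_cases hx : x ∈ M.toppled (addGrain c 0) t
    · have : ¬M.threshold ≤ d x := by rw [hux]; tauto
      simp only [hx, hsub hx, if_true, this, if_false] at h1 ⊢
      omega
    · by_cases hx' : x ∈ M.toppled (addGrain c 0) (t + 1)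
      · have : M.threshold ≤ d x := by rw [hux]; tauto
        simp only [hx, hx', if_true, this, if_false] at h1 ⊢
        omega
      · have : ¬M.threshold ≤ d x := by rw [hux]; tauto
        simp only [hx, hx', this, if_false] at h1 ⊢
        omega

theorem eventuallyUnstable_iff_toppled (hc : SupportedOnSegment n c) (hs : M.Stable c) (x : ℤ) :
    M.EventuallyUnstable (addGrain c 0) x ↔ ∃ t, x ∈ M.toppled (addGrain c 0) t := by
  constructor
  · rintro ⟨t, ht⟩
    exact ⟨t + 1, ((unstable_iff_of_balance hc hs (balance hc hs t) x).1 ht).1⟩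
  · intro h
    classical
    have h1 := Nat.find_spec h
    have h2 := fun t => Nat.find_min h (m := t)
    generalize Nat.find h = t at h1 h2
    rcases t with _ | t
    · exact absurd h1 (by simp [toppled])
    · exact ⟨t, (unstable_iff_of_balance hc hs (balance hc hs t) x).2 ⟨h1, h2 t (by omega)⟩⟩

/-- The cells that ever become unstable form the least set closed under the local toppling
condition, the condition being imposed on the cells of a segment only. -/
theorem eventuallyUnstable_iff (hc : SupportedOnSegment n c) (hs : M.Stable c) (hn : n ≤ R)
    (hR : 0 < R) (x : ℤ) : M.EventuallyUnstable (addGrain c 0) x ↔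
      ∀ S : Set ℤ, (∀ y ∈ S, 0 ≤ y ∧ y < R) →
        (∀ y : ℤ, 0 ≤ y → y < R → M.threshold ≤ addGrain c 0 y + M.received S y → y ∈ S) → x ∈ S := by
  rw [eventuallyUnstable_iff_toppled hc hs]
  constructor
  · rintro ⟨t, ht⟩ S - hclosed
    suffices h : M.toppled (addGrain c 0) t ⊆ S from h ht
    clear ht
    induction t with
    | zero => exact Set.empty_subset _
    | succ t ih =>
      intro y hy
      refine hclosed y (toppled_nonneg hc _ y hy) (toppled_lt hc hn hR _ y hy) ?_
      have h1 : M.threshold ≤ addGrain c 0 y + M.received (M.toppled (addGrain c 0) t) y := hy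
      exact h1.trans (by have := M.received_mono ih y; omega)
  · intro h
    have hmono : Monotone (M.toppled (addGrain c 0)) :=
      monotone_nat_of_le_succ (M.toppled_subset_succ _)
    have := h (⋃ t, M.toppled (addGrain c 0) t) (fun y hy => by
        obtain ⟨t, ht⟩ := Set.mem_iUnion.1 hy
        exact ⟨toppled_nonneg hc t y ht, toppled_lt hc hn hR t y ht⟩) (fun y _ _ hy => by
        -- The finitely many neighbors of `y` that ever topple have all done so at some finite time.
        have : ∀ v : ℤ, ∃ t, y - v ∈ (⋃ t, M.toppled (addGrain c 0) t) →
            y - v ∈ M.toppled (addGrain c 0) t := fun v => by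
          by_cases hv : y - v ∈ (⋃ t, M.toppled (addGrain c 0) t)
          · obtain ⟨t, ht⟩ := Set.mem_iUnion.1 hv
            exact ⟨t, fun _ => ht⟩
          · exact ⟨0, fun h => absurd h hv⟩
        choose f hf using this
        refine Set.mem_iUnion.2 ⟨M.nbhd.sup f + 1, (hy.trans ?_ : M.threshold ≤ _)⟩
        refine Nat.add_le_add_left (Finset.sum_le_sum fun v hv => ?_) _
        by_cases h1 : y - v ∈ (⋃ t, M.toppled (addGrain c 0) t)
        · have h2 := hmono (Finset.le_sup hv) (hf v h1)
          simp only [h1, h2, if_true, le_refl]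
        · simp only [h1, if_false, Nat.zero_le])
    exact Set.mem_iUnion.1 this

end FirstColumn

end SandpileModel

/-! ### Tree automata with an arbitrary finite set of states -/

namespace TreeAutomaton

section OfFinite

variable {V : Type} [Fintype V]

/-- An encoding of the elements of a finite type by words of length its cardinality. -/
noncomputable def encode (v : V) : List Bool :=
  (List.range (Fintype.card V)).map fun g => decide (g = (Fintype.equivFin V v : ℕ))

theorem length_encode (v : V) : (encode v).length = Fintype.card V := by simp [encode]

theorem encode_injective : Function.Injective (encode : V → List Bool) := by
  intro v v' h
  have h1 := congrArg (fun l => l.getD (Fintype.equivFin V v) false) h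
  have h2 := (Fintype.equivFin V v).2
  simp only [encode, List.getD_eq_getElem?_getD, List.getElem?_map] at h1
  rw [List.getElem?_range h2] at h1
  simp only [Option.map_some, Option.getD_some, decide_true] at h1
  exact (Fintype.equivFin V).injective (Fin.ext (of_decide_eq_true h1.symm))

theorem map_getD_encode (v : V) :
    ((List.range (Fintype.card V)).map fun g => (encode v).getD g false) = encode v := by
  refine List.ext_getElem (by simp [length_encode]) fun i h1 h2 => ?_
  rw [List.getElem_map, List.getElem_range, List.getD_eq_getElem _ _ h2]

variable [Nonempty V]

/-- A left inverse of `encode`. -/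
noncomputable def decode : List Bool → V := Function.invFun encode

theorem decode_encode (v : V) : decode (encode v) = v :=
  Function.leftInverse_invFun encode_injective v

/-- The tree automaton with set of states `V` and the given transition functions. -/
noncomputable def ofFinite (m : ℕ) (leaf : List Bool → V) (node : Bool → V → V → V)
    (accept : V → Bool) : TreeAutomaton m where
  s := Fintype.card V
  s_pos := Fintype.card_pos
  leaf g w := (encode (leaf w)).getD g false
  node g l := (encode (node (l.headD false) (decode (l.tail.take (Fintype.card V)))
    (decode (l.tail.drop (Fintype.card V))))).getD g false
  accept l := accept (decode l)

/-- The state of node `j` of level `e`, as an element of `V`. -/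
def stateIn (leaf : List Bool → V) (node : Bool → V → V → V) (leafWord : ℕ → List Bool)
    (levelBit : ℕ → Bool) : ℕ → ℕ → V
  | 0, j => leaf (leafWord j)
  | e + 1, j => node (levelBit e) (stateIn leaf node leafWord levelBit e (2 * j))
      (stateIn leaf node leafWord levelBit e (2 * j + 1))

theorem state_ofFinite {m : ℕ} (leaf : List Bool → V) (node : Bool → V → V → V)
    (accept : V → Bool) (leafWord : ℕ → List Bool) (levelBit : ℕ → Bool) (e j : ℕ) :
    (ofFinite m leaf node accept).state leafWord levelBit e j =
      encode (stateIn leaf node leafWord levelBit e j) := by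
  induction e generalizing j with
  | zero => exact map_getD_encode _
  | succ e ih =>
    rw [state, ih, ih, stateIn]
    have h : ∀ v v' : V, (encode v ++ encode v').take (Fintype.card V) = encode v ∧
        (encode v ++ encode v').drop (Fintype.card V) = encode v' := fun v v' => by
      constructor
      · rw [List.take_append_of_le_length (by rw [length_encode]), List.take_of_length_le
          (by rw [length_encode])]
      · rw [List.drop_append_of_le_length (by rw [length_encode]), List.drop_of_length_le
          (by rw [length_encode]), List.nil_append]
    simp only [ofFinite, List.headD_cons, List.tail_cons, (h _ _).1, (h _ _).2, decode_encode]
    exact map_getD_encode _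

end OfFinite

end TreeAutomaton

/-! ### Segments of the sandpile as states -/

namespace SandpileModel

variable (M : SandpileModel)

/-- The range of the neighborhood. -/
def radius : ℕ := M.nbhd.sup Int.natAbs

theorem abs_le_radius {v : ℤ} (hv : v ∈ M.nbhd) : -(M.radius : ℤ) ≤ v ∧ v ≤ M.radius := by
  have : v.natAbs ≤ M.radius := Finset.le_sup (f := Int.natAbs) hv
  omega

/-- The restrictions of sets of cells to the `2 * radius` cells next to the border between two cells.
Such a window contains all the neighbors, across the border, of the cells on either side. -/
abbrev Window : Type := Set (Set.Ico (-(M.radius : ℤ)) M.radius)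

/-- The restriction of `S` around the border between the cells `a - 1` and `a`. -/
def window (S : Set ℤ) (a : ℤ) : M.Window := {i | a + i ∈ S}

/-- What a segment of `len` cells lets through: the pairs of windows, just before its first cell and just
after its last cell, of the sets `S` that are closed under toppling at the cells of the segment and
avoid the cells in `avoid`. The cell number `y` of the segment holds `h y` grains. -/
def summary (len : ℕ) (h : ℕ → ℕ) (avoid : ℕ → Prop) : Set (M.Window × M.Window) :=
  {p | ∃ S : Set ℤ, M.window S 0 = p.1 ∧ M.window S len = p.2 ∧
    ∀ y : ℕ, y < len → (M.threshold ≤ h y + M.received S y → (y : ℤ) ∈ S) ∧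
      (avoid y → (y : ℤ) ∉ S)}

/-- Composition of relations between windows. -/
def comp (P Q : Set (M.Window × M.Window)) : Set (M.Window × M.Window) :=
  {p | ∃ q, (p.1, q) ∈ P ∧ (q, p.2) ∈ Q}

theorem received_congr {S T : Set ℤ} {x y : ℤ}
    (h : ∀ z, -(M.radius : ℤ) ≤ z → z ≤ M.radius → (x + z ∈ S ↔ y + z ∈ T)) :
    M.received S x = M.received T y := by
  refine Finset.sum_congr rfl fun v hv => ?_
  have hr := M.abs_le_radius hv
  have := h (-v) (by omega) (by omega)
  rw [← sub_eq_add_neg, ← sub_eq_add_neg] at this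
  classical exact if_congr this rfl rfl

theorem summary_congr {len : ℕ} {h h' : ℕ → ℕ} {a a' : ℕ → Prop} (hh : ∀ i < len, h i = h' i)
    (ha : ∀ i < len, a i ↔ a' i) : M.summary len h a = M.summary len h' a' := by
  ext p
  refine exists_congr fun S => and_congr_right fun _ => and_congr_right fun _ =>
    forall_congr' fun y => forall_congr' fun hy => ?_
  rw [hh y hy, ha y hy]

/-- Sets that have the same window where two segments meet can be glued. -/
theorem summary_add {l l₁ l₂ : ℕ} (hl : l = l₁ + l₂) (h : ℕ → ℕ) (a : ℕ → Prop) :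
    M.summary l h a =
    M.comp (M.summary l₁ h a) (M.summary l₂ (fun i => h (l₁ + i)) fun i => a (l₁ + i)) := by
  subst hl
  ext ⟨p, q⟩
  constructor
  · rintro ⟨S, hp, hq, hS⟩
    refine ⟨M.window S l₁, ⟨S, hp, rfl, fun y hy => hS y (by omega)⟩,
      {z | l₁ + z ∈ S}, ?_, ?_, fun y hy => ?_⟩
    · ext i; simp [window]
    · rw [← hq]; ext i; simp [window, add_assoc]
    · have h1 := hS (l₁ + y) (by omega)
      have h2 : M.received {z | (l₁ : ℤ) + z ∈ S} y = M.received S (l₁ + y : ℕ) :=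
        M.received_congr fun z _ _ => by simp [add_assoc]
      rw [h2]
      simpa using h1
  · rintro ⟨q', ⟨S₁, hp, hq₁, hS₁⟩, S₂, hq₂, hq, hS₂⟩
    simp only at hp hq₁ hq₂ hq
    have hagree : ∀ i : ℤ, -(M.radius : ℤ) ≤ i → i < M.radius → (l₁ + i ∈ S₁ ↔ i ∈ S₂) := by
      intro i h1 h2
      have := Set.ext_iff.1 (hq₁.trans hq₂.symm) ⟨i, h1, h2⟩
      simpa [window] using this
    set S : Set ℤ := {z | if z < l₁ then z ∈ S₁ else z - l₁ ∈ S₂} with hS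
    have hleft : ∀ z : ℤ, z < l₁ + M.radius → (z ∈ S ↔ z ∈ S₁) := by
      intro z hz
      simp only [hS, Set.mem_ofPred_eq]
      split_ifs with h1
      · rfl
      · rw [← hagree (z - l₁) (by omega) (by omega)]; simp
    have hright : ∀ z : ℤ, -(M.radius : ℤ) ≤ z → (l₁ + z ∈ S ↔ z ∈ S₂) := by
      intro z hz
      simp only [hS, Set.mem_ofPred_eq]
      split_ifs with h1
      · exact hagree z hz (by omega)
      · simp
    refine ⟨S, ?_, ?_, fun y hy => ?_⟩
    · rw [← hp]
      ext ⟨i, hi⟩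
      have := hi.2
      exact hleft (0 + i) (by omega)
    · rw [← hq]
      ext ⟨i, hi⟩
      have h1 := hi.1
      have := hright (l₂ + i) (by omega)
      simpa [window, add_assoc] using this
    · rcases Nat.lt_or_ge y l₁ with h1 | h1
      · have h2 : M.received S y = M.received S₁ y :=
          M.received_congr fun z _ hz => hleft _ (by omega)
        rw [h2, hleft y (by omega)]
        exact hS₁ y h1
      · obtain ⟨y, rfl⟩ := Nat.exists_eq_add_of_le h1
        have h2 : M.received S (l₁ + y : ℕ) = M.received S₂ y :=
          M.received_congr fun z hz _ => by
            rw [Nat.cast_add, add_assoc]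
            exact hright _ (by omega)
        rw [h2, Nat.cast_add, hright y (by omega)]
        exact hS₂ y (by omega)

/-- The state of a segment: whether its cells are stable, and its summary, depending on whether a
grain is added on its first cell, and on whether a distinguished cell is avoided. -/
abbrev SegmentState : Type := Bool × (Bool → Bool → Set (M.Window × M.Window))

/-- The number with binary digits `l`, least significant first. -/
def wordVal (l : List Bool) : ℕ := l.foldr (fun b n => Nat.bit b n) 0

/-- The state of a single cell. -/
noncomputable def leafState (l : List Bool) : M.SegmentState :=
  (decide (wordVal l < M.threshold), fun first mark =>
    M.summary 1 (fun _ => wordVal l + if first then 1 else 0) fun _ => mark)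

/-- The state of the union of two adjacent segments; `x` tells whether the distinguished cell is in
the right one. -/
def nodeState (x : Bool) (P Q : M.SegmentState) : M.SegmentState :=
  (P.1 && Q.1, fun first mark => M.comp (P.2 first (mark && !x)) (Q.2 false (mark && x)))

open Classical in
/-- The cells are stable and no closed set contained in the segment avoids the distinguished cell. A
set closed at the cells of the segment may be cut down to it if its windows have no cell outside. -/
noncomputable def acceptState (P : M.SegmentState) : Bool :=
  P.1 && decide (¬∃ p ∈ P.2 true true, (∀ i ∈ p.1, 0 ≤ i.1) ∧ ∀ i ∈ p.2, i.1 < 0)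

/-- The state of the node number `j` of level `e`. It deals with the cells from `2 ^ e * j` on, the
distinguished one being given by the `e` least significant binary digits of `X`. -/
theorem stateIn_eq (leafWord : ℕ → List Bool) (X : ℕ) (e : ℕ) : ∀ j,
    TreeAutomaton.stateIn M.leafState M.nodeState leafWord X.testBit e j =
      (decide (∀ i < 2 ^ e, wordVal (leafWord (2 ^ e * j + i)) < M.threshold), fun first mark =>
        M.summary (2 ^ e)
          (fun i => wordVal (leafWord (2 ^ e * j + i)) + if first = true ∧ i = 0 then 1 else 0)
          fun i => mark = true ∧ i = X % 2 ^ e) := by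
  induction e with
  | zero =>
    intro j
    simp only [TreeAutomaton.stateIn, leafState, pow_zero, Nat.lt_one_iff, forall_eq, one_mul,
      Nat.add_zero, Nat.mod_one]
    refine Prod.ext rfl (funext fun first => funext fun mark => M.summary_congr ?_ ?_)
    · intro i hi
      obtain rfl : i = 0 := by omega
      simp
    · intro i hi
      simp; omega
  | succ e ih =>
    intro j
    have e1 : 2 ^ (e + 1) = 2 ^ e + 2 ^ e := by rw [pow_succ]; ring
    have e2 : 2 ^ e * (2 * j) = 2 ^ (e + 1) * j := by rw [pow_succ]; ring
    have e3 (i : ℕ) : 2 ^ e * (2 * j + 1) + i = 2 ^ (e + 1) * j + (2 ^ e + i) := by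
      rw [pow_succ]; ring
    have hpos : 0 < 2 ^ e := by positivity
    have hmod : X % 2 ^ (e + 1) = X % 2 ^ e + if X.testBit e then 2 ^ e else 0 := by
      rw [Nat.mod_pow_succ, Nat.testBit_eq_decide_div_mod_eq]
      rcases Nat.mod_two_eq_zero_or_one (X / 2 ^ e) with h | h <;> simp [h]
    have hlt : X % 2 ^ e < 2 ^ e := Nat.mod_lt _ hpos
    simp only [TreeAutomaton.stateIn, ih, nodeState, e2, e3]
    refine Prod.ext ?_ (funext fun first => funext fun mark => ?_)
    · simp only [← Bool.decide_and]
      refine decide_eq_decide.2 ⟨fun ⟨h1, h2⟩ i hi => ?_, fun h => ⟨fun i hi => h i (by omega),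
        fun i hi => h _ (by omega)⟩⟩
      rcases Nat.lt_or_ge i (2 ^ e) with h | h
      · exact h1 i h
      · obtain ⟨i, rfl⟩ := Nat.exists_eq_add_of_le h
        exact h2 i (by omega)
    · simp only
      rw [M.summary_add e1]
      congr 1
      · refine M.summary_congr (fun _ _ => rfl) fun i hi => ?_
        rw [hmod]
        cases X.testBit e <;> simp
        omega
      · refine M.summary_congr (fun i _ => ?_) fun i hi => ?_
        · simp
        · rw [hmod]
          cases X.testBit e <;> simp
          · omega
          · omega

end SandpileModel

/-! ### Reading the input -/

section Encoding

theorem testBit_wordVal (l : List Bool) (i : ℕ) :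
    (SandpileModel.wordVal l).testBit i = l.getD i false := by
  induction l generalizing i with
  | nil => simp [SandpileModel.wordVal]
  | cons b l ih =>
    rw [SandpileModel.wordVal, List.foldr_cons]
    cases i with
    | zero => simp
    | succ i => rw [Nat.testBit_bit_succ, List.getD_cons_succ]; exact ih i

theorem wordVal_lt (l : List Bool) : SandpileModel.wordVal l < 2 ^ l.length := by
  refine Nat.lt_pow_two_of_testBit _ fun i hi => ?_
  rw [testBit_wordVal, List.getD_eq_default _ _ hi]

theorem getD_bitsOfWidth {width i : ℕ} (hi : i < width) (m : ℕ) :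
    (bitsOfWidth width m).getD i false = m.testBit i := by
  simp [bitsOfWidth, hi]

theorem wordVal_eq {l : List Bool} {m : ℕ} (hm : m < 2 ^ l.length)
    (h : ∀ i < l.length, l.getD i false = m.testBit i) : SandpileModel.wordVal l = m := by
  refine Nat.eq_of_testBit_eq fun i => ?_
  rw [testBit_wordVal]
  rcases Nat.lt_or_ge i l.length with hi | hi
  · exact h i hi
  · rw [List.getD_eq_default _ _ hi, Nat.testBit_lt_two_pow
      (hm.trans_le (Nat.pow_le_pow_right (by omega) hi))]

namespace SandpileModel

variable (M : SandpileModel) (k n : ℕ) (c : ℤ → ℕ) (x : ℤ)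

/-- In the definition, the list of natural numbers is first coerced to a list of cells; here, the
coercion is applied to its elements. -/
theorem encodeInstance_eq : M.encodeInstance k n c x =
    (List.range n).flatMap (fun i : ℕ => bitsOfWidth M.threshold.size (c i)) ++
      decide (x < 0) :: bitsOfWidth (k * (Nat.log 2 n + 1)) x.natAbs := by
  rw [encodeInstance]
  congr 1
  simp [List.flatMap_assoc]

theorem length_flatMap_bitsOfWidth (B : ℕ) :
    ((List.range n).flatMap fun i : ℕ => bitsOfWidth B (c i)).length = B * n := by
  simp [List.length_flatMap, bitsOfWidth, Nat.mul_comm]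

theorem length_encodeInstance :
    (M.encodeInstance k n c x).length = TreeAutomaton.inputLength M.threshold.size k n := by
  rw [encodeInstance_eq, List.length_append, length_flatMap_bitsOfWidth]
  simp [bitsOfWidth, TreeAutomaton.inputLength]
  omega

theorem encodeInstance_grains {j b : ℕ} (hj : j < n) (hb : b < M.threshold.size) :
    (M.encodeInstance k n c x).getD (M.threshold.size * j + b) false = (c (j : ℤ)).testBit b := by
  have h1 : M.threshold.size * j + b < M.threshold.size * n := by
    calc _ < M.threshold.size * (j + 1) := by rw [Nat.mul_succ]; omega
      _ ≤ _ := Nat.mul_le_mul_left _ hj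
  rw [encodeInstance_eq, List.getD_append _ _ _ _ (by rwa [length_flatMap_bitsOfWidth]),
    List.getD_eq_getElem?_getD, Nat.mul_comm,
    getElem?_flatMap_range (fun i : ℕ => bitsOfWidth M.threshold.size (c (i : ℤ)))
      (fun _ => by simp [bitsOfWidth]) hj hb, ← List.getD_eq_getElem?_getD, getD_bitsOfWidth hb]

theorem encodeInstance_sign :
    (M.encodeInstance k n c x).getD (M.threshold.size * n) false = decide (x < 0) := by
  rw [encodeInstance_eq, List.getD_append_right _ _ _ _ (by rw [length_flatMap_bitsOfWidth]),
    length_flatMap_bitsOfWidth, Nat.sub_self, List.getD_cons_zero]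

theorem encodeInstance_cell {e : ℕ} (he : e < k * (Nat.log 2 n + 1)) :
    (M.encodeInstance k n c x).getD (M.threshold.size * n + 1 + e) false =
      x.natAbs.testBit e := by
  rw [encodeInstance_eq, List.getD_append_right _ _ _ _ (by rw [length_flatMap_bitsOfWidth]; omega),
    length_flatMap_bitsOfWidth, show M.threshold.size * n + 1 + e - M.threshold.size * n = e + 1
      by omega, List.getD_cons_succ, getD_bitsOfWidth he]

end SandpileModel

end Encoding

/-! ### The tree automaton of a sandpile model -/

namespace SandpileModel

variable (M : SandpileModel)

theorem threshold_pos : 0 < M.threshold := by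
  obtain ⟨v, hv, -⟩ := M.exists_pos
  exact (M.dist_pos v hv).trans_le (Finset.single_le_sum (f := M.dist) (fun _ _ => Nat.zero_le _) hv)

/-- The sets of `eventuallyUnstable_iff` restrict to a segment of `R` cells, outside of which they
are empty. -/
theorem exists_summary_iff {R X : ℕ} (hX : X < R) (h : ℕ → ℕ) :
    (∃ p ∈ M.summary R h (fun i => i = X), (∀ i ∈ p.1, 0 ≤ i.1) ∧ ∀ i ∈ p.2, i.1 < 0) ↔
      ∃ S : Set ℤ, (∀ y ∈ S, 0 ≤ y ∧ y < R) ∧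
        (∀ y : ℕ, y < R → M.threshold ≤ h y + M.received S y → (y : ℤ) ∈ S) ∧ (X : ℤ) ∉ S := by
  constructor
  · rintro ⟨⟨P, Q⟩, ⟨S, rfl, rfl, hS⟩, hP, hQ⟩
    refine ⟨{y ∈ S | 0 ≤ y ∧ y < R}, fun y hy => hy.2, fun y hy ht => ?_,
      fun hx => (hS X hX).2 rfl hx.1⟩
    refine ⟨(hS y hy).1 ?_, by omega, by omega⟩
    rwa [M.received_congr (S := S) (T := {y ∈ S | 0 ≤ y ∧ y < R}) (x := y) (y := y)]
    refine fun z h1 h2 => ⟨fun hz => ⟨hz, ?_, ?_⟩, fun hz => hz.1⟩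
    · by_contra! hneg
      have := hP ⟨y + z, by omega, by omega⟩ (by simpa [window] using hz)
      simp only at this
      omega
    · by_contra! hneg
      -- `y + z` lies in the window, since `y` is a cell of the segment.
      rcases lt_or_ge (y + z) (R + M.radius : ℤ) with h3 | h3
      · have := hQ ⟨y + z - R, by omega, by omega⟩ (by simpa [window] using hz)
        simp only at this
        omega
      · omega
  · rintro ⟨S, h1, h2, h3⟩
    refine ⟨(M.window S 0, M.window S R), ⟨S, rfl, rfl, fun y hy => ⟨h2 y hy, ?_⟩⟩,
      fun i hi => ?_, fun i hi => ?_⟩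
    · rintro rfl
      exact h3
    · have := h1 _ hi
      omega
    · have := h1 _ hi
      omega

/-- The automaton accepts the stable configurations for which the given cell becomes unstable. -/
theorem acceptState_stateIn {leafWord : ℕ → List Bool} {c : ℤ → ℕ} {n e X : ℕ}
    (hc : SupportedOnSegment n c) (hn : n ≤ 2 ^ e) (hX : X < 2 ^ e)
    (hleaf : ∀ j < 2 ^ e, wordVal (leafWord j) = c j) :
    M.acceptState
        (TreeAutomaton.stateIn M.leafState M.nodeState leafWord X.testBit e 0) = true ↔
      M.Stable c ∧ M.EventuallyUnstable (addGrain c 0) X := by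
  have hstable : (∀ i < 2 ^ e, wordVal (leafWord i) < M.threshold) ↔ M.Stable c := by
    refine ⟨fun h y => ?_, fun h i hi => (hleaf i hi).symm ▸ h i⟩
    by_cases hy : c y = 0
    · rw [hy]
      exact M.threshold_pos
    · obtain ⟨h1, h2⟩ := hc y hy
      lift y to ℕ using h1
      rw [← hleaf y (by omega)]
      exact h y (by omega)
  rw [stateIn_eq, acceptState]
  simp only [Nat.mul_zero, Nat.zero_add, Bool.and_eq_true, decide_eq_true_eq, true_and,
    Nat.mod_eq_of_lt hX, hstable]
  refine and_congr_right fun hs => ?_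
  rw [M.exists_summary_iff hX, M.eventuallyUnstable_iff hc hs (R := 2 ^ e) hn (by positivity)]
  have hload : ∀ y : ℕ, y < 2 ^ e →
      wordVal (leafWord y) + (if y = 0 then 1 else 0) = addGrain c 0 y := by
    intro y hy
    simp [addGrain, hleaf y hy]
  push Not
  refine forall_congr' fun S => forall_congr' fun _ => imp_congr_left ⟨fun h y h1 h2 => ?_,
    fun h y hy => ?_⟩
  · lift y to ℕ using h1
    have hy : y < 2 ^ e := by exact_mod_cast h2
    rw [← hload y hy]
    exact h y hy
  · rw [hload y hy]
    exact h y (by omega) (by exact_mod_cast hy)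

theorem acceptState_iff (k : ℕ) (w : List Bool) {n X : ℕ} {c : ℤ → ℕ} (hc : SupportedOnSegment n c)
    (hX : X < 2 ^ (k * (Nat.log 2 n + 1)))
    (hleaf : ∀ j < n, wordVal (TreeAutomaton.blockWord M.threshold.size n w j) = c j)
    (hbit : ∀ e < k * (Nat.log 2 n + 1),
      w.getD (M.threshold.size * n + 1 + e) false = X.testBit e) :
    M.acceptState (TreeAutomaton.stateIn M.leafState M.nodeState
        (TreeAutomaton.blockWord M.threshold.size n w)
        (TreeAutomaton.tailBit M.threshold.size k n w) (TreeAutomaton.height k n) 0) = true ↔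
      M.Stable c ∧ M.EventuallyUnstable (addGrain c 0) X := by
  have h1 : TreeAutomaton.tailBit M.threshold.size k n w = X.testBit := by
    funext e
    rw [TreeAutomaton.tailBit]
    split_ifs with he
    · exact hbit e he
    · exact (Nat.testBit_lt_two_pow (hX.trans_le (Nat.pow_le_pow_right (by omega) (by omega)))).symm
  have h2 : k * (Nat.log 2 n + 1) ≤ TreeAutomaton.height k n :=
    Nat.mul_le_mul_right _ (Nat.le_succ k)
  have h3 : Nat.log 2 n + 1 ≤ TreeAutomaton.height k n :=
    Nat.le_mul_of_pos_left _ (Nat.succ_pos k)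
  rw [h1]
  refine M.acceptState_stateIn hc ?_ (hX.trans_le (Nat.pow_le_pow_right (by omega) h2)) ?_
  · exact (Nat.lt_pow_succ_log_self (by omega) n).le.trans (Nat.pow_le_pow_right (by omega) h3)
  · intro j _
    rcases Nat.lt_or_ge j n with hj | hj
    · exact hleaf j hj
    · have h4 : c j = 0 := by
        by_contra h
        have := hc j h
        omega
      rw [h4, TreeAutomaton.blockWord, if_neg (by omega)]
      exact wordVal_eq (by positivity) (by simp)

open TreeAutomaton in
theorem firstColStablePred_mem_NC_one (k : ℕ) :
    M.firstColStablePred k ∈ NC 1 := by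
  have hm : 0 < M.threshold.size := Nat.size_pos.2 M.threshold_pos
  have : Fintype M.SegmentState := Fintype.ofFinite _
  refine (ofFinite M.threshold.size M.leafState M.nodeState M.acceptState).mem_NC_one hm k _
    fun w => ?_
  simp only [state_ofFinite]
  simp only [ofFinite, decode_encode]
  constructor
  · rintro ⟨n, c, x, hc, hs, hx, rfl, hu⟩
    have hx0 : 0 ≤ x := by
      obtain ⟨t, ht⟩ := (M.eventuallyUnstable_iff_toppled hc hs x).1 hu
      exact toppled_nonneg (M := M) hc t x ht
    refine ⟨n, M.length_encodeInstance k n c x, ?_, ?_⟩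
    · rw [encodeInstance_sign]
      exact decide_eq_false (by omega)
    · refine (M.acceptState_iff k _ hc hx ?_ fun e he => M.encodeInstance_cell k n c x he).2 ⟨hs, ?_⟩
      · intro j hj
        rw [blockWord, if_pos (by omega)]
        refine wordVal_eq ?_ fun i hi => ?_
        · simp only [List.length_map, List.length_range]
          exact (hs j).trans (Nat.lt_size_self _)
        · simp only [List.length_map, List.length_range] at hi
          simp [hi, ← M.encodeInstance_grains k n c x hj hi]
      · rwa [Int.natAbs_of_nonneg hx0]
  · rintro ⟨n, hlen, hsign, hacc⟩
    -- The word determines the configuration and the cell that it encodes.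
    set c : ℤ → ℕ := fun z => if 0 ≤ z ∧ z < n then
      wordVal (blockWord M.threshold.size n w z.toNat) else 0 with hcdef
    set X := wordVal (w.drop (M.threshold.size * n + 1)) with hXdef
    have hdrop : (w.drop (M.threshold.size * n + 1)).length = k * (Nat.log 2 n + 1) := by
      rw [List.length_drop, hlen, inputLength]
      omega
    have hc : SupportedOnSegment n c := by
      intro z hz
      by_contra h
      exact hz (if_neg h)
    have hX : X < 2 ^ (k * (Nat.log 2 n + 1)) := hdrop ▸ wordVal_lt _
    have hcell (j : ℕ) (hj : j < n) : c j = wordVal (blockWord M.threshold.size n w j) := by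
      simp [hcdef, hj]
    have hbit (e : ℕ) : w.getD (M.threshold.size * n + 1 + e) false = X.testBit e := by
      rw [hXdef, testBit_wordVal]
      simp [List.getD_eq_getElem?_getD]
    obtain ⟨hs, hu⟩ := (M.acceptState_iff k w hc hX (fun j hj => (hcell j hj).symm)
      fun e _ => hbit e).1 hacc
    refine ⟨n, c, X, hc, hs, by simpa using hX, ?_, hu⟩
    have hlen' := M.length_encodeInstance k n c X
    refine List.ext_getElem (hlen.trans hlen'.symm) fun i h1 h2 => ?_
    rw [← List.getD_eq_getElem _ false h1, ← List.getD_eq_getElem _ false h2]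
    rcases lt_trichotomy i (M.threshold.size * n) with hi | rfl | hi
    · have hj : i / M.threshold.size < n := Nat.div_lt_of_lt_mul hi
      have hb : i % M.threshold.size < M.threshold.size := Nat.mod_lt _ hm
      rw [← Nat.div_add_mod i M.threshold.size, M.encodeInstance_grains k n c X hj hb, hcell _ hj,
        testBit_wordVal, blockWord, if_pos (by omega)]
      simp [hb]
    · rw [encodeInstance_sign, hsign]
      simp
    · obtain ⟨e, rfl⟩ := Nat.exists_eq_add_of_le (Nat.succ_le_of_lt hi)
      have he : e < k * (Nat.log 2 n + 1) := by
        rw [hlen, inputLength] at h1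
        omega
      rw [Nat.succ_eq_add_one, M.encodeInstance_cell k n c X he, hbit, Int.natAbs_natCast]

end SandpileModel

theorem mainTheorem3 (M : SandpileModel) (k : ℕ) :
    M.firstColStablePred k ∈ NC 1 := by
  exact M.firstColStablePred_mem_NC_one k
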